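/- Let $X=(X_t)_{t\ge 0}$ be a $d$-dimensional subordinator on a probability space $(\Omega,\mathcal F,P)$, that is, a càdlàg Lévy process in $\mathbb R^d$ with $X_0=0$ whose coordinates are almost surely non-decreasing. Assume that for every $t>0$ the law of $X_t$ is absolutely continuous with respect to Lebesgue measure. Let $r\in[0,\infty)^d$ satisfy $\sum_{i=1}^d r_i\,E(X^{(i)}_1)\le 1$ (with $0\cdot\infty=0$). Put $Z_u=u-r\cdot X_u$, $\tau_t=\inf\{u\ge 0: Z_u=t\}$ (with $\inf\emptyset=\infty$) and $Y_t=X_{\tau_t}$ for $t\ge 0$. Then: 1. Almost surely $\tau_t<\infty$ for all $t\ge 0$, and $Y$ is, up to modification, a $d$-dimensional subordinator. 2. For every $t>0$ the law of $Y_t$ is absolutely continuous with respect to Lebesgue measure. 3. There exists a canonical family of densities of $X$, that is, a family $p^X_t:[0,\infty)^d\to[0,\infty]$, $t>0$, such that $p^X_t$ is a density of $X_t$ and $p^X_{s+t}(y)=\int_{[0,y]}p^X_s(x)\,p^X_t(y-x)\,dx$ for all $s,t>0$ and all $y\in[0,\infty)^d$, where $[0,y]=\prod_i[0,y_i]$.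 For every such family and every $t>0$, the function $$p^Y_t(y)=\frac{t}{t+r\cdot y}\;p^X_{t+r\cdot y}(y),\qquad y\in[0,\infty)^d,$$ is a density of $Y_t$. If $(t,y)\mapsto p^X_t(y)$ is merely a jointly measurable function such that $p^X_t$ is a density of $X_t$ for every $t>0$, then the same formula gives a density of $Y_t$ for Lebesgue-almost every $t>0$. 4. There are functions $\varphi_X,\varphi_Y:[0,\infty)^d\to[0,\infty)$ (the Laplace exponents of $X$ and $Y$) such that $E(e^{-z\cdot X_t})=e^{-t\varphi_X(z)}$ and $E(e^{-z\cdot Y_t})=e^{-t\varphi_Y(z)}$ for all $t\ge 0$ and $z\in[0,\infty)^d$, and $$\varphi_Y(z)=\varphi_X\big(z+\varphi_Y(z)\,r\big),\qquad z\in[0,\infty)^d.$$ -/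

import Mathlib

open MeasureTheory ProbabilityTheory Set
open scoped NNReal ENNReal

/-- `X` is a `d`-dimensional subordinator under `P`: a Lévy process in `ℝ^d`, started at `0`, whose
coordinates are almost surely non-decreasing. Left limits of the paths exist by monotonicity, so
right-continuity makes them càdlàg. -/
structure IsSubordinator {Ω : Type*} [MeasurableSpace Ω] {d : ℕ} (P : Measure Ω)
    (X : ℝ≥0 → Ω → (Fin d → ℝ)) : Prop where
  measurable : ∀ t, Measurable (X t)
  start : ∀ᵐ ω ∂P, X 0 ω = 0
  indep_increments : HasIndepIncrements X P
  stationary_increments : ∀ s t, IdentDistrib (fun ω => X (s + t) ω - X s ω) (X t) P P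
  monotone : ∀ᵐ ω ∂P, Monotone fun t => X t ω
  right_continuous : ∀ᵐ ω ∂P, ∀ t, ContinuousWithinAt (fun s => X s ω) (Ici t) t

/-- The random vector `V` takes values in `[0,∞)^d` almost surely and has density `f` on `[0,∞)^d`
with respect to Lebesgue measure. Values of `f` outside `[0,∞)^d` are irrelevant. -/
structure HasOrthantDensity {Ω : Type*} [MeasurableSpace Ω] {d : ℕ} (P : Measure Ω)
    (V : Ω → (Fin d → ℝ)) (f : (Fin d → ℝ) → ℝ≥0∞) : Prop where
  aemeasurable : AEMeasurable f (volume.restrict (Ici 0))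
  hasLaw : HasLaw V ((volume.restrict (Ici 0)).withDensity f) P

/-- `p` is the canonical family of densities (transition densities) of the marginals of `X`:
`p t` is a density of `X t` for every `t > 0`, and the semigroup identity
`p (s + t) = p s * p t` (convolution on `[0,∞)^d`) holds at every point of `[0,∞)^d`. -/
structure IsTransitionDensity {Ω : Type*} [MeasurableSpace Ω] {d : ℕ} (P : Measure Ω)
    (X : ℝ≥0 → Ω → (Fin d → ℝ)) (p : ℝ≥0 → (Fin d → ℝ) → ℝ≥0∞) : Prop where
  density : ∀ t, 0 < t → HasOrthantDensity P (X t) (p t)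
  chapman_kolmogorov : ∀ s t, 0 < s → 0 < t → ∀ y : Fin d → ℝ, 0 ≤ y →
    p (s + t) y = ∫⁻ x in Icc 0 y, p s x * p t (y - x)

/-- `φ` is the Laplace exponent on `[0,∞)^d` of the process `X`:
`E exp (-z · X_t) = exp (-t φ(z))`. -/
def IsLaplaceExponent {Ω : Type*} [MeasurableSpace Ω] {d : ℕ} (P : Measure Ω)
    (X : ℝ≥0 → Ω → (Fin d → ℝ)) (φ : (Fin d → ℝ) → ℝ) : Prop :=
  ∀ (t : ℝ≥0) (z : Fin d → ℝ), 0 ≤ z →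
    ∫ ω, Real.exp (-(z ⬝ᵥ X t ω)) ∂P = Real.exp (-((t : ℝ) * φ z))

/-- The process `Z_u = u - r · X_u`. -/
def reservoir {Ω : Type*} {d : ℕ} (r : Fin d → ℝ) (X : ℝ≥0 → Ω → (Fin d → ℝ)) (u : ℝ≥0) (ω : Ω) :
    ℝ :=
  (u : ℝ) - r ⬝ᵥ X u ω

/-- The first passage time `inf {u ≥ 0 : Z_u = t}`, equal to `∞` if there is no such `u`. -/
noncomputable def firstPassageTime {Ω : Type*} (Z : ℝ≥0 → Ω → ℝ) (t : ℝ≥0) (ω : Ω) : ℝ≥0∞ :=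
  ⨅ (u : ℝ≥0) (_ : Z u ω = (t : ℝ)), (u : ℝ≥0∞)

/-- The process `Y_t = X(τ_t)`, where `τ_t` is the first passage time of `u - r · X_u` at `t`
(with an arbitrary value, `X_0`, where `τ_t = ∞`). -/
noncomputable def passageProcess {Ω : Type*} {d : ℕ} (r : Fin d → ℝ)
    (X : ℝ≥0 → Ω → (Fin d → ℝ)) (t : ℝ≥0) (ω : Ω) : Fin d → ℝ :=
  X (firstPassageTime (reservoir r X) t ω).toNNReal ω

/-- The function `y ↦ t / (t + r · y) * p_{t + r · y}(y)`, for `y ∈ [0,∞)^d`. -/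
noncomputable def passageDensity {d : ℕ} (r : Fin d → ℝ) (p : ℝ≥0 → (Fin d → ℝ) → ℝ≥0∞)
    (t : ℝ≥0) (y : Fin d → ℝ) : ℝ≥0∞ :=
  ENNReal.ofReal ((t : ℝ) / ((t : ℝ) + r ⬝ᵥ y)) * p (Real.toNNReal ((t : ℝ) + r ⬝ᵥ y)) y

/-!
Write `Z_u = u - r · X_u` and `σ_t = inf {u : Z_u > t}`. As `Z` is right-continuous and increases
at most at unit speed, `Z (σ_t) = t`, that is, `σ_t = t + r · Y_t` for `Y_t = X (σ_t)`. Unlike the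
hitting time of `t`, the time `σ_t` is measurable, monotone and right-continuous in `t` on every
path; it agrees with the hitting time almost surely for each `t`
(`IsPassageReady.firstPassageTime_ae_eq`). Everything is proved for `σ_t`, for a version of `X`
all of whose paths are regular (`IsSubordinator.exists_isPassageReady`), and by approximation
along the grids `2⁻ᵐ ℕ`, on which `σ_t` is a stopping time of a random walk.

*The passage process.* Let `φ` be the Laplace exponent of `X`. Since `r · X_1` has mean at most
`1` and no atom at `1`, `φ(c r) < c` for `c > 0`, and optional stopping of `exp (c Z_k - (c - φ(c
r)) k)` with `c → 0` shows that `Z` exceeds every level (`IsSubcritical.ae_exceeds`). By the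
intermediate value theorem `φ(z + c r) = c` has a solution `c`
(`IsSubcritical.exists_laplaceExponent_eq`). Then `exp (-z · X_u + c Z_u)` is a martingale,
bounded up to time `σ_t`, and optional stopping yields `E (exp (-z · (Y_t - Y_s)) | Y_v, v ≤ s) =
exp (-(t - s) c)`. So `Y` is a subordinator with exponent `c` at `z`
(`IsPassageReady.isSubordinator_crossProcess`, `IsPassageReady.lintegral_lexp_crossProcess`).
Laplace transforms at the points of `ℕ^d` determine laws on the orthant (`ext_of_lintegral_lexp`).

*The density at almost every time.* The increments of `X` over a grid are exchangeable, and in the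
average over their cyclic rotations the height by which `Z_{nh}` exceeds the earlier values of `Z`
on the grid `h ℕ` is `Z_{nh}⁺ / n` (`sum_ladder_cyclic`,
`IsRegularSubordinator.lintegral_ladder`). As `h → 0` this becomes Kendall's identity
`IsPassageReady.kendall`: `(σ_t, Y_t)` under `dt` has the law of `(u, X_u)` under `(Z_u⁺ / u) du`.
The substitution `u = t + r · y` turns it into the asserted density `q_t(y) = t / (t + r · y) p_{t
+ r · y}(y)` for almost every `t` (`IsPassageReady.ae_map_crossProcess`).

*The density at every time.* Canonical densities are `p_t = f_{t/2} ⋆ f_{t/2}` for any jointly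
measurable densities `f`, and they are unique at every point (`exists_isSemigroupDensity`,
`IsSemigroupDensity.eq_of_isTransitionDensity`). Decomposing `X_u` at the passage of a level `s`
at which the formula is known gives `p_u(y) = ∫ q_s(x) p_{u - s - r · x}(y - x) dx` at every `y`
with `r · y < u - s` (`IsPassageReady.eq_lintegral_passageDensity`). With `u = s + t + r · y` and
the partial fractions `1 / (v (u - v)) = (1 / u) (1 / v + 1 / (u - v))`, this implies `q_s ⋆ q_t =
q_{s + t}` (`IsPassageReady.passageDensity_lconvolution`). As `Y` has stationary and independent
increments, the formula at `s` and `t - s`, for a suitable `s < t`, implies the formula at `t`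
(`IsPassageReady.map_crossProcess`).
-/

/-! ### Laplace transforms on the orthant -/

/-- The function `x ↦ exp (-z · x)`, with values in `[0,∞]`. -/
noncomputable def lexp {d : ℕ} (z x : Fin d → ℝ) : ℝ≥0∞ := ENNReal.ofReal (Real.exp (-(z ⬝ᵥ x)))

section lexp

variable {d : ℕ}

lemma continuous_dotProduct_right (z : Fin d → ℝ) : Continuous fun x : Fin d → ℝ => z ⬝ᵥ x := by
  unfold dotProduct; fun_prop

@[fun_prop]
lemma measurable_dotProduct_right (z : Fin d → ℝ) : Measurable fun x : Fin d → ℝ => z ⬝ᵥ x :=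
  (continuous_dotProduct_right z).measurable

lemma continuous_lexp (z : Fin d → ℝ) : Continuous (lexp z) := by
  unfold lexp
  exact ENNReal.continuous_ofReal.comp
    (Real.continuous_exp.comp (continuous_dotProduct_right z).neg)

@[fun_prop]
lemma measurable_lexp (z : Fin d → ℝ) : Measurable (lexp z) := (continuous_lexp z).measurable

lemma lexp_add (z x y : Fin d → ℝ) : lexp z (x + y) = lexp z x * lexp z y := by
  unfold lexp
  rw [← ENNReal.ofReal_mul (Real.exp_nonneg _), ← Real.exp_add, dotProduct_add, neg_add]

@[simp]
lemma lexp_zero_left (x : Fin d → ℝ) : lexp 0 x = 1 := by simp [lexp]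

@[simp]
lemma lexp_zero_right (z : Fin d → ℝ) : lexp z 0 = 1 := by simp [lexp]

lemma lexp_ne_top (z x : Fin d → ℝ) : lexp z x ≠ ∞ := ENNReal.ofReal_ne_top

lemma lexp_ne_zero (z x : Fin d → ℝ) : lexp z x ≠ 0 := by
  simp [lexp, Real.exp_pos]

lemma lexp_le_one {z x : Fin d → ℝ} (hz : 0 ≤ z) (hx : 0 ≤ x) : lexp z x ≤ 1 := by
  unfold lexp
  rw [ENNReal.ofReal_le_one, Real.exp_le_one_iff]
  have : 0 ≤ z ⬝ᵥ x := dotProduct_nonneg_of_nonneg hz hx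
  linarith

lemma dotProduct_le_dotProduct_right {z x y : Fin d → ℝ} (hz : 0 ≤ z) (hxy : x ≤ y) :
    z ⬝ᵥ x ≤ z ⬝ᵥ y :=
  dotProduct_le_dotProduct_of_nonneg_left hxy hz

lemma lexp_le_lexp {z x y : Fin d → ℝ} (hz : 0 ≤ z) (hxy : x ≤ y) : lexp z y ≤ lexp z x := by
  unfold lexp
  gcongr
  exact dotProduct_le_dotProduct_right hz hxy

/-- The exponential monomials `x ↦ exp (-n · x)`, `n ∈ ℕ^d`, as bounded continuous functions on
`[0,∞)^d`. -/
noncomputable def expMonomial (n : Fin d → ℕ) : BoundedContinuousFunction (Fin d → ℝ≥0) ℝ :=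
  BoundedContinuousFunction.ofNormedAddCommGroup
    (fun x => Real.exp (-((fun i => (n i : ℝ)) ⬝ᵥ fun i => (x i : ℝ))))
    (by unfold dotProduct; fun_prop) 1 (by
      intro x
      rw [Real.norm_eq_abs, Real.abs_exp, Real.exp_le_one_iff, neg_nonpos]
      exact dotProduct_nonneg_of_nonneg (fun i => Nat.cast_nonneg _) (fun i => NNReal.coe_nonneg _))

lemma expMonomial_apply (n : Fin d → ℕ) (x : Fin d → ℝ≥0) :
    expMonomial n x = Real.exp (-((fun i => (n i : ℝ)) ⬝ᵥ fun i => (x i : ℝ))) := rfl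

/-- The exponential monomials form a multiplicative monoid. -/
noncomputable def expMonoid (d : ℕ) : Submonoid (BoundedContinuousFunction (Fin d → ℝ≥0) ℝ) where
  carrier := range expMonomial
  one_mem' := ⟨0, by ext x; simp [expMonomial_apply, dotProduct]⟩
  mul_mem' := by
    rintro _ _ ⟨n, rfl⟩ ⟨m, rfl⟩
    refine ⟨n + m, ?_⟩
    ext x
    simp only [BoundedContinuousFunction.coe_mul, Pi.mul_apply, expMonomial_apply, ← Real.exp_add,
      dotProduct, ← neg_add, ← Finset.sum_add_distrib, Pi.add_apply, Nat.cast_add, add_mul]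

/-- The algebra of exponential polynomials on `[0,∞)^d`. -/
noncomputable def expAlgebra (d : ℕ) :
    StarSubalgebra ℝ (BoundedContinuousFunction (Fin d → ℝ≥0) ℝ) where
  toSubalgebra := Algebra.adjoin ℝ (expMonoid d : Set _)
  star_mem' := by
    intro a ha
    have : star a = a := by ext x; simp
    rwa [this]

/-- By Stone–Weierstrass, a finite measure on `[0,∞)^d` is determined by the values of its Laplace
transform at the integer points. -/
lemma ext_of_integral_expMonomial {μ ν : Measure (Fin d → ℝ≥0)} [IsFiniteMeasure μ]
    [IsFiniteMeasure ν] (h : ∀ n, ∫ x, expMonomial n x ∂μ = ∫ x, expMonomial n x ∂ν) : μ = ν := by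
  refine ext_of_forall_mem_subalgebra_integral_eq_of_polish (𝕜 := ℝ) (A := expAlgebra d) ?_ ?_
  · intro x y hxy
    obtain ⟨i, hi⟩ := Function.ne_iff.1 hxy
    refine ⟨_, ⟨BoundedContinuousFunction.toContinuousMapStarₐ ℝ (expMonomial (Pi.single i 1)),
      ⟨_, Algebra.subset_adjoin ⟨_, rfl⟩, rfl⟩, rfl⟩, ?_⟩
    have key : ∀ w : Fin d → ℝ≥0, expMonomial (Pi.single i 1) w = Real.exp (-(w i : ℝ)) := by
      intro w
      rw [expMonomial_apply]
      congr 2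
      simp [dotProduct, Pi.single_apply]
    change expMonomial (Pi.single i 1) x ≠ expMonomial (Pi.single i 1) y
    rw [key, key]
    intro h
    apply hi
    have := Real.exp_injective h
    exact_mod_cast neg_injective this
  · intro g hg
    have hg' : g ∈ Submodule.span ℝ (expMonoid d : Set _) := by
      have : g ∈ Subalgebra.toSubmodule (Algebra.adjoin ℝ (expMonoid d : Set _)) := hg
      rwa [Algebra.adjoin_eq_span, Submonoid.closure_eq] at this
    clear hg
    induction hg' using Submodule.span_induction with
    | mem x hx => obtain ⟨n, rfl⟩ := hx; exact h n
    | zero => simp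
    | add x y _ _ hx hy =>
      simp only [BoundedContinuousFunction.coe_add, Pi.add_apply]
      rw [integral_add (x.integrable _) (y.integrable _), integral_add (x.integrable _)
        (y.integrable _), hx, hy]
    | smul a x _ hx =>
      have key : ∀ m : Measure (Fin d → ℝ≥0), ∫ w, (a • x) w ∂m = a * ∫ w, x w ∂m :=
        fun m => integral_const_mul a x
      rw [key, key, hx]

/-- Two finite measures carried by the orthant `[0,∞)^d` whose Laplace transforms agree at the
points of `ℕ^d` are equal. -/
theorem ext_of_lintegral_lexp {μ ν : Measure (Fin d → ℝ)} [IsFiniteMeasure μ] [IsFiniteMeasure ν]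
    (hμ : ∀ᵐ x ∂μ, 0 ≤ x) (hν : ∀ᵐ x ∂ν, 0 ≤ x)
    (h : ∀ n : Fin d → ℕ,
      ∫⁻ x, lexp (fun i => (n i : ℝ)) x ∂μ = ∫⁻ x, lexp (fun i => (n i : ℝ)) x ∂ν) :
    μ = ν := by
  set f : (Fin d → ℝ) → (Fin d → ℝ≥0) := fun x i => (x i).toNNReal with hf
  set g : (Fin d → ℝ≥0) → (Fin d → ℝ) := fun x i => (x i : ℝ) with hg
  have hfm : Measurable f := by fun_prop
  have hgm : Measurable g := by fun_prop
  have hfg : ∀ x : Fin d → ℝ, 0 ≤ x → g (f x) = x := by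
    intro x hx
    ext i
    simpa [f, g] using hx i
  have back : ∀ m : Measure (Fin d → ℝ), (∀ᵐ x ∂m, 0 ≤ x) → (m.map f).map g = m := by
    intro m hm
    rw [Measure.map_map hgm hfm]
    conv_rhs => rw [← Measure.map_id (μ := m)]
    refine Measure.map_congr ?_
    filter_upwards [hm] with x hx using hfg x hx
  rw [← back μ hμ, ← back ν hν]
  congr 1
  refine ext_of_integral_expMonomial fun n => ?_
  have key : ∀ m : Measure (Fin d → ℝ), (∀ᵐ x ∂m, 0 ≤ x) →
      ∫ x, expMonomial n x ∂(m.map f) = (∫⁻ x, lexp (fun i => (n i : ℝ)) x ∂m).toReal := by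
    intro m hm
    rw [integral_map hfm.aemeasurable
      (expMonomial n).continuous.stronglyMeasurable.aestronglyMeasurable,
      integral_eq_lintegral_of_nonneg_ae]
    · congr 1
      refine lintegral_congr_ae ?_
      filter_upwards [hm] with x hx
      have := hfg x hx
      simp only [hg] at this
      rw [expMonomial_apply, this, lexp]
    · exact Filter.Eventually.of_forall fun x => (Real.exp_pos _).le
    · exact ((expMonomial n).continuous.measurable.comp hfm).aestronglyMeasurable
  rw [key μ hμ, key ν hν, h n]

end lexp

/-! ### Subordinators: regular versions, independence of the past, Laplace exponents -/

/-- A monotone additive function on `[0,∞)` is linear. -/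
lemma eq_mul_of_monotone_of_additive {g : ℝ≥0 → ℝ} (hadd : ∀ s t, g (s + t) = g s + g t)
    (hmono : Monotone g) (t : ℝ≥0) : g t = t * g 1 := by
  have h0 : g 0 = 0 := by simpa using hadd 0 0
  have hmul : ∀ (n : ℕ) (s : ℝ≥0), g (n * s) = n * g s := by
    intro n s
    induction n with
    | zero => simp [h0]
    | succ n ih => rw [Nat.cast_succ, add_mul, hadd, ih, one_mul]; push_cast; ring
  have h1 : 0 ≤ g 1 := by rw [← h0]; exact hmono zero_le_one
  have key : ∀ n : ℕ, 0 < n → |g t - t * g 1| ≤ g 1 / n := by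
    intro n hn
    have hn' : (0 : ℝ) < n := by exact_mod_cast hn
    have hfl := Nat.floor_le (a := (n * t : ℝ≥0)) zero_le
    have hlt := (Nat.lt_floor_add_one (n * t : ℝ≥0)).le
    have e1 := hmono hfl
    have e2 := hmono hlt
    have c1 : ∀ m : ℕ, g m = m * g 1 := fun m => by simpa using hmul m 1
    rw [c1, hmul] at e1
    rw [hmul, hadd, c1] at e2
    have f1 : ((⌊(n * t : ℝ≥0)⌋₊ : ℕ) : ℝ) ≤ n * t := by exact_mod_cast hfl
    have f2 : (n * t : ℝ) ≤ (⌊(n * t : ℝ≥0)⌋₊ : ℕ) + 1 := by exact_mod_cast hlt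
    have hb : |(g t - t * g 1) * n| ≤ g 1 := by
      rw [abs_le]
      constructor <;> nlinarith
    rwa [abs_mul, Nat.abs_cast, ← le_div_iff₀ hn'] at hb
  have hlim : Filter.Tendsto (fun n : ℕ => g 1 / n) Filter.atTop (nhds 0) :=
    tendsto_const_div_atTop_nhds_zero_nat _
  have : |g t - t * g 1| ≤ 0 := by
    refine ge_of_tendsto hlim ?_
    filter_upwards [Filter.eventually_gt_atTop 0] with n hn using key n hn
  exact sub_eq_zero.1 (abs_nonpos_iff.1 this)

section Independence

variable {Ω E : Type*} [MeasurableSpace E]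

/-- The σ-algebra generated by the values of a process at the times `t 0, …, t k`. -/
@[reducible]
def pastSigma (X : ℝ≥0 → Ω → E) (t : ℕ → ℝ≥0) (k : ℕ) : MeasurableSpace Ω :=
  MeasurableSpace.comap (fun ω (j : Fin (k + 1)) => X (t j) ω) inferInstance

lemma measurable_pastSigma {X : ℝ≥0 → Ω → E} {t : ℕ → ℝ≥0} {j k : ℕ} (hjk : j ≤ k) :
    Measurable[pastSigma X t k] (X (t j)) := by
  have : X (t j) = (fun v : Fin (k + 1) → E => v ⟨j, Nat.lt_succ_of_le hjk⟩) ∘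
      (fun ω (j : Fin (k + 1)) => X (t j) ω) := rfl
  rw [this]
  exact (measurable_pi_apply _).comp (comap_measurable _)

lemma pastSigma_le [mΩ : MeasurableSpace Ω] {X : ℝ≥0 → Ω → E} (hX : ∀ t, Measurable (X t))
    (t : ℕ → ℝ≥0) (k : ℕ) : pastSigma X t k ≤ mΩ :=
  (measurable_pi_lambda _ fun _ => hX _).comap_le

lemma pastSigma_mono (X : ℝ≥0 → Ω → E) (t : ℕ → ℝ≥0) {j k : ℕ} (hjk : j ≤ k) :
    pastSigma X t j ≤ pastSigma X t k := by
  refine Measurable.comap_le ?_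
  exact @measurable_pi_lambda _ _ _ (pastSigma X t k) _ _
    fun i => measurable_pastSigma (by omega)

variable [MeasurableSpace Ω] {P : Measure Ω}

/-- A sequence of random variables, each of which is independent of the tuple of its predecessors,
is independent. -/
lemma iIndepFun_of_indepFun_prefix [IsProbabilityMeasure P] {ξ : ℕ → Ω → E}
    (h : ∀ k, IndepFun (fun ω (j : Fin k) => ξ j ω) (ξ k) P) :
    iIndepFun ξ P := by
  have main : ∀ (s : ℕ → Set E), (∀ i, MeasurableSet (s i)) → ∀ n : ℕ,
      P (⋂ i ∈ Finset.range n, ξ i ⁻¹' s i) = ∏ i ∈ Finset.range n, P (ξ i ⁻¹' s i) := by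
    intro s hs n
    induction n with
    | zero => simp
    | succ n ih =>
      rw [Finset.prod_range_succ, ← ih]
      have h1 := (h n).measure_inter_preimage_eq_mul (Set.univ.pi fun j : Fin n => s j) (s n)
        (MeasurableSet.univ_pi fun j => hs j) (hs n)
      have h2 : (fun ω (j : Fin n) => ξ j ω) ⁻¹' (Set.univ.pi fun j : Fin n => s j)
          = ⋂ i ∈ Finset.range n, ξ i ⁻¹' s i := by
        ext ω
        simp only [mem_preimage, mem_pi, mem_univ, forall_true_left, mem_iInter, Finset.mem_range]
        exact ⟨fun H i hi => H ⟨i, hi⟩, fun H i => H i i.2⟩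
      rw [h2] at h1
      rw [← h1]
      congr 1
      ext ω
      simp only [mem_iInter, Finset.mem_range, mem_preimage, mem_inter_iff]
      exact ⟨fun H => ⟨fun i hi => H i (by omega), H n (by omega)⟩, fun H i hi => by
        rcases Nat.lt_succ_iff_lt_or_eq.1 hi with hi | rfl
        · exact H.1 i hi
        · exact H.2⟩
  rw [iIndepFun_iff_measure_inter_preimage_eq_mul]
  intro S sets hsets
  classical
  obtain ⟨n, hn⟩ := S.exists_nat_subset_range
  have h1 := main (fun i => if i ∈ S then sets i else univ) (fun i => by
    by_cases hi : i ∈ S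
    · simpa [hi] using hsets i hi
    · simp [hi]) n
  have h2 : (⋂ i ∈ Finset.range n, ξ i ⁻¹' (if i ∈ S then sets i else univ))
      = ⋂ i ∈ S, ξ i ⁻¹' sets i := by
    ext ω
    simp only [mem_iInter, mem_preimage]
    constructor
    · intro H i hi
      simpa [hi] using H i (hn hi)
    · intro H i _
      by_cases hi : i ∈ S
      · simpa [hi] using H i hi
      · simp [hi]
  rw [h2] at h1
  rw [h1, ← Finset.prod_subset hn]
  · exact Finset.prod_congr rfl fun i hi => by simp [hi]
  · intro i _ hi
    simp [hi]

/-- A process has independent increments as soon as each increment over a finite set of times is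
independent of the values of the process up to the start of that increment. -/
lemma HasIndepIncrements.of_indep_pastSigma [IsProbabilityMeasure P] {d : ℕ}
    {X : ℝ≥0 → Ω → (Fin d → ℝ)}
    (h : ∀ t : ℕ → ℝ≥0, Monotone t → ∀ k, IndepFun (fun ω (j : Fin (k + 1)) => X (t j) ω)
      (fun ω => X (t (k + 1)) ω - X (t k) ω) P) :
    HasIndepIncrements X P := by
  refine HasIndepIncrements.of_nat fun t ht _ => iIndepFun_of_indepFun_prefix fun k => ?_
  have : (fun ω (j : Fin k) => X (t (j + 1)) ω - X (t j) ω) =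
      (fun (v : Fin (k + 1) → (Fin d → ℝ)) (j : Fin k) => v j.succ - v j.castSucc) ∘
        (fun ω (j : Fin (k + 1)) => X (t j) ω) := by
    ext ω j
    simp
  rw [this]
  exact (h t ht k).comp (φ := fun (v : Fin (k + 1) → (Fin d → ℝ)) (j : Fin k) =>
    v j.succ - v j.castSucc) (by fun_prop) measurable_id

end Independence

section Subordinator

variable {Ω : Type*} [MeasurableSpace Ω] {P : Measure Ω} {d : ℕ}
  {X : ℝ≥0 → Ω → (Fin d → ℝ)}

/-- A subordinator all of whose paths start at `0`, are non-decreasing and right-continuous. -/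
structure IsRegularSubordinator (P : Measure Ω) (X : ℝ≥0 → Ω → (Fin d → ℝ)) : Prop
    extends IsSubordinator P X where
  start_zero : ∀ ω, X 0 ω = 0
  mono : ∀ ω, Monotone fun t => X t ω
  rightCts : ∀ ω t, ContinuousWithinAt (fun s => X s ω) (Ici t) t

/-- Setting all exceptional paths to `0` makes a subordinator regular; any further almost sure
property `Q` of the paths may be imposed at the same time. -/
lemma IsSubordinator.exists_regular (hX : IsSubordinator P X) {Q : Ω → Prop}
    (hQ : ∀ᵐ ω ∂P, Q ω) :
    ∃ X' : ℝ≥0 → Ω → (Fin d → ℝ), IsRegularSubordinator P X' ∧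
      (∀ᵐ ω ∂P, ∀ t, X' t ω = X t ω) ∧
      ∀ ω, (∀ t, X' t ω = 0) ∨ (Q ω ∧ ∀ t, X' t ω = X t ω) := by
  have hgood : ∀ᵐ ω ∂P, Q ω ∧ X 0 ω = 0 ∧ (Monotone fun t => X t ω) ∧
      ∀ t, ContinuousWithinAt (fun s => X s ω) (Ici t) t := by
    filter_upwards [hQ, hX.start, hX.monotone, hX.right_continuous] with ω h1 h2 h3 h4
      using ⟨h1, h2, h3, h4⟩
  obtain ⟨G, hGsub, hGm, hGnull⟩ : ∃ G : Set Ω, (∀ ω ∈ G, Q ω ∧ X 0 ω = 0 ∧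
      (Monotone fun t => X t ω) ∧ ∀ t, ContinuousWithinAt (fun s => X s ω) (Ici t) t) ∧
      MeasurableSet G ∧ ∀ᵐ ω ∂P, ω ∈ G := by
    obtain ⟨N, hN, hNm, hN0⟩ := exists_measurable_superset_of_null (ae_iff.1 hgood)
    refine ⟨Nᶜ, fun ω hω => ?_, hNm.compl, measure_eq_zero_iff_ae_notMem.1 hN0⟩
    by_contra hcon
    exact hω (hN hcon)
  classical
  set X' : ℝ≥0 → Ω → (Fin d → ℝ) := fun t => G.indicator (X t) with hX'
  have hpos : ∀ ω ∈ G, ∀ t, X' t ω = X t ω := fun ω hω t => indicator_of_mem hω _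
  have hneg : ∀ ω ∉ G, ∀ t, X' t ω = 0 := fun ω hω t => indicator_of_notMem hω _
  have hae : ∀ᵐ ω ∂P, ∀ t, X' t ω = X t ω := by
    filter_upwards [hGnull] with ω hω using hpos ω hω
  have hae' : ∀ t, X' t =ᵐ[P] X t := fun t => by filter_upwards [hae] with ω hω using hω t
  have hfun : ∀ ω, (ω ∈ G ∧ (fun t => X' t ω) = fun t => X t ω) ∨
      (ω ∉ G ∧ (fun t => X' t ω) = fun _ => 0) := fun ω => by
    by_cases hω : ω ∈ G
    · exact Or.inl ⟨hω, funext (hpos ω hω)⟩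
    · exact Or.inr ⟨hω, funext (hneg ω hω)⟩
  have hstart : ∀ ω, X' 0 ω = 0 := fun ω => by
    by_cases hω : ω ∈ G
    · rw [hpos ω hω]; exact (hGsub ω hω).2.1
    · exact hneg ω hω 0
  have hmono : ∀ ω, Monotone fun t => X' t ω := fun ω => by
    rcases hfun ω with ⟨hω, h⟩ | ⟨hω, h⟩ <;> rw [h]
    · exact (hGsub ω hω).2.2.1
    · exact monotone_const
  have hrc : ∀ ω t, ContinuousWithinAt (fun s => X' s ω) (Ici t) t := fun ω t => by
    rcases hfun ω with ⟨hω, h⟩ | ⟨hω, h⟩ <;> rw [h]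
    · exact (hGsub ω hω).2.2.2 t
    · exact continuousWithinAt_const
  have hmeas : ∀ t, Measurable (X' t) := fun t => (hX.measurable t).indicator hGm
  refine ⟨X', ⟨⟨hmeas, ae_of_all _ hstart, ?_, ?_, ae_of_all _ hmono, ae_of_all _ hrc⟩,
    hstart, hmono, hrc⟩, hae, fun ω => ?_⟩
  · intro n t ht
    refine (iIndepFun_congr fun i => ?_).1 (hX.indep_increments n t ht)
    filter_upwards [hae] with ω hω
    rw [hω, hω]
  · intro s t
    have h1 : (fun ω => X' (s + t) ω - X' s ω) =ᵐ[P] fun ω => X (s + t) ω - X s ω := by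
      filter_upwards [hae] with ω hω
      rw [hω, hω]
    have hm1 : Measurable fun ω => X' (s + t) ω - X' s ω := (hmeas _).sub (hmeas _)
    have hm2 : Measurable fun ω => X (s + t) ω - X s ω := (hX.measurable _).sub (hX.measurable _)
    exact ((IdentDistrib.of_ae_eq hm1.aemeasurable h1).trans (hX.stationary_increments s t)).trans
      (IdentDistrib.of_ae_eq (hX.measurable t).aemeasurable (hae' t).symm)
  · by_cases hω : ω ∈ G
    · exact Or.inr ⟨(hGsub ω hω).1, hpos ω hω⟩
    · exact Or.inl (hneg ω hω)

lemma IsSubordinator.ae_nonneg (hX : IsSubordinator P X) : ∀ᵐ ω ∂P, ∀ t, 0 ≤ X t ω := by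
  filter_upwards [hX.start, hX.monotone] with ω h0 hm t
  rw [← h0]
  exact hm (zero_le)

lemma IsRegularSubordinator.nonneg (hX : IsRegularSubordinator P X) (t : ℝ≥0) (ω : Ω) :
    0 ≤ X t ω := by
  rw [← hX.start_zero ω]
  exact hX.mono ω zero_le

/-- The increments of a regular subordinator along a sequence of times starting at `0` are
independent of the past. -/
lemma IsRegularSubordinator.indep_pastSigma (hX : IsRegularSubordinator P X)
    {t : ℕ → ℝ≥0} (ht : Monotone t) (ht0 : t 0 = 0) (k : ℕ) (u : ℝ≥0) :
    Indep (pastSigma X t k)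
      (MeasurableSpace.comap (fun ω => X (t k + u) ω - X (t k) ω) inferInstance) P := by
  -- the times `t 0, …, t k`, followed by `t k + u`
  set t' : ℕ → ℝ≥0 := fun j => if j ≤ k then t j else t k + u with ht'
  have hmono : Monotone t' := by
    intro i j hij
    simp only [ht']
    split_ifs with h1 h2 h2
    · exact ht hij
    · exact (ht h1).trans (le_add_of_nonneg_right zero_le)
    · omega
    · exact le_rfl
  set ξ : ℕ → Ω → (Fin d → ℝ) := fun i ω => X (t' (i + 1)) ω - X (t' i) ω with hξ
  have hind : iIndepFun ξ P := hX.indep_increments.nat hmono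
  have h1 := hind.indepFun_finset (Finset.range k) {k} (by simp)
    (fun i => (hX.measurable _).sub (hX.measurable _))
  have hψ : Measurable fun (v : ({k} : Finset ℕ) → (Fin d → ℝ)) => v ⟨k, by simp⟩ :=
    measurable_pi_apply _
  have h2 := h1.comp (φ := fun (v : Finset.range k → (Fin d → ℝ)) (j : Fin (k + 1)) =>
      ∑ i : Fin j, v ⟨i, by simp; omega⟩)
    (by fun_prop) hψ
  have e1 : (fun (v : Finset.range k → (Fin d → ℝ)) (j : Fin (k + 1)) =>
      ∑ i : Fin j, v ⟨i, by simp; omega⟩) ∘ (fun ω (i : Finset.range k) => ξ i ω)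
      = fun ω (j : Fin (k + 1)) => X (t j) ω := by
    ext ω j
    simp only [Function.comp_apply, hξ]
    rw [Finset.sum_apply,
      Fin.sum_univ_eq_sum_range (fun i => (X (t' (i + 1)) ω - X (t' i) ω) _) (j : ℕ)]
    have : ∀ n, n ≤ k → ∑ i ∈ Finset.range n, (X (t' (i + 1)) ω - X (t' i) ω) ‹Fin d›
        = X (t n) ω ‹Fin d› := by
      intro n hn
      have := Finset.sum_range_sub (fun i => X (t' i) ω ‹Fin d›) n
      simp only [Pi.sub_apply]
      rw [this]
      simp [ht', hn, ht0, hX.start_zero]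
    exact this j (by omega)
  have e2 : (fun (v : ({k} : Finset ℕ) → (Fin d → ℝ)) => v ⟨k, by simp⟩) ∘
      (fun ω (i : ({k} : Finset ℕ)) => ξ i ω) = fun ω => X (t k + u) ω - X (t k) ω := by
    ext ω
    simp [hξ, ht']
  rw [e1, e2] at h2
  exact h2

lemma IsSubordinator.lintegral_lexp_add (hX : IsSubordinator P X) (s t : ℝ≥0) (z : Fin d → ℝ) :
    ∫⁻ ω, lexp z (X (s + t) ω) ∂P = (∫⁻ ω, lexp z (X s ω) ∂P) * ∫⁻ ω, lexp z (X t ω) ∂P := by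
  have hind := hX.indep_increments.indepFun_eval_sub (zero_le (a := s))
    (le_add_of_nonneg_right (zero_le (a := t)) : s ≤ s + t) hX.start
  have h1 : ∫⁻ ω, lexp z (X (s + t) ω) ∂P
      = ∫⁻ ω, ((lexp z ∘ X s) * (lexp z ∘ (X (s + t) - X s))) ω ∂P := by
    refine lintegral_congr fun ω => ?_
    simp only [Pi.mul_apply, Function.comp_apply, Pi.sub_apply]
    rw [← lexp_add]
    congr 1
    abel
  rw [h1, lintegral_mul_eq_lintegral_mul_lintegral_of_indepFun
    ((measurable_lexp z).comp (hX.measurable s))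
    ((measurable_lexp z).comp ((hX.measurable _).sub (hX.measurable _)))
    (hind.comp (measurable_lexp z) (measurable_lexp z))]
  congr 1
  exact ((hX.stationary_increments s t).comp (measurable_lexp z)).lintegral_eq

variable [IsProbabilityMeasure P]

lemma IsSubordinator.lintegral_lexp_le_one (hX : IsSubordinator P X) (t : ℝ≥0) {z : Fin d → ℝ}
    (hz : 0 ≤ z) : ∫⁻ ω, lexp z (X t ω) ∂P ≤ 1 := by
  calc ∫⁻ ω, lexp z (X t ω) ∂P ≤ ∫⁻ _, 1 ∂P := by
        refine lintegral_mono_ae ?_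
        filter_upwards [hX.ae_nonneg] with ω hω using lexp_le_one hz (hω t)
    _ = 1 := by simp

lemma lintegral_lexp_ne_zero {V : Ω → Fin d → ℝ} (hV : Measurable V) (z : Fin d → ℝ) :
    ∫⁻ ω, lexp z (V ω) ∂P ≠ 0 := by
  rw [Ne, lintegral_eq_zero_iff (by fun_prop)]
  intro h
  obtain ⟨ω, hω⟩ := h.exists
  exact lexp_ne_zero _ _ hω

/-- The Laplace exponent of a process, read off at time `1`. -/
noncomputable def laplaceExponent (P : Measure Ω) (X : ℝ≥0 → Ω → (Fin d → ℝ)) (z : Fin d → ℝ) : ℝ :=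
  -Real.log (∫⁻ ω, lexp z (X 1 ω) ∂P).toReal

/-- `E exp (-z · X_t) = exp (-t φ(z))`: the logarithm of the left side is additive and monotone
in `t`. -/
lemma IsSubordinator.lintegral_lexp (hX : IsSubordinator P X) (t : ℝ≥0) {z : Fin d → ℝ}
    (hz : 0 ≤ z) :
    ∫⁻ ω, lexp z (X t ω) ∂P = ENNReal.ofReal (Real.exp (-(t * laplaceExponent P X z))) := by
  set L : ℝ≥0 → ℝ≥0∞ := fun t => ∫⁻ ω, lexp z (X t ω) ∂P with hL
  have hfin : ∀ t, L t ≠ ∞ := fun t =>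
    ((hX.lintegral_lexp_le_one t hz).trans_lt ENNReal.one_lt_top).ne
  have hpos : ∀ t, 0 < (L t).toReal := fun t =>
    ENNReal.toReal_pos (lintegral_lexp_ne_zero (hX.measurable t) z) (hfin t)
  have key := eq_mul_of_monotone_of_additive (g := fun t => -Real.log (L t).toReal) (fun s t => by
      have : L (s + t) = L s * L t := hX.lintegral_lexp_add s t z
      simp only [this, ENNReal.toReal_mul, Real.log_mul (hpos s).ne' (hpos t).ne']
      ring) (fun s t hst => by
      refine neg_le_neg (Real.log_le_log (hpos t) ?_)
      refine ENNReal.toReal_mono (hfin s) (lintegral_mono_ae ?_)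
      filter_upwards [hX.monotone] with ω hω using lexp_le_lexp hz (hω hst)) t
  have : (t : ℝ) * laplaceExponent P X z = -Real.log (L t).toReal := key.symm
  rw [this, neg_neg, Real.exp_log (hpos t), ENNReal.ofReal_toReal (hfin t)]

lemma IsSubordinator.laplaceExponent_nonneg (hX : IsSubordinator P X) {z : Fin d → ℝ}
    (hz : 0 ≤ z) : 0 ≤ laplaceExponent P X z := by
  unfold laplaceExponent
  rw [neg_nonneg]
  refine Real.log_nonpos ENNReal.toReal_nonneg ?_
  exact ENNReal.toReal_le_of_le_ofReal zero_le_one (by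
    simpa using hX.lintegral_lexp_le_one 1 hz)

lemma IsSubordinator.isLaplaceExponent (hX : IsSubordinator P X) :
    IsLaplaceExponent P X (laplaceExponent P X) := by
  intro t z hz
  rw [integral_eq_lintegral_of_nonneg_ae (ae_of_all _ fun ω => (Real.exp_pos _).le)
    (by have := hX.measurable t; exact Measurable.aestronglyMeasurable (by fun_prop))]
  have := hX.lintegral_lexp t hz
  unfold lexp at this
  rw [this, ENNReal.toReal_ofReal (Real.exp_nonneg _)]

/-- The increment over `[t k, t k + u]` may be integrated out of a Laplace functional against
everything determined by the values at the times `t 0, …, t k`. -/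
lemma IsRegularSubordinator.lintegral_mul_lexp (hX : IsRegularSubordinator P X)
    {t : ℕ → ℝ≥0} (ht : Monotone t) (ht0 : t 0 = 0) (k : ℕ) (u : ℝ≥0) {z : Fin d → ℝ} (hz : 0 ≤ z)
    {G : Ω → ℝ≥0∞} (hG : Measurable[pastSigma X t k] G) :
    ∫⁻ ω, G ω * lexp z (X (t k + u) ω) ∂P =
      (∫⁻ ω, G ω * lexp z (X (t k) ω) ∂P) *
        ENNReal.ofReal (Real.exp (-(u * laplaceExponent P X z))) := by
  have h1 := lintegral_mul_eq_lintegral_mul_lintegral_of_independent_measurableSpace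
    (pastSigma_le hX.measurable t k)
    (((hX.measurable _).sub (hX.measurable _)).comap_le)
    (hX.indep_pastSigma ht ht0 k u) (f := fun ω => G ω * lexp z (X (t k) ω))
    (g := fun ω => lexp z (X (t k + u) ω - X (t k) ω))
    (Measurable.mul hG ((measurable_lexp z).comp (measurable_pastSigma le_rfl)))
    ((measurable_lexp z).comp (comap_measurable _))
  have h2 : ∫⁻ ω, lexp z (X (t k + u) ω - X (t k) ω) ∂P = ∫⁻ ω, lexp z (X u ω) ∂P :=
    ((hX.stationary_increments (t k) u).comp (measurable_lexp z)).lintegral_eq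
  rw [h2, hX.lintegral_lexp u hz] at h1
  rw [← h1]
  refine lintegral_congr fun ω => ?_
  rw [mul_assoc, ← lexp_add]
  congr 2
  abel

end Subordinator

/-! ### First passage of a single path, and its dyadic approximation -/

/-- A right-continuous path started at `0` that increases at most at unit speed (so that it passes
continuously through every level on its way up) and exceeds every level. -/
structure IsSkipFreePath (z : ℝ≥0 → ℝ) : Prop where
  zero : z 0 = 0
  rightCts : ∀ u, ContinuousWithinAt z (Ici u) u
  sub_le : ∀ v w, v ≤ w → z w - z v ≤ w - v
  unbounded : ∀ t : ℝ, ∃ k : ℕ, t < z k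

/-- The index of the first point of the grid `2⁻ᵐ ℕ` at which the path `z` exceeds `t`. -/
noncomputable def gridIdx (z : ℝ≥0 → ℝ) (m : ℕ) (t : ℝ) : ℕ := sInf {k : ℕ | t < z (k / 2 ^ m)}

/-- The first point of the grid `2⁻ᵐ ℕ` at which the path `z` exceeds `t`. -/
noncomputable def gridTime (z : ℝ≥0 → ℝ) (m : ℕ) (t : ℝ) : ℝ≥0 := gridIdx z m t / 2 ^ m

/-- The first time at which the path `z` exceeds `t`, as an infimum over dyadic times. -/
noncomputable def passTime (z : ℝ≥0 → ℝ) (t : ℝ) : ℝ≥0 := ⨅ m, gridTime z m t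

namespace IsSkipFreePath

variable {z : ℝ≥0 → ℝ} (hz : IsSkipFreePath z)

include hz

lemma le_self (u : ℝ≥0) : z u ≤ u := by
  have := hz.sub_le 0 u zero_le
  simpa [hz.zero] using this

lemma grid_nonempty (m : ℕ) (t : ℝ) : {k : ℕ | t < z (k / 2 ^ m)}.Nonempty := by
  obtain ⟨k, hk⟩ := hz.unbounded t
  refine ⟨k * 2 ^ m, ?_⟩
  have : ((k * 2 ^ m : ℕ) : ℝ≥0) / 2 ^ m = k := by
    push_cast
    field_simp
  simpa [this] using hk

lemma lt_gridTime (m : ℕ) (t : ℝ) : t < z (gridTime z m t) := Nat.sInf_mem (hz.grid_nonempty m t)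

lemma gridIdx_le_iff {m : ℕ} {t : ℝ} {k : ℕ} :
    gridIdx z m t ≤ k ↔ ∃ j ≤ k, t < z (j / 2 ^ m) :=
  ⟨fun h => ⟨_, h, hz.lt_gridTime m t⟩, fun ⟨_, hj, h⟩ => (Nat.sInf_le h).trans hj⟩

lemma gridIdx_mono (m : ℕ) : Monotone (gridIdx z m) := fun _ _ hst =>
  Nat.sInf_le (hst.trans_lt (hz.lt_gridTime m _))

lemma gridTime_mono (m : ℕ) : Monotone (gridTime z m) := fun s t hst => by
  unfold gridTime
  have : (gridIdx z m s : ℝ≥0) ≤ gridIdx z m t := by exact_mod_cast hz.gridIdx_mono m hst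
  gcongr

lemma gridTime_antitone (t : ℝ) : Antitone fun m => gridTime z m t := by
  refine antitone_nat_of_succ_le fun m => ?_
  have h1 : gridIdx z (m + 1) t ≤ 2 * gridIdx z m t := by
    refine Nat.sInf_le ?_
    have : ((2 * gridIdx z m t : ℕ) : ℝ≥0) / 2 ^ (m + 1) = gridTime z m t := by
      unfold gridTime
      push_cast
      rw [pow_succ]
      field_simp
    change t < z _
    rw [this]
    exact hz.lt_gridTime m t
  have h2 : (gridIdx z (m + 1) t : ℝ≥0) ≤ 2 * gridIdx z m t := by exact_mod_cast h1
  unfold gridTime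
  calc (gridIdx z (m + 1) t : ℝ≥0) / 2 ^ (m + 1) ≤ 2 * gridIdx z m t / 2 ^ (m + 1) := by gcongr
    _ = gridIdx z m t / 2 ^ m := by rw [pow_succ]; field_simp

omit hz in
lemma passTime_le_gridTime (m : ℕ) (t : ℝ) : passTime z t ≤ gridTime z m t :=
  ciInf_le (OrderBot.bddBelow _) m

lemma tendsto_gridTime (t : ℝ) :
    Filter.Tendsto (fun m => gridTime z m t) Filter.atTop (nhds (passTime z t)) :=
  tendsto_atTop_ciInf (hz.gridTime_antitone t) (OrderBot.bddBelow _)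

lemma tendsto_gridTime_right (t : ℝ) :
    Filter.Tendsto (fun m => gridTime z m t) Filter.atTop
      (nhdsWithin (passTime z t) (Ici (passTime z t))) :=
  tendsto_nhdsWithin_iff.2 ⟨hz.tendsto_gridTime t, .of_forall fun m => passTime_le_gridTime m t⟩

/-- The overshoot on the grid is at most the mesh. -/
lemma apply_gridTime_le (m : ℕ) {t : ℝ} (ht : 0 ≤ t) :
    z (gridTime z m t) ≤ t + (2 ^ m : ℝ)⁻¹ := by
  have hne : gridIdx z m t ≠ 0 := by
    intro h0
    have := hz.lt_gridTime m t
    simp only [gridTime, h0, Nat.cast_zero, zero_div, hz.zero] at this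
    linarith
  obtain ⟨k, hk⟩ := Nat.exists_eq_succ_of_ne_zero hne
  have hle : z (k / 2 ^ m) ≤ t := by
    by_contra hcon
    have : gridIdx z m t ≤ k := Nat.sInf_le (not_le.1 hcon)
    omega
  have hstep := hz.sub_le ((k : ℝ≥0) / 2 ^ m) (gridTime z m t) (by
    unfold gridTime
    rw [hk]
    push_cast
    gcongr
    simp)
  have hval : ((gridTime z m t : ℝ≥0) : ℝ) - ((k : ℝ≥0) / 2 ^ m : ℝ≥0) = (2 ^ m : ℝ)⁻¹ := by
    unfold gridTime
    rw [hk]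
    push_cast
    field_simp
    ring
  linarith

lemma apply_passTime {t : ℝ} (ht : 0 ≤ t) : z (passTime z t) = t := by
  have h1 : Filter.Tendsto (fun m => z (gridTime z m t)) Filter.atTop
      (nhds (z (passTime z t))) :=
    (hz.rightCts _).tendsto.comp (hz.tendsto_gridTime_right t)
  have h2 : Filter.Tendsto (fun m : ℕ => t + (2 ^ m : ℝ)⁻¹) Filter.atTop (nhds (t + 0)) := by
    refine tendsto_const_nhds.add ?_
    simpa using tendsto_pow_atTop_nhds_zero_of_lt_one (r := (2 : ℝ)⁻¹) (by norm_num) (by norm_num)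
  rw [add_zero] at h2
  exact le_antisymm (le_of_tendsto_of_tendsto' h1 h2 fun m => hz.apply_gridTime_le m ht)
    (ge_of_tendsto' h1 fun m => (hz.lt_gridTime m t).le)

lemma passTime_le_of_lt_apply {t : ℝ} {u : ℝ≥0} (h : t < z u) : passTime z t ≤ u := by
  refine le_of_forall_pos_le_add fun ε hε => ?_
  have hnhds : ∀ᶠ v in nhdsWithin u (Ici u), t < z v := (hz.rightCts u).eventually (lt_mem_nhds h)
  rw [Filter.Eventually, mem_nhdsGE_iff_exists_Ico_subset] at hnhds
  obtain ⟨w, hw, hsub⟩ := hnhds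
  have hlt : u < min w (u + ε) := lt_min hw (lt_add_of_pos_right _ hε)
  obtain ⟨m, hm⟩ : ∃ m : ℕ, ((2 : ℝ≥0)⁻¹) ^ m < min w (u + ε) - u :=
    exists_pow_lt_of_lt_one (tsub_pos_of_lt hlt) (by norm_num [NNReal.inv_lt_one_iff])
  -- the first grid point to the right of `u`
  have hceil1 : u ≤ (⌈u * 2 ^ m⌉₊ : ℝ≥0) / 2 ^ m := by
    rw [le_div_iff₀ (by positivity)]
    exact Nat.le_ceil _
  have hceil2 : (⌈u * 2 ^ m⌉₊ : ℝ≥0) / 2 ^ m < min w (u + ε) := by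
    have := (Nat.ceil_lt_add_one (a := u * 2 ^ m) zero_le).le
    calc (⌈u * 2 ^ m⌉₊ : ℝ≥0) / 2 ^ m ≤ (u * 2 ^ m + 1) / 2 ^ m := by gcongr
      _ = u + (2 : ℝ≥0)⁻¹ ^ m := by rw [inv_pow, add_div, mul_div_cancel_right₀ _ (by positivity),
            one_div]
      _ < u + (min w (u + ε) - u) := by gcongr
      _ = min w (u + ε) := add_tsub_cancel_of_le hlt.le
  have hmem : t < z ((⌈u * 2 ^ m⌉₊ : ℝ≥0) / 2 ^ m) :=
    hsub ⟨hceil1, hceil2.trans_le (min_le_left _ _)⟩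
  calc passTime z t ≤ gridTime z m t := passTime_le_gridTime m t
    _ ≤ (⌈u * 2 ^ m⌉₊ : ℝ≥0) / 2 ^ m := by
        unfold gridTime
        have hidx : gridIdx z m t ≤ ⌈u * 2 ^ m⌉₊ := Nat.sInf_le hmem
        have : (gridIdx z m t : ℝ≥0) ≤ (⌈u * 2 ^ m⌉₊ : ℕ) := Nat.cast_le.2 hidx
        gcongr
    _ ≤ u + ε := (hceil2.trans_le (min_le_right _ _)).le

/-- As the path rises at most at unit speed, it exceeds a level strictly before any later time at
which it lies above it. -/
lemma passTime_lt_of_lt_apply {t : ℝ} (ht : 0 ≤ t) {u : ℝ≥0} (h : t < z u) : passTime z t < u := by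
  refine (hz.passTime_le_of_lt_apply h).lt_of_ne fun heq => ?_
  rw [← heq, hz.apply_passTime ht] at h
  exact lt_irrefl _ h

lemma passTime_mono : Monotone (passTime z) := fun s _ hst =>
  le_ciInf fun m => (passTime_le_gridTime m s).trans (hz.gridTime_mono m hst)

lemma le_passTime {t : ℝ} (ht : 0 ≤ t) : t ≤ passTime z t := by
  have := hz.le_self (passTime z t)
  rwa [hz.apply_passTime ht] at this

lemma rightCts_passTime (t : ℝ) : ContinuousWithinAt (passTime z) (Ici t) t := by
  rw [ContinuousWithinAt, tendsto_order]
  constructor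
  · intro a ha
    filter_upwards [self_mem_nhdsWithin] with s hs using ha.trans_le (hz.passTime_mono hs)
  · intro a ha
    obtain ⟨m, hm⟩ := ((hz.tendsto_gridTime t).eventually (gt_mem_nhds ha)).exists
    filter_upwards [mem_nhdsWithin_of_mem_nhds (gt_mem_nhds (hz.lt_gridTime m t))] with s hs
    exact (hz.passTime_le_of_lt_apply hs).trans_lt hm

end IsSkipFreePath

/-! ### The equation `φ(z + c r) = c` and finiteness of the passage times -/

section Passage

variable {Ω : Type*} [MeasurableSpace Ω] {P : Measure Ω} {d : ℕ}
  {X : ℝ≥0 → Ω → (Fin d → ℝ)} {r : Fin d → ℝ}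

lemma reservoir_zero (hX : IsRegularSubordinator P X) (ω : Ω) : reservoir r X 0 ω = 0 := by
  simp [reservoir, hX.start_zero]

lemma reservoir_sub_le (hX : IsRegularSubordinator P X) (hr : 0 ≤ r) (ω : Ω) (v w : ℝ≥0)
    (hvw : v ≤ w) : reservoir r X w ω - reservoir r X v ω ≤ w - v := by
  have := dotProduct_le_dotProduct_right hr (hX.mono ω hvw)
  simp only [reservoir] at this ⊢
  linarith

lemma measurable_reservoir (hX : ∀ t, Measurable (X t)) (u : ℝ≥0) :
    Measurable (reservoir r X u) := by
  have := hX u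
  unfold reservoir
  fun_prop

lemma continuousWithinAt_reservoir (hX : IsRegularSubordinator P X) (ω : Ω) (u : ℝ≥0) :
    ContinuousWithinAt (fun v => reservoir r X v ω) (Ici u) u := by
  unfold reservoir
  exact NNReal.continuous_coe.continuousWithinAt.sub
    ((continuous_dotProduct_right r).continuousAt.comp_continuousWithinAt (hX.rightCts ω u))

lemma isSkipFreePath_reservoir (hX : IsRegularSubordinator P X) (hr : 0 ≤ r) {ω : Ω}
    (h : ∀ t : ℝ, ∃ k : ℕ, t < reservoir r X k ω) :
    IsSkipFreePath fun u => reservoir r X u ω where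
  zero := reservoir_zero hX ω
  rightCts := continuousWithinAt_reservoir hX ω
  sub_le := reservoir_sub_le hX hr ω
  unbounded := h

variable [IsProbabilityMeasure P]

lemma integral_pos_of_ae_pos {f : Ω → ℝ} (hint : Integrable f P) (h : ∀ᵐ ω ∂P, 0 < f ω) :
    0 < ∫ ω, f ω ∂P := by
  refine lt_of_le_of_ne (integral_nonneg_of_ae (h.mono fun ω h => h.le)) fun h0 => ?_
  have h1 := (integral_eq_zero_iff_of_nonneg_ae (h.mono fun ω h => h.le) hint).1 h0.symm
  obtain ⟨ω, h2, h3⟩ := (h1.and h).exists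
  exact h3.ne' h2

/-- The hypotheses on the scalar subordinator `r · X` at time `1`: its mean is at most `1` and it
has no atom at `1`. -/
structure IsSubcritical (P : Measure Ω) (X : ℝ≥0 → Ω → (Fin d → ℝ)) (r : Fin d → ℝ) : Prop where
  nonneg : 0 ≤ r
  mean_le : ∫⁻ ω, ENNReal.ofReal (r ⬝ᵥ X 1 ω) ∂P ≤ 1
  ne_one : ∀ᵐ ω ∂P, r ⬝ᵥ X 1 ω ≠ 1

namespace IsSubcritical

variable (hX : IsRegularSubordinator P X) (hs : IsSubcritical P X r)

include hX hs

omit [IsProbabilityMeasure P] in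
lemma dot_nonneg (t : ℝ≥0) (ω : Ω) : 0 ≤ r ⬝ᵥ X t ω :=
  dotProduct_nonneg_of_nonneg hs.nonneg (hX.nonneg t ω)

omit [IsProbabilityMeasure P] in
lemma integrable_dot : Integrable (fun ω => r ⬝ᵥ X 1 ω) P := by
  have hm : Measurable fun ω => r ⬝ᵥ X 1 ω := by have := hX.measurable 1; fun_prop
  refine ⟨hm.aestronglyMeasurable, ?_⟩
  rw [hasFiniteIntegral_iff_ofReal (ae_of_all _ (hs.dot_nonneg hX 1))]
  exact hs.mean_le.trans_lt ENNReal.one_lt_top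

omit [IsProbabilityMeasure P] in
lemma integral_dot_le : ∫ ω, r ⬝ᵥ X 1 ω ∂P ≤ 1 := by
  rw [integral_eq_lintegral_of_nonneg_ae (ae_of_all _ (hs.dot_nonneg hX 1))
    (hs.integrable_dot hX).1]
  exact ENNReal.toReal_le_of_le_ofReal zero_le_one (by simpa using hs.mean_le)

/-- Jensen's inequality `E exp (-c r·X_1) ≥ exp (-c)` is strict, as `r·X_1 ≠ 1`. -/
lemma laplaceExponent_lt {c : ℝ} (hc : 0 < c) : laplaceExponent P X (c • r) < c := by
  have hm : Measurable (X 1) := hX.measurable 1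
  have hint1 : Integrable (fun ω => Real.exp (-(c • r ⬝ᵥ X 1 ω))) P := by
    refine Integrable.of_bound (C := 1) (Measurable.aestronglyMeasurable (by fun_prop))
      (ae_of_all _ fun ω => ?_)
    rw [Real.norm_eq_abs, Real.abs_exp, Real.exp_le_one_iff, smul_dotProduct, smul_eq_mul]
    have := mul_nonneg hc.le (hs.dot_nonneg hX 1 ω)
    linarith
  have hint2 : Integrable (fun ω => Real.exp (-c) * (1 - c * (r ⬝ᵥ X 1 ω - 1))) P :=
    (((integrable_const (1 : ℝ)).sub
      (((hs.integrable_dot hX).sub (integrable_const (1 : ℝ))).const_mul c))).const_mul _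
  have hpos : 0 < ∫ ω, (Real.exp (-(c • r ⬝ᵥ X 1 ω))
      - Real.exp (-c) * (1 - c * (r ⬝ᵥ X 1 ω - 1))) ∂P := by
    have hlt : ∀ᵐ ω ∂P, 0 < Real.exp (-(c • r ⬝ᵥ X 1 ω))
        - Real.exp (-c) * (1 - c * (r ⬝ᵥ X 1 ω - 1)) := by
      filter_upwards [hs.ne_one] with ω hω
      have h1 : -(c * (r ⬝ᵥ X 1 ω - 1)) ≠ 0 := by
        rw [neg_ne_zero]
        exact mul_ne_zero hc.ne' (sub_ne_zero.2 hω)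
      have h2 := Real.add_one_lt_exp h1
      have h3 : Real.exp (-(c • r ⬝ᵥ X 1 ω))
          = Real.exp (-c) * Real.exp (-(c * (r ⬝ᵥ X 1 ω - 1))) := by
        rw [← Real.exp_add, smul_dotProduct, smul_eq_mul]
        congr 1
        ring
      rw [h3, ← mul_sub]
      exact mul_pos (Real.exp_pos _) (by linarith)
    exact integral_pos_of_ae_pos (hint1.sub hint2) hlt
  have hlin : ∫ ω, (1 - c * (r ⬝ᵥ X 1 ω - 1)) ∂P = 1 - c * (∫ ω, r ⬝ᵥ X 1 ω ∂P - 1) := by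
    have hi := (hs.integrable_dot hX).sub (integrable_const (1 : ℝ))
    have h1 : ∫ ω, (1 - c * (r ⬝ᵥ X 1 ω - 1)) ∂P = ∫ _, (1 : ℝ) ∂P
        - ∫ ω, c * (r ⬝ᵥ X 1 ω - 1) ∂P := integral_sub (integrable_const _) (hi.const_mul c)
    rw [h1, integral_const_mul, integral_sub (hs.integrable_dot hX) (integrable_const _)]
    simp
  rw [integral_sub hint1 hint2, integral_const_mul, hlin] at hpos
  have hle := hs.integral_dot_le hX
  have h4 : Real.exp (-c) < ∫ ω, Real.exp (-(c • r ⬝ᵥ X 1 ω)) ∂P := by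
    have : Real.exp (-c) * 1 ≤ Real.exp (-c) * (1 - c * (∫ ω, r ⬝ᵥ X 1 ω ∂P - 1)) := by
      gcongr
      nlinarith
    linarith
  have h5 := hX.isLaplaceExponent 1 (c • r) (smul_nonneg hc.le hs.nonneg)
  rw [h5, Real.exp_lt_exp] at h4
  simpa using h4

lemma measure_dot_lt_one_ne_zero : P {ω | r ⬝ᵥ X 1 ω < 1} ≠ 0 := by
  intro h0
  have hlt : ∀ᵐ ω ∂P, 0 < r ⬝ᵥ X 1 ω - 1 := by
    filter_upwards [measure_eq_zero_iff_ae_notMem.1 h0, hs.ne_one] with ω h1 h2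
    have : 1 ≤ r ⬝ᵥ X 1 ω := not_lt.1 h1
    exact sub_pos.2 (lt_of_le_of_ne this (Ne.symm h2))
  have hint := (hs.integrable_dot hX).sub (integrable_const (1 : ℝ))
  have h2 := integral_pos_of_ae_pos hint hlt
  have h3 : ∫ ω, (r ⬝ᵥ X 1 ω - 1) ∂P ≤ 0 := by
    rw [integral_sub (hs.integrable_dot hX) (integrable_const _)]
    simpa using hs.integral_dot_le hX
  exact (h2.trans_le h3).false

/-- Since `r·X_1 < 1` with positive probability, `φ(z + c r)` grows more slowly than `c`. -/
lemma exists_laplaceExponent_le {z : Fin d → ℝ} (hz : 0 ≤ z) :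
    ∃ c : ℝ, 0 ≤ c ∧ laplaceExponent P X (z + c • r) ≤ c := by
  have hm : Measurable (X 1) := hX.measurable 1
  have hcov : {ω | r ⬝ᵥ X 1 ω < 1} ⊆
      ⋃ n : ℕ, {ω | r ⬝ᵥ X 1 ω ≤ 1 - 1 / (n + 1 : ℝ) ∧ z ⬝ᵥ X 1 ω ≤ n} := by
    intro ω hω
    rw [mem_iUnion]
    obtain ⟨n1, hn1⟩ := exists_nat_one_div_lt (sub_pos.2 (show r ⬝ᵥ X 1 ω < 1 from hω))
    obtain ⟨n2, hn2⟩ := exists_nat_ge (z ⬝ᵥ X 1 ω)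
    refine ⟨max n1 n2, ?_, hn2.trans (by exact_mod_cast le_max_right _ _)⟩
    have : 1 / ((max n1 n2 : ℕ) + 1 : ℝ) ≤ 1 / (n1 + 1 : ℝ) := by
      gcongr
      exact le_max_left _ _
    linarith
  obtain ⟨n, hn⟩ : ∃ n : ℕ, P {ω | r ⬝ᵥ X 1 ω ≤ 1 - 1 / (n + 1 : ℝ) ∧ z ⬝ᵥ X 1 ω ≤ n} ≠ 0 := by
    by_contra! hcon
    exact hs.measure_dot_lt_one_ne_zero hX (measure_mono_null hcov (measure_iUnion_null hcon))
  set A := {ω | r ⬝ᵥ X 1 ω ≤ 1 - 1 / (n + 1 : ℝ) ∧ z ⬝ᵥ X 1 ω ≤ n} with hA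
  have hAm : MeasurableSet A :=
    MeasurableSet.inter
      (measurableSet_le (f := fun ω => r ⬝ᵥ X 1 ω) (by fun_prop) measurable_const)
      (measurableSet_le (f := fun ω => z ⬝ᵥ X 1 ω) (by fun_prop) measurable_const)
  set p := (P A).toReal with hp
  have hp0 : 0 < p := ENNReal.toReal_pos hn (measure_ne_top _ _)
  have hp1 : p ≤ 1 := ENNReal.toReal_le_of_le_ofReal zero_le_one (by simpa using prob_le_one)
  -- on `A`, `(z + c r)·X_1 ≤ n + c (1 - 1 / (n + 1))`, and this `c` makes
  -- `p exp (-(n + c (1 - 1 / (n + 1)))) = exp (-c)`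
  set c : ℝ := (n + 1) * (n - Real.log p) with hc
  have hc0 : 0 ≤ c := by
    have := Real.log_nonpos hp0.le hp1
    have hn0 : (0 : ℝ) ≤ n := Nat.cast_nonneg n
    exact mul_nonneg (by linarith) (by linarith)
  refine ⟨c, hc0, ?_⟩
  have hzc : 0 ≤ z + c • r := add_nonneg hz (smul_nonneg hc0 hs.nonneg)
  have h1 : ENNReal.ofReal (Real.exp (-(n + c * (1 - 1 / (n + 1 : ℝ))))) * P A
      ≤ ∫⁻ ω, lexp (z + c • r) (X 1 ω) ∂P := by
    rw [← setLIntegral_const]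
    refine (setLIntegral_mono' hAm fun ω hω => ?_).trans (setLIntegral_le_lintegral A _)
    unfold lexp
    refine ENNReal.ofReal_le_ofReal (Real.exp_le_exp.2 (neg_le_neg ?_))
    rw [add_dotProduct, smul_dotProduct, smul_eq_mul]
    have := mul_le_mul_of_nonneg_left hω.1 hc0
    linarith [hω.2]
  rw [hX.lintegral_lexp 1 hzc, ← ENNReal.ofReal_toReal (measure_ne_top P A), ← hp,
    ← ENNReal.ofReal_mul (Real.exp_nonneg _),
    ENNReal.ofReal_le_ofReal_iff (Real.exp_nonneg _)] at h1
  nth_rw 1 [← Real.exp_log hp0] at h1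
  rw [← Real.exp_add, Real.exp_le_exp] at h1
  have h2 : c * (1 / (n + 1 : ℝ)) = n - Real.log p := by
    rw [hc]
    field_simp
  simp only [NNReal.coe_one, one_mul] at h1
  nlinarith

/-- The Laplace exponent of the passage process: the solution `c` of `φ(z + c r) = c`, found by
the intermediate value theorem. -/
lemma exists_laplaceExponent_eq {z : Fin d → ℝ} (hz : 0 ≤ z) :
    ∃ c : ℝ, 0 ≤ c ∧ laplaceExponent P X (z + c • r) = c := by
  have hm : Measurable (X 1) := hX.measurable 1
  obtain ⟨b, hb0, hb⟩ := hs.exists_laplaceExponent_le hX hz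
  have hpos : ∀ c : ℝ, 0 ≤ c → 0 ≤ z + c • r := fun c hc =>
    add_nonneg hz (smul_nonneg hc hs.nonneg)
  -- the truncation `max c 0` keeps the integrand bounded by `1`, so that `F` is continuous on `ℝ`
  set F : ℝ → ℝ := fun c => ∫ ω, Real.exp (-((z + max c 0 • r) ⬝ᵥ X 1 ω)) ∂P with hF
  have hFc : Continuous F := by
    refine continuous_of_dominated (bound := fun _ => 1)
      (fun c => Measurable.aestronglyMeasurable (by fun_prop)) (fun c => ae_of_all _ fun ω => ?_)
      (integrable_const _) (ae_of_all _ fun ω => ?_)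
    · rw [Real.norm_eq_abs, Real.abs_exp, Real.exp_le_one_iff, neg_nonpos]
      exact dotProduct_nonneg_of_nonneg (hpos _ (le_max_right _ _)) (hX.nonneg _ _)
    · simp only [add_dotProduct, smul_dotProduct, smul_eq_mul]
      fun_prop
  have hFval : ∀ c, 0 ≤ c → F c = Real.exp (-laplaceExponent P X (z + c • r)) := by
    intro c hc
    have := hX.isLaplaceExponent 1 _ (hpos c hc)
    simp only [hF, max_eq_left hc]
    simpa using this
  have hg : ContinuousOn (fun c => F c * Real.exp c) (Icc 0 b) :=
    (hFc.mul Real.continuous_exp).continuousOn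
  obtain ⟨c, hc, hce⟩ := intermediate_value_Icc hb0 hg (show (1 : ℝ) ∈ _ from by
    rw [hFval 0 le_rfl, hFval b hb0, ← Real.exp_add, ← Real.exp_add]
    refine ⟨?_, ?_⟩
    · have := hX.laplaceExponent_nonneg (hpos 0 le_rfl)
      rw [Real.exp_le_one_iff]
      linarith
    · rw [Real.one_le_exp_iff]
      linarith)
  refine ⟨c, hc.1, ?_⟩
  simp only [hFval c hc.1, ← Real.exp_add, Real.exp_eq_one_iff] at hce
  linarith

/-- Optional stopping at the first integer time at which the path exceeds `t`: the exponential
martingale `exp (-c r·X_k + φ(c r) k)` is at most `exp (c (t + 1))` at that time and tends to `0`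
before it. -/
lemma exp_neg_le_measure_exceed {c t : ℝ} (hc : 0 < c) (ht : 0 ≤ t) :
    ENNReal.ofReal (Real.exp (-(c * (t + 1)))) ≤ P {ω | ∃ k : ℕ, t < reservoir r X k ω} := by
  set φ := laplaceExponent P X (c • r) with hφ
  have hφc : φ < c := hs.laplaceExponent_lt hX hc
  have hcr : 0 ≤ c • r := smul_nonneg hc.le hs.nonneg
  have hφ0 : 0 ≤ φ := hX.laplaceExponent_nonneg hcr
  set A : ℕ → Set Ω := fun K => {ω | ∀ j ≤ K, reservoir r X j ω ≤ t} with hA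
  set N : ℕ → Ω → ℝ≥0∞ := fun k ω => ENNReal.ofReal (Real.exp (φ * k)) * lexp (c • r) (X k ω)
    with hN
  set B : ℝ≥0∞ := ENNReal.ofReal (Real.exp (c * (t + 1))) with hB
  have hNval : ∀ k ω, N k ω = ENNReal.ofReal (Real.exp (c * reservoir r X k ω - (c - φ) * k)) := by
    intro k ω
    simp only [hN, lexp]
    rw [← ENNReal.ofReal_mul (Real.exp_nonneg _), ← Real.exp_add]
    congr 2
    simp only [reservoir, smul_dotProduct, smul_eq_mul, NNReal.coe_natCast]
    ring
  have hZm : ∀ K j, j ≤ K → Measurable[pastSigma X (fun j => (j : ℝ≥0)) K]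
      (reservoir r X (j : ℕ)) := by
    intro K j hj
    have h := measurable_pastSigma (X := X) (t := fun j => (j : ℝ≥0)) hj
    unfold reservoir
    exact measurable_const.sub ((measurable_dotProduct_right r).comp h)
  have hAm : ∀ K, MeasurableSet[pastSigma X (fun j => (j : ℝ≥0)) K] (A K) := by
    intro K
    have : A K = ⋂ j : Fin (K + 1), {ω | reservoir r X (j : ℕ) ω ≤ t} := by
      ext ω
      simp only [hA, mem_ofPred_eq, mem_iInter]
      exact ⟨fun h j => h j (by omega), fun h j hj => h ⟨j, by omega⟩⟩
    rw [this]
    exact MeasurableSet.iInter fun j =>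
      (hZm K j (by omega)) measurableSet_Iic
  have hAm' : ∀ K, MeasurableSet (A K) := fun K => pastSigma_le hX.measurable _ K _ (hAm K)
  have hXm : ∀ k : ℕ, Measurable (X k) := fun k => hX.measurable k
  have hNm : ∀ k, Measurable (N k) := fun k => by
    have := hXm k
    simp only [hN]
    fun_prop
  have hmart : ∀ K, ∫⁻ ω in A K, N (K + 1) ω ∂P = ∫⁻ ω in A K, N K ω ∂P := by
    intro K
    have h := hX.lintegral_mul_lexp (t := fun j => (j : ℝ≥0)) Nat.mono_cast (by simp) K 1 hcr
      (G := (A K).indicator fun _ => 1) (measurable_const.indicator (hAm K))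
    have e : ∀ k : ℕ, ∫⁻ ω in A K, N k ω ∂P = ENNReal.ofReal (Real.exp (φ * k)) *
        ∫⁻ ω, (A K).indicator (fun _ => 1) ω * lexp (c • r) (X k ω) ∂P := by
      intro k
      have := hXm k
      simp only [hN]
      rw [lintegral_const_mul _ (by fun_prop), ← lintegral_indicator (hAm' K)]
      congr 2
      ext ω
      by_cases hω : ω ∈ A K <;> simp [hω]
    rw [e, e]
    push_cast
    push_cast at h
    rw [h, ← mul_assoc, mul_right_comm, ← ENNReal.ofReal_mul (Real.exp_nonneg _), ← Real.exp_add]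
    congr 3
    simp
    ring
  have hsub : ∀ K, A (K + 1) ⊆ A K := fun K ω hω j hj => hω j (by omega)
  have hopt : ∀ K, 1 ≤ ∫⁻ ω in A K, N K ω ∂P + B * P (A K)ᶜ := by
    intro K
    induction K with
    | zero =>
      have : A 0 = univ := by
        ext ω
        simp [hA, reservoir_zero hX, ht]
      simp [this, hN, hX.start_zero]
    | succ K ih =>
      refine ih.trans ?_
      rw [← hmart K, ← lintegral_inter_add_sdiff (N (K + 1)) (A K) (hAm' (K + 1)),
        inter_eq_self_of_subset_right (hsub K), add_assoc]
      gcongr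
      calc ∫⁻ ω in A K \ A (K + 1), N (K + 1) ω ∂P + B * P (A K)ᶜ
          ≤ ∫⁻ ω in A K \ A (K + 1), B ∂P + B * P (A K)ᶜ := by
            gcongr 1
            refine setLIntegral_mono' ((hAm' K).diff (hAm' (K + 1))) fun ω hω => ?_
            rw [hNval, hB]
            refine ENNReal.ofReal_le_ofReal (Real.exp_le_exp.2 ?_)
            have h1 := hω.1 K le_rfl
            have h2 := reservoir_sub_le hX hs.nonneg ω K (K + 1 : ℕ) (by simp)
            have h3 : reservoir r X (K + 1 : ℕ) ω ≤ t + 1 := by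
              push_cast at h2 ⊢
              linarith
            have h4 := mul_le_mul_of_nonneg_left h3 hc.le
            have h5 : 0 ≤ (c - φ) * ((K + 1 : ℕ) : ℝ) :=
              mul_nonneg (by linarith) (Nat.cast_nonneg _)
            linarith
        _ = B * P (A (K + 1))ᶜ := by
            rw [setLIntegral_const, ← mul_add, ← measure_union _ (hAm' K).compl]
            · congr 2
              ext ω
              have := @hsub K ω
              simp only [mem_union, mem_sdiff, mem_compl_iff]
              tauto
            · exact disjoint_compl_right.mono_left sdiff_subset
  have hE : ∀ K, P (A K)ᶜ ≤ P {ω | ∃ k : ℕ, t < reservoir r X k ω} := by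
    intro K
    refine measure_mono fun ω hω => ?_
    simp only [hA, mem_compl_iff, mem_ofPred_eq, not_forall, not_le] at hω
    obtain ⟨j, _, hj⟩ := hω
    exact ⟨j, hj⟩
  have hbound : ∀ K : ℕ, 1 ≤ ENNReal.ofReal (Real.exp (c * t - (c - φ) * K)) +
      B * P {ω | ∃ k : ℕ, t < reservoir r X k ω} := by
    intro K
    refine (hopt K).trans (add_le_add ?_ (mul_le_mul_right (hE K) B))
    calc ∫⁻ ω in A K, N K ω ∂P
        ≤ ∫⁻ ω in A K, ENNReal.ofReal (Real.exp (c * t - (c - φ) * K)) ∂P := by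
          refine setLIntegral_mono' (hAm' K) fun ω hω => ?_
          rw [hNval]
          refine ENNReal.ofReal_le_ofReal (Real.exp_le_exp.2 ?_)
          have := mul_le_mul_of_nonneg_left (hω K le_rfl) hc.le
          linarith
      _ ≤ _ := by
          rw [setLIntegral_const]
          exact mul_le_of_le_one_right' prob_le_one
  have hlim : Filter.Tendsto (fun K : ℕ => ENNReal.ofReal (Real.exp (c * t - (c - φ) * K)) +
      B * P {ω | ∃ k : ℕ, t < reservoir r X k ω}) Filter.atTop
      (nhds (0 + B * P {ω | ∃ k : ℕ, t < reservoir r X k ω})) := by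
    refine Filter.Tendsto.add_const _ ?_
    rw [← ENNReal.ofReal_zero]
    refine ENNReal.tendsto_ofReal (Real.tendsto_exp_atBot.comp ?_)
    refine Filter.tendsto_atBot_add_const_left _ _ (Filter.tendsto_neg_atTop_atBot.comp ?_)
    exact tendsto_natCast_atTop_atTop.const_mul_atTop (by linarith)
  have hfin := ge_of_tendsto' hlim hbound
  rw [zero_add] at hfin
  calc ENNReal.ofReal (Real.exp (-(c * (t + 1))))
      = ENNReal.ofReal (Real.exp (-(c * (t + 1)))) * 1 := (mul_one _).symm
    _ ≤ ENNReal.ofReal (Real.exp (-(c * (t + 1)))) *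
        (B * P {ω | ∃ k : ℕ, t < reservoir r X k ω}) := by gcongr
    _ = _ := by
        rw [← mul_assoc, hB, ← ENNReal.ofReal_mul (Real.exp_nonneg _), ← Real.exp_add]
        simp

/-- Almost surely `u - r · X_u` exceeds every level. -/
lemma ae_exceeds : ∀ᵐ ω ∂P, ∀ t : ℝ, ∃ k : ℕ, t < reservoir r X k ω := by
  have key : ∀ n : ℕ, ∀ᵐ ω ∂P, ∃ k : ℕ, (n : ℝ) < reservoir r X k ω := by
    intro n
    have hlim : Filter.Tendsto (fun m : ℕ =>
        ENNReal.ofReal (Real.exp (-(1 / ((m : ℝ) + 1) * ((n : ℝ) + 1))))) Filter.atTop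
        (nhds (ENNReal.ofReal (Real.exp (-(0 * ((n : ℝ) + 1)))))) := by
      refine ENNReal.tendsto_ofReal ((Real.continuous_exp.tendsto _).comp ?_)
      exact (tendsto_one_div_add_atTop_nhds_zero_nat.mul_const _).neg
    have h1 := le_of_tendsto' hlim fun m =>
      hs.exp_neg_le_measure_exceed hX (by positivity) (Nat.cast_nonneg n)
    simp only [zero_mul, neg_zero, Real.exp_zero, ENNReal.ofReal_one] at h1
    have hmeas : MeasurableSet {ω | ∃ k : ℕ, (n : ℝ) < reservoir r X k ω} := by
      rw [ofPred_exists]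
      exact MeasurableSet.iUnion fun k =>
        measurableSet_lt measurable_const (measurable_reservoir hX.measurable k)
    exact (mem_ae_iff_prob_eq_one hmeas).2 (le_antisymm prob_le_one h1)
  filter_upwards [ae_all_iff.2 key] with ω hω t
  obtain ⟨n, hn⟩ := exists_nat_ge t
  obtain ⟨k, hk⟩ := hω n
  exact ⟨k, hn.trans_lt hk⟩

end IsSubcritical

end Passage

/-! ### The passage process, its dyadic approximation, and optional stopping -/

/-- Evaluating a sequence of measurable functions at a measurable random index is measurable. -/
lemma measurable_apply_index {α β ι : Type*} [MeasurableSpace α] [MeasurableSpace β] [Countable ι]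
    [MeasurableSpace ι] [MeasurableSingletonClass ι] {f : ι → α → β} (hf : ∀ i, Measurable (f i))
    {n : α → ι} (hn : Measurable n) : Measurable fun a => f (n a) a := by
  have h : Measurable fun p : α × ι => f p.2 p.1 := measurable_from_prod_countable_left hf
  exact h.comp (measurable_id.prodMk hn)

lemma measurable_nat_of_le {α : Type*} {mα : MeasurableSpace α} {n : α → ℕ}
    (h : ∀ k, MeasurableSet {a | n a ≤ k}) : Measurable n := measurable_of_Iic h

lemma measurable_comp_apply_index {α β γ : Type*} {mα : MeasurableSpace α} [MeasurableSpace β]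
    [MeasurableSpace γ] {k : ℕ} {G : (Fin k → β) → γ} (hG : Measurable G) {f : ℕ → α → β}
    (hf : ∀ i, Measurable (f i)) {n : Fin k → α → ℕ} (hn : ∀ i, Measurable (n i)) :
    Measurable fun a => G fun i => f (n i a) a :=
  hG.comp (measurable_pi_lambda _ fun i => measurable_apply_index hf (hn i))

/-- Optional stopping for nonnegative processes, on the event that the earlier time `a` is at
most `K`: if `N` is a martingale, in the sense that `E[G N_{k+1}] = E[G N_k]` for all nonnegative
`G` determined at time `k`, then `N` may be stopped at `b ∧ K` or at `a ≤ b`. -/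
lemma setLIntegral_stopped_eq {Ω : Type*} {mΩ : MeasurableSpace Ω} {P : Measure Ω}
    {𝓕 : ℕ → MeasurableSpace Ω} (h𝓕 : ∀ k, 𝓕 k ≤ mΩ) {N : ℕ → Ω → ℝ≥0∞}
    (hNm : ∀ k, Measurable (N k))
    (hN : ∀ (k : ℕ) (G : Ω → ℝ≥0∞), Measurable[𝓕 k] G →
      ∫⁻ ω, G ω * N (k + 1) ω ∂P = ∫⁻ ω, G ω * N k ω ∂P)
    {a b : Ω → ℕ} (hab : ∀ ω, a ω ≤ b ω) (hb : ∀ k, MeasurableSet[𝓕 k] {ω | k < b ω})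
    (ha : ∀ k, MeasurableSet[𝓕 k] {ω | a ω ≤ k}) {W : Ω → ℝ≥0∞}
    (hW : ∀ k, Measurable[𝓕 k] ({ω | a ω ≤ k}.indicator W)) (K : ℕ) :
    ∫⁻ ω in {ω | a ω ≤ K}, W ω * N (min (b ω) K) ω ∂P =
      ∫⁻ ω in {ω | a ω ≤ K}, W ω * N (a ω) ω ∂P := by
  have ham : ∀ k, MeasurableSet {ω | a ω ≤ k} := fun k => h𝓕 k _ (ha k)
  have hbm : ∀ k, MeasurableSet {ω | k < b ω} := fun k => h𝓕 k _ (hb k)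
  have ha' : Measurable a := measurable_of_Iic fun k => ham k
  have hb' : Measurable b := measurable_of_Ioi fun k => hbm k
  have hNa : Measurable fun ω => N (a ω) ω := measurable_apply_index hNm ha'
  have hNb : ∀ K, Measurable fun ω => N (min (b ω) K) ω := fun K =>
    measurable_apply_index hNm (hb'.min measurable_const)
  induction K with
  | zero =>
    refine setLIntegral_congr_fun (ham 0) fun ω hω => ?_
    have h0 : a ω = 0 := Nat.le_zero.1 hω
    simp [h0]
  | succ K ih =>
    have hsub : {ω | a ω ≤ K} ⊆ {ω | a ω ≤ K + 1} := fun ω (hω : a ω ≤ K) => Nat.le_succ_of_le hω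
    rw [← lintegral_inter_add_sdiff _ {ω | a ω ≤ K + 1} (ham K),
      ← lintegral_inter_add_sdiff (fun ω => W ω * N (a ω) ω) {ω | a ω ≤ K + 1} (ham K),
      inter_eq_self_of_subset_right hsub, ← ih]
    congr 1
    · -- between the times `K` and `K + 1` the stopped process moves only on `{b > K}`
      rw [← lintegral_inter_add_sdiff _ {ω | a ω ≤ K} (hbm K),
        ← lintegral_inter_add_sdiff (fun ω => W ω * N (min (b ω) K) ω) {ω | a ω ≤ K} (hbm K)]
      congr 1
      · have e : ∀ j, ∫⁻ ω in {ω | a ω ≤ K} ∩ {ω | K < b ω}, W ω * N j ω ∂P =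
            ∫⁻ ω, ({ω | K < b ω}.indicator ({ω | a ω ≤ K}.indicator W)) ω * N j ω ∂P := by
          intro j
          rw [← lintegral_indicator ((ham K).inter (hbm K))]
          refine lintegral_congr fun ω => ?_
          by_cases h1 : a ω ≤ K <;> by_cases h2 : K < b ω <;> simp [h1, h2, indicator]
        have e1 : ∫⁻ ω in {ω | a ω ≤ K} ∩ {ω | K < b ω}, W ω * N (min (b ω) (K + 1)) ω ∂P =
            ∫⁻ ω in {ω | a ω ≤ K} ∩ {ω | K < b ω}, W ω * N (K + 1) ω ∂P :=
          setLIntegral_congr_fun ((ham K).inter (hbm K)) fun ω hω => by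
            have h2 : K < b ω := hω.2
            simp [min_eq_right (Nat.succ_le_of_lt h2)]
        have e2 : ∫⁻ ω in {ω | a ω ≤ K} ∩ {ω | K < b ω}, W ω * N (min (b ω) K) ω ∂P =
            ∫⁻ ω in {ω | a ω ≤ K} ∩ {ω | K < b ω}, W ω * N K ω ∂P :=
          setLIntegral_congr_fun ((ham K).inter (hbm K)) fun ω hω => by
            have h2 : K < b ω := hω.2
            simp [min_eq_right h2.le]
        rw [e1, e2, e, e]
        exact hN K _ ((hW K).indicator (hb K))
      · refine setLIntegral_congr_fun ((ham K).diff (hbm K)) fun ω hω => ?_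
        have h2 : b ω ≤ K := not_lt.1 hω.2
        simp [min_eq_left h2, min_eq_left (Nat.le_succ_of_le h2)]
    · refine setLIntegral_congr_fun ((ham (K + 1)).diff (ham K)) fun ω hω => ?_
      have h1 : a ω = K + 1 := le_antisymm hω.1 (Nat.succ_le_of_lt (not_le.1 hω.2))
      have h2 : K + 1 ≤ b ω := h1 ▸ hab ω
      simp [h1, min_eq_right h2]

section Passage

variable {Ω : Type*} [MeasurableSpace Ω] {P : Measure Ω} {d : ℕ}
  {X : ℝ≥0 → Ω → (Fin d → ℝ)} {r : Fin d → ℝ}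

/-- The first time at which `u - r · X_u` exceeds `t`. Unlike the hitting time of `t` it is
measurable and right-continuous in `t` on every path. -/
noncomputable def crossTime (r : Fin d → ℝ) (X : ℝ≥0 → Ω → (Fin d → ℝ)) (t : ℝ≥0) (ω : Ω) : ℝ≥0 :=
  passTime (fun u => reservoir r X u ω) t

/-- The index of the first point of the grid `2⁻ᵐ ℕ` at which `u - r · X_u` exceeds `t`. -/
noncomputable def crossIdx (r : Fin d → ℝ) (X : ℝ≥0 → Ω → (Fin d → ℝ)) (m : ℕ) (t : ℝ≥0) (ω : Ω) :
    ℕ :=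
  gridIdx (fun u => reservoir r X u ω) m t

/-- The first point of the grid `2⁻ᵐ ℕ` at which `u - r · X_u` exceeds `t`. -/
noncomputable def crossGrid (r : Fin d → ℝ) (X : ℝ≥0 → Ω → (Fin d → ℝ)) (m : ℕ) (t : ℝ≥0) (ω : Ω) :
    ℝ≥0 :=
  gridTime (fun u => reservoir r X u ω) m t

omit [MeasurableSpace Ω] in
lemma crossGrid_eq (m : ℕ) (t : ℝ≥0) (ω : Ω) :
    crossGrid r X m t ω = crossIdx r X m t ω / 2 ^ m := rfl

/-- The process `X` at the first time at which `u - r · X_u` exceeds `t`. -/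
noncomputable def crossProcess (r : Fin d → ℝ) (X : ℝ≥0 → Ω → (Fin d → ℝ)) (t : ℝ≥0) (ω : Ω) :
    Fin d → ℝ :=
  X (crossTime r X t ω) ω

/-- The process `X` at the first point of the grid `2⁻ᵐ ℕ` at which `u - r · X_u` exceeds `t`. -/
noncomputable def crossGridProcess (r : Fin d → ℝ) (X : ℝ≥0 → Ω → (Fin d → ℝ)) (m : ℕ) (t : ℝ≥0)
    (ω : Ω) : Fin d → ℝ :=
  X (crossGrid r X m t ω) ω

/-- A regular subordinator `X`, subcritical with respect to `r`, for which `u - r · X_u` surely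
exceeds every level. -/
structure IsPassageReady (P : Measure Ω) (X : ℝ≥0 → Ω → (Fin d → ℝ)) (r : Fin d → ℝ) : Prop
    extends IsSubcritical P X r where
  regular : IsRegularSubordinator P X
  exceeds : ∀ ω, ∀ t : ℝ, ∃ k : ℕ, t < reservoir r X k ω

/-- The grid points `⌈2ᵐ u⌉ / 2ᵐ` approach `u` from the right. -/
lemma tendsto_ceil_grid (u : ℝ≥0) :
    Filter.Tendsto (fun m : ℕ => (⌈u * 2 ^ m⌉₊ : ℝ≥0) / 2 ^ m) Filter.atTop
      (nhdsWithin u (Ici u)) := by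
  have hle : ∀ m : ℕ, u ≤ (⌈u * 2 ^ m⌉₊ : ℝ≥0) / 2 ^ m := fun m => by
    rw [le_div_iff₀ (by positivity)]
    exact Nat.le_ceil _
  refine tendsto_nhdsWithin_iff.2 ⟨?_, .of_forall hle⟩
  have hlim : Filter.Tendsto (fun m : ℕ => u + (2 : ℝ≥0)⁻¹ ^ m) Filter.atTop (nhds (u + 0)) :=
    tendsto_const_nhds.add (NNReal.tendsto_pow_atTop_nhds_zero_of_lt_one
      (by norm_num [NNReal.inv_lt_one_iff]))
  rw [add_zero] at hlim
  refine tendsto_of_tendsto_of_tendsto_of_le_of_le tendsto_const_nhds hlim hle fun m => ?_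
  have := (Nat.ceil_lt_add_one (a := u * 2 ^ m) zero_le).le
  calc (⌈u * 2 ^ m⌉₊ : ℝ≥0) / 2 ^ m ≤ (u * 2 ^ m + 1) / 2 ^ m := by gcongr
    _ = u + (2 : ℝ≥0)⁻¹ ^ m := by
        rw [inv_pow, add_div, mul_div_cancel_right₀ _ (by positivity), one_div]

/-- Joint measurability, by right-continuity of the paths. -/
lemma IsRegularSubordinator.measurable_joint (hX : IsRegularSubordinator P X) :
    Measurable fun p : ℝ≥0 × Ω => X p.1 p.2 := by
  have hm : ∀ m : ℕ, Measurable fun p : ℝ≥0 × Ω => X ((⌈p.1 * 2 ^ m⌉₊ : ℝ≥0) / 2 ^ m) p.2 :=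
    fun m => measurable_apply_index (f := fun (k : ℕ) (p : ℝ≥0 × Ω) => X ((k : ℝ≥0) / 2 ^ m) p.2)
      (fun k => (hX.measurable _).comp measurable_snd)
      (Nat.measurable_ceil.comp (measurable_fst.mul_const _))
  refine measurable_of_tendsto_metrizable hm (tendsto_pi_nhds.2 fun p => ?_)
  exact (hX.rightCts p.2 p.1).tendsto.comp (tendsto_ceil_grid p.1)

namespace IsPassageReady

variable (hs : IsPassageReady P X r)

include hs

lemma skipFree (ω : Ω) : IsSkipFreePath fun u => reservoir r X u ω :=
  isSkipFreePath_reservoir hs.regular hs.nonneg (hs.exceeds ω)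

lemma measurable_crossIdx (m : ℕ) : Measurable fun p : ℝ≥0 × Ω => crossIdx r X m p.1 p.2 := by
  refine measurable_of_Iic fun k => ?_
  have : (fun p : ℝ≥0 × Ω => crossIdx r X m p.1 p.2) ⁻¹' Iic k =
      ⋃ j ∈ Finset.range (k + 1), {p | (p.1 : ℝ) < reservoir r X (j / 2 ^ m) p.2} := by
    ext p
    simp only [mem_preimage, mem_Iic, crossIdx, (hs.skipFree p.2).gridIdx_le_iff, mem_iUnion,
      Finset.mem_range, Nat.lt_succ_iff, exists_prop, mem_ofPred_eq]
  rw [this]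
  refine Finset.measurableSet_biUnion _ fun j _ => measurableSet_lt (by fun_prop) ?_
  exact (measurable_reservoir hs.regular.measurable _).comp measurable_snd

lemma measurable_crossGrid (m : ℕ) : Measurable fun p : ℝ≥0 × Ω => crossGrid r X m p.1 p.2 := by
  have h := hs.measurable_crossIdx m
  simp only [crossGrid_eq]
  exact (measurable_from_nat.comp h : Measurable
    ((fun k : ℕ => (k : ℝ≥0) / 2 ^ m) ∘ fun p : ℝ≥0 × Ω => crossIdx r X m p.1 p.2))

lemma measurable_crossTime : Measurable fun p : ℝ≥0 × Ω => crossTime r X p.1 p.2 :=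
  measurable_of_tendsto_metrizable (fun m => hs.measurable_crossGrid m)
    (tendsto_pi_nhds.2 fun p => (hs.skipFree p.2).tendsto_gridTime p.1)

lemma measurable_crossProcess_uncurry :
    Measurable fun p : ℝ≥0 × Ω => crossProcess r X p.1 p.2 :=
  hs.regular.measurable_joint.comp (hs.measurable_crossTime.prodMk measurable_snd)

lemma measurable_crossGridProcess_uncurry (m : ℕ) :
    Measurable fun p : ℝ≥0 × Ω => crossGridProcess r X m p.1 p.2 :=
  hs.regular.measurable_joint.comp ((hs.measurable_crossGrid m).prodMk measurable_snd)

lemma measurable_crossProcess (t : ℝ≥0) : Measurable (crossProcess r X t) :=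
  Measurable.of_uncurry_left (f := crossProcess r X) hs.measurable_crossProcess_uncurry

lemma measurable_crossGridProcess (m : ℕ) (t : ℝ≥0) : Measurable (crossGridProcess r X m t) :=
  Measurable.of_uncurry_left (f := crossGridProcess r X m)
    (hs.measurable_crossGridProcess_uncurry m)

lemma tendsto_crossGrid (t : ℝ≥0) (ω : Ω) :
    Filter.Tendsto (fun m => crossGrid r X m t ω) Filter.atTop (nhds (crossTime r X t ω)) :=
  (hs.skipFree ω).tendsto_gridTime t

lemma tendsto_crossGridProcess (t : ℝ≥0) (ω : Ω) :
    Filter.Tendsto (fun m => crossGridProcess r X m t ω) Filter.atTop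
      (nhds (crossProcess r X t ω)) :=
  (hs.regular.rightCts ω _).tendsto.comp ((hs.skipFree ω).tendsto_gridTime_right t)

lemma reservoir_crossTime (t : ℝ≥0) (ω : Ω) : reservoir r X (crossTime r X t ω) ω = t :=
  (hs.skipFree ω).apply_passTime t.2

lemma coe_crossTime (t : ℝ≥0) (ω : Ω) :
    (crossTime r X t ω : ℝ) = t + r ⬝ᵥ crossProcess r X t ω := by
  have := hs.reservoir_crossTime t ω
  unfold reservoir at this
  unfold crossProcess
  linarith

lemma crossTime_mono (ω : Ω) : Monotone fun t => crossTime r X t ω := fun _ _ hst =>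
  (hs.skipFree ω).passTime_mono (NNReal.coe_le_coe.2 hst)

lemma crossProcess_mono (ω : Ω) : Monotone fun t => crossProcess r X t ω :=
  (hs.regular.mono ω).comp (hs.crossTime_mono ω)

lemma crossProcess_nonneg (t : ℝ≥0) (ω : Ω) : 0 ≤ crossProcess r X t ω := hs.regular.nonneg _ _

lemma crossProcess_rightCts (ω : Ω) (t : ℝ≥0) :
    ContinuousWithinAt (fun s => crossProcess r X s ω) (Ici t) t := by
  have h1 : ContinuousWithinAt (fun s => crossTime r X s ω) (Ici t) t :=
    ((hs.skipFree ω).rightCts_passTime t).comp NNReal.continuous_coe.continuousWithinAt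
      fun s hs => NNReal.coe_le_coe.2 hs
  exact (hs.regular.rightCts ω _).comp h1 fun s hst => hs.crossTime_mono ω hst

lemma measurableSet_crossIdx_le (m : ℕ) (t : ℝ≥0) (k : ℕ) :
    MeasurableSet[pastSigma X (fun j => (j : ℝ≥0) / 2 ^ m) k] {ω | crossIdx r X m t ω ≤ k} := by
  have : {ω | crossIdx r X m t ω ≤ k} =
      ⋃ j ∈ Finset.range (k + 1), reservoir r X (j / 2 ^ m) ⁻¹' Ioi t := by
    ext ω
    simp only [crossIdx, (hs.skipFree ω).gridIdx_le_iff, mem_iUnion, mem_preimage, mem_Ioi,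
      Finset.mem_range, Nat.lt_succ_iff, exists_prop, mem_ofPred_eq]
  rw [this]
  refine Finset.measurableSet_biUnion _ fun j hj => ?_
  have h := measurable_pastSigma (X := X) (t := fun j => (j : ℝ≥0) / 2 ^ m)
    (Nat.lt_succ_iff.1 (Finset.mem_range.1 hj))
  have h' : Measurable[pastSigma X (fun j => (j : ℝ≥0) / 2 ^ m) k] (reservoir r X (j / 2 ^ m)) := by
    unfold reservoir
    exact measurable_const.sub ((measurable_dotProduct_right r).comp h)
  exact h' measurableSet_Ioi

omit hs in
lemma monotone_grid (m : ℕ) : Monotone fun j : ℕ => (j : ℝ≥0) / 2 ^ m := fun i j hij => by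
  have : (i : ℝ≥0) ≤ j := by exact_mod_cast hij
  simp only
  gcongr

/-- Functionals of the stopped values at passage indices that are at most `k` are determined at the
grid time `k`. -/
lemma measurable_indicator_crossGridProcess (m : ℕ) {n : ℕ} {t : Fin n → ℝ≥0} {s : ℝ≥0}
    (hts : ∀ i, t i ≤ s) {G : (Fin n → Fin d → ℝ) → ℝ≥0∞} (hG : Measurable G) (k : ℕ) :
    Measurable[pastSigma X (fun j => (j : ℝ≥0) / 2 ^ m) k]
      ({ω | crossIdx r X m s ω ≤ k}.indicator
        fun ω => G fun i => crossGridProcess r X m (t i) ω) := by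
  have h1 : {ω | crossIdx r X m s ω ≤ k}.indicator
      (fun ω => G fun i => crossGridProcess r X m (t i) ω) =
      {ω | crossIdx r X m s ω ≤ k}.indicator
        (fun ω => G fun i => X ((min (crossIdx r X m (t i) ω) k : ℕ) / 2 ^ m) ω) := by
    refine indicator_congr fun ω hω => ?_
    congr 1
    ext i : 1
    have : crossIdx r X m (t i) ω ≤ k :=
      ((hs.skipFree ω).gridIdx_mono m (NNReal.coe_le_coe.2 (hts i))).trans hω
    rw [min_eq_left this]
    rfl
  rw [h1]
  refine Measurable.indicator ?_ (hs.measurableSet_crossIdx_le m s k)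
  have h2 : ∀ i, Measurable[pastSigma X (fun j => (j : ℝ≥0) / 2 ^ m) k]
      fun ω => min (crossIdx r X m (t i) ω) k := by
    intro i
    refine measurable_nat_of_le fun j => ?_
    by_cases hj : k ≤ j
    · have : {ω | min (crossIdx r X m (t i) ω) k ≤ j} = univ := by
        ext ω; simp [hj]
      rw [this]
      exact MeasurableSet.univ
    · have : {ω | min (crossIdx r X m (t i) ω) k ≤ j} = {ω | crossIdx r X m (t i) ω ≤ j} := by
        ext ω; simp [hj]
      rw [this]
      exact pastSigma_mono X _ (not_le.1 hj).le _ (hs.measurableSet_crossIdx_le m (t i) j)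
  have h3 : ∀ j : ℕ, Measurable[pastSigma X (fun j => (j : ℝ≥0) / 2 ^ m) k]
      (X ((min j k : ℕ) / 2 ^ m)) := fun j =>
    measurable_pastSigma (t := fun j => (j : ℝ≥0) / 2 ^ m) (min_le_right j k)
  have h4 := measurable_comp_apply_index hG h3 h2
  simpa [min_assoc] using h4

variable [IsProbabilityMeasure P]

/-- Optional stopping of the bounded martingale `exp (-z·X_u + c Z_u)`, `Z_u = u - r·X_u`,
`c = φ(z + c r)`, along the grid `2⁻ᵐ ℕ`. -/
lemma lintegral_stopped_grid {z : Fin d → ℝ} (hz : 0 ≤ z) {c : ℝ} (hc0 : 0 ≤ c)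
    (hc : laplaceExponent P X (z + c • r) = c) (m : ℕ) (t : ℝ≥0) {a : Ω → ℕ}
    (hat : ∀ ω, a ω ≤ crossIdx r X m t ω)
    (ha : ∀ k, MeasurableSet[pastSigma X (fun j => (j : ℝ≥0) / 2 ^ m) k] {ω | a ω ≤ k})
    {W : Ω → ℝ≥0∞} (hWm : Measurable W) {C : ℝ≥0} (hWb : ∀ ω, W ω ≤ C)
    (hW : ∀ k, Measurable[pastSigma X (fun j => (j : ℝ≥0) / 2 ^ m) k]
      ({ω | a ω ≤ k}.indicator W)) :
    ∫⁻ ω, W ω * (lexp z (crossGridProcess r X m t ω) *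
        ENNReal.ofReal (Real.exp (c * reservoir r X (crossGrid r X m t ω) ω))) ∂P =
      ∫⁻ ω, W ω * (lexp z (X (a ω / 2 ^ m) ω) *
        ENNReal.ofReal (Real.exp (c * reservoir r X (a ω / 2 ^ m) ω))) ∂P := by
  set N : ℕ → Ω → ℝ≥0∞ := fun k ω => lexp z (X (k / 2 ^ m) ω) *
    ENNReal.ofReal (Real.exp (c * reservoir r X (k / 2 ^ m) ω)) with hN
  have hzc : 0 ≤ z + c • r := add_nonneg hz (smul_nonneg hc0 hs.nonneg)
  have hNval : ∀ k ω, N k ω = ENNReal.ofReal (Real.exp (c * (k / 2 ^ m))) *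
      lexp (z + c • r) (X (k / 2 ^ m) ω) := by
    intro k ω
    simp only [hN, lexp]
    rw [← ENNReal.ofReal_mul (Real.exp_nonneg _), ← ENNReal.ofReal_mul (Real.exp_nonneg _),
      ← Real.exp_add, ← Real.exp_add]
    congr 2
    simp only [reservoir, add_dotProduct, smul_dotProduct, smul_eq_mul]
    push_cast
    ring
  have hNm : ∀ k, Measurable (N k) := fun k => by
    have h1 := hs.regular.measurable (k / 2 ^ m)
    have h2 := measurable_reservoir (r := r) hs.regular.measurable (k / 2 ^ m)
    simp only [hN]
    fun_prop
  have hmart : ∀ (k : ℕ) (G : Ω → ℝ≥0∞),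
      Measurable[pastSigma X (fun j => (j : ℝ≥0) / 2 ^ m) k] G →
      ∫⁻ ω, G ω * N (k + 1) ω ∂P = ∫⁻ ω, G ω * N k ω ∂P := by
    intro k G hG
    have hG' : Measurable G := hG.mono (pastSigma_le hs.regular.measurable _ k) le_rfl
    have h := hs.regular.lintegral_mul_lexp (monotone_grid m) (by simp) k ((2 ^ m)⁻¹) hzc hG
    have e : ∀ j : ℕ, ∫⁻ ω, G ω * N j ω ∂P = ENNReal.ofReal (Real.exp (c * (j / 2 ^ m))) *
        ∫⁻ ω, G ω * lexp (z + c • r) (X (j / 2 ^ m) ω) ∂P := by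
      intro j
      have := hs.regular.measurable (j / 2 ^ m)
      rw [← lintegral_const_mul _ (by fun_prop)]
      refine lintegral_congr fun ω => ?_
      rw [hNval]
      ring
    have h5 : ((k + 1 : ℕ) : ℝ≥0) / 2 ^ m = k / 2 ^ m + (2 ^ m)⁻¹ := by
      push_cast
      rw [add_div, one_div]
    rw [e, e, h5, h, hc, ← mul_assoc, mul_right_comm, ← ENNReal.ofReal_mul (Real.exp_nonneg _),
      ← Real.exp_add]
    congr 3
    push_cast
    ring_nf
  have hopt := setLIntegral_stopped_eq (P := P) (pastSigma_le hs.regular.measurable _) hNm hmart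
    hat (fun k => by
      have : {ω | k < crossIdx r X m t ω} = {ω | crossIdx r X m t ω ≤ k}ᶜ := by
        ext ω; simp
      rw [this]
      exact (hs.measurableSet_crossIdx_le m t k).compl) ha hW
  -- before and at the passage the martingale is bounded, as the overshoot is at most the mesh
  have hbound : ∀ k ω, k ≤ crossIdx r X m t ω →
      N k ω ≤ ENNReal.ofReal (Real.exp (c * (t + 1))) := by
    intro k ω hk
    have h1 : reservoir r X (k / 2 ^ m) ω ≤ t + 1 := by
      rcases hk.lt_or_eq with hk | rfl
      · have : reservoir r X (k / 2 ^ m) ω ≤ t := by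
          by_contra hcon
          have : crossIdx r X m t ω ≤ k := Nat.sInf_le (not_le.1 hcon)
          omega
        linarith
      · refine ((hs.skipFree ω).apply_gridTime_le m t.coe_nonneg).trans ?_
        gcongr
        exact inv_le_one_of_one_le₀ (one_le_pow₀ (by norm_num))
    calc N k ω ≤ 1 * ENNReal.ofReal (Real.exp (c * (t + 1))) := by
          simp only [hN]
          gcongr
          exact lexp_le_one hz (hs.regular.nonneg _ _)
      _ = _ := one_mul _
  have ha' : Measurable a :=
    measurable_of_Iic fun k => pastSigma_le hs.regular.measurable _ k _ (ha k)
  have hidx : Measurable (crossIdx r X m t) :=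
    Measurable.of_uncurry_left (f := crossIdx r X m) (hs.measurable_crossIdx m)
  have hlim : ∀ (n : ℕ → Ω → ℕ) (n' : Ω → ℕ), (∀ K, Measurable (n K)) →
      (∀ K ω, n K ω ≤ crossIdx r X m t ω) →
      (∀ ω, ∀ᶠ K in Filter.atTop, n K ω = n' ω) →
      Filter.Tendsto (fun K => ∫⁻ ω in {ω | a ω ≤ K}, W ω * N (n K ω) ω ∂P) Filter.atTop
        (nhds (∫⁻ ω, W ω * N (n' ω) ω ∂P)) := by
    intro n n' hnm hnle hn
    have hset : ∀ K, MeasurableSet {ω | a ω ≤ K} := fun K => ha' measurableSet_Iic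
    simp_rw [← lintegral_indicator (hset _)]
    refine tendsto_lintegral_of_dominated_convergence
      (fun _ => C * ENNReal.ofReal (Real.exp (c * (t + 1)))) (fun K => ?_) (fun K => ?_) ?_ ?_
    · exact (hWm.mul (measurable_apply_index hNm (hnm K))).indicator (hset K)
    · refine ae_of_all _ fun ω => (indicator_le_self _ _ ω).trans ?_
      exact mul_le_mul' (hWb ω) (hbound _ ω (hnle K ω))
    · simp [ENNReal.mul_ne_top]
    · refine ae_of_all _ fun ω => ?_
      refine tendsto_const_nhds.congr' ?_
      filter_upwards [hn ω, Filter.eventually_ge_atTop (a ω)] with K h1 h2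
      rw [indicator_of_mem (show ω ∈ {ω | a ω ≤ K} from h2), h1]
  have l1 := hlim (fun K ω => min (crossIdx r X m t ω) K) (crossIdx r X m t)
    (fun K => hidx.min measurable_const) (fun K ω => min_le_left _ _) (fun ω => by
      filter_upwards [Filter.eventually_ge_atTop (crossIdx r X m t ω)] with K hK
      exact min_eq_left hK)
  have l2 := hlim (fun _ => a) a (fun _ => ha') (fun _ => hat) (fun ω => .of_forall fun _ => rfl)
  simp_rw [hopt] at l1
  exact tendsto_nhds_unique l1 l2

end IsPassageReady

end Passage

/-! ### The passage process is a subordinator -/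

section Passage

variable {Ω : Type*} [MeasurableSpace Ω] {P : Measure Ω} {d : ℕ}
  {X : ℝ≥0 → Ω → (Fin d → ℝ)} {r : Fin d → ℝ}

lemma lexp_sub (z x y : Fin d → ℝ) : lexp z (y - x) = (lexp z x)⁻¹ * lexp z y := by
  have h : lexp z y = lexp z x * lexp z (y - x) := by rw [← lexp_add, add_sub_cancel]
  rw [h, ← mul_assoc, ENNReal.inv_mul_cancel (lexp_ne_zero _ _) (lexp_ne_top _ _), one_mul]

/-- Random vectors with values in the orthant have the same law as soon as their Laplace transforms
agree on `ℕ^d`, even on a smaller event. -/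
lemma map_restrict_eq_of_lexp [IsFiniteMeasure P] {V : Ω → Fin d → ℝ} (hV : Measurable V)
    (hV0 : ∀ᵐ ω ∂P, 0 ≤ V ω) {ν : Measure (Fin d → ℝ)} [IsFiniteMeasure ν]
    (hν : ∀ᵐ x ∂ν, 0 ≤ x) (A : Set Ω)
    (h : ∀ n : Fin d → ℕ, ∫⁻ ω in A, lexp (fun i => (n i : ℝ)) (V ω) ∂P =
      ∫⁻ x, lexp (fun i => (n i : ℝ)) x ∂ν) :
    (P.restrict A).map V = ν := by
  refine ext_of_lintegral_lexp ?_ hν fun n => ?_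
  · rw [ae_map_iff hV.aemeasurable measurableSet_Ici]
    exact ae_restrict_of_ae hV0
  · rw [lintegral_map (measurable_lexp _) hV, h n]

lemma lintegral_map_withDensity {α β : Type*} [MeasurableSpace α] [MeasurableSpace β]
    {μ : Measure α} {w : α → ℝ≥0∞} (hw : Measurable w) {V : α → β} (hV : Measurable V)
    {F : β → ℝ≥0∞} (hF : Measurable F) :
    ∫⁻ x, F x ∂((μ.withDensity w).map V) = ∫⁻ a, w a * F (V a) ∂μ := by
  rw [lintegral_map hF hV]
  exact lintegral_withDensity_eq_lintegral_mul _ hw (hF.comp hV)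

namespace IsPassageReady

variable [IsProbabilityMeasure P] (hs : IsPassageReady P X r)

include hs

/-- The weights `exp (-z·X_u + c Z_u)` at the grid passage times converge boundedly. -/
lemma tendsto_lintegral_grid {z : Fin d → ℝ} (hz : 0 ≤ z) {c : ℝ} (hc0 : 0 ≤ c) (t : ℝ≥0)
    {W : ℕ → Ω → ℝ≥0∞} {W' : Ω → ℝ≥0∞} (hWm : ∀ m, Measurable (W m)) {C : ℝ≥0}
    (hWb : ∀ m ω, W m ω ≤ C)
    (hW : ∀ ω, Filter.Tendsto (fun m => W m ω) Filter.atTop (nhds (W' ω))) :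
    Filter.Tendsto (fun m => ∫⁻ ω, W m ω * (lexp z (crossGridProcess r X m t ω) *
        ENNReal.ofReal (Real.exp (c * reservoir r X (crossGrid r X m t ω) ω))) ∂P) Filter.atTop
      (nhds (∫⁻ ω, W' ω * (lexp z (crossProcess r X t ω) *
        ENNReal.ofReal (Real.exp (c * t))) ∂P)) := by
  have hres : ∀ m, Measurable fun ω => reservoir r X (crossGrid r X m t ω) ω := by
    intro m
    have h1 := hs.measurable_crossGridProcess m t
    have h2 : Measurable (crossGrid r X m t) :=
      Measurable.of_uncurry_left (f := crossGrid r X m) (hs.measurable_crossGrid m)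
    change Measurable fun ω => (crossGrid r X m t ω : ℝ) - r ⬝ᵥ crossGridProcess r X m t ω
    fun_prop
  have hlim : ∀ ω, Filter.Tendsto (fun m => reservoir r X (crossGrid r X m t ω) ω) Filter.atTop
      (nhds (t : ℝ)) := by
    intro ω
    rw [← hs.reservoir_crossTime t ω]
    exact ((hs.skipFree ω).rightCts _).tendsto.comp ((hs.skipFree ω).tendsto_gridTime_right t)
  refine tendsto_lintegral_of_dominated_convergence
    (fun _ => C * (1 * ENNReal.ofReal (Real.exp (c * (t + 1))))) (fun m => ?_)
    (fun m => ae_of_all _ fun ω => ?_) (by simp [ENNReal.mul_ne_top]) (ae_of_all _ fun ω => ?_)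
  · have h1 := hs.measurable_crossGridProcess m t
    have h2 := hres m
    have h3 := hWm m
    fun_prop
  · have : reservoir r X (crossGrid r X m t ω) ω ≤ t + 1 := by
      refine ((hs.skipFree ω).apply_gridTime_le m t.coe_nonneg).trans ?_
      gcongr
      exact inv_le_one_of_one_le₀ (one_le_pow₀ (by norm_num))
    exact mul_le_mul' (hWb m ω) (mul_le_mul' (lexp_le_one hz (hs.regular.nonneg _ _))
      (ENNReal.ofReal_le_ofReal (Real.exp_le_exp.2 (mul_le_mul_of_nonneg_left this hc0))))
  · have h1 : Filter.Tendsto (fun m => lexp z (crossGridProcess r X m t ω)) Filter.atTop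
        (nhds (lexp z (crossProcess r X t ω))) :=
      ((continuous_lexp z).tendsto _).comp (hs.tendsto_crossGridProcess t ω)
    have h2 : Filter.Tendsto (fun m => ENNReal.ofReal
        (Real.exp (c * reservoir r X (crossGrid r X m t ω) ω))) Filter.atTop
        (nhds (ENNReal.ofReal (Real.exp (c * t)))) :=
      ENNReal.tendsto_ofReal ((Real.continuous_exp.tendsto _).comp ((hlim ω).const_mul c))
    have h3 := ENNReal.Tendsto.mul h1 (Or.inr ENNReal.ofReal_ne_top) h2 (Or.inr (lexp_ne_top _ _))
    exact ENNReal.Tendsto.mul (hW ω) (Or.inr (ENNReal.mul_ne_top (lexp_ne_top _ _)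
      ENNReal.ofReal_ne_top)) h3 (Or.inr (ne_top_of_le_ne_top ENNReal.coe_ne_top
        (le_of_tendsto' (hW ω) fun m => hWb m ω)))

/-- The Laplace transform of `Y_t`: the martingale `exp (-z·X_u + c Z_u)` starts at `1` and equals
`exp (-z·Y_t + c t)` at the passage of `t`. -/
lemma lintegral_lexp_crossProcess {z : Fin d → ℝ} (hz : 0 ≤ z) {c : ℝ} (hc0 : 0 ≤ c)
    (hc : laplaceExponent P X (z + c • r) = c) (t : ℝ≥0) :
    ∫⁻ ω, lexp z (crossProcess r X t ω) ∂P = ENNReal.ofReal (Real.exp (-(t * c))) := by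
  have h1 := hs.tendsto_lintegral_grid (C := 1) hz hc0 t (W := fun _ _ => 1) (W' := fun _ => 1)
    (fun _ => measurable_const) (fun _ _ => by simp) (fun _ => tendsto_const_nhds)
  have h2 : ∀ m, ∫⁻ ω, 1 * (lexp z (crossGridProcess r X m t ω) *
      ENNReal.ofReal (Real.exp (c * reservoir r X (crossGrid r X m t ω) ω))) ∂P = 1 := by
    intro m
    rw [hs.lintegral_stopped_grid hz hc0 hc m t (a := fun _ => 0) (fun _ => Nat.zero_le _)
      (fun k => by simp) (W := fun _ => 1) measurable_const (C := 1) (fun _ => by simp)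
      (fun k => measurable_const.indicator (by simp))]
    simp [hs.regular.start_zero, reservoir_zero hs.regular]
  simp_rw [h2] at h1
  have h3 := tendsto_nhds_unique h1 tendsto_const_nhds
  have hm := hs.measurable_crossProcess t
  simp only [one_mul] at h3
  rw [lintegral_mul_const _ (by fun_prop)] at h3
  rw [mul_comm, Real.exp_neg, ENNReal.ofReal_inv_of_pos (Real.exp_pos _)]
  exact ENNReal.eq_inv_of_mul_eq_one_left h3

/-- The martingale property of `exp (-z·Y_t + c t)`, tested against a bounded continuous functional
of finitely many earlier values of `Y`. -/
lemma lintegral_mul_lexp_crossProcess {z : Fin d → ℝ} (hz : 0 ≤ z) {c : ℝ} (hc0 : 0 ≤ c)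
    (hc : laplaceExponent P X (z + c • r) = c) {n : ℕ} {v : Fin n → ℝ≥0} {s t : ℝ≥0}
    (hvs : ∀ i, v i ≤ s) (hst : s ≤ t) (G : BoundedContinuousFunction (Fin n → Fin d → ℝ) ℝ≥0) :
    ∫⁻ ω, G (fun i => crossProcess r X (v i) ω) *
        (lexp z (crossProcess r X t ω) * ENNReal.ofReal (Real.exp (c * t))) ∂P =
      ∫⁻ ω, G (fun i => crossProcess r X (v i) ω) *
        (lexp z (crossProcess r X s ω) * ENNReal.ofReal (Real.exp (c * s))) ∂P := by
  obtain ⟨C, hC⟩ : ∃ C : ℝ≥0, ∀ x, G x ≤ C :=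
    ⟨_, fun x => BoundedContinuousFunction.NNReal.upper_bound G x⟩
  have hGm : Measurable fun x => (G x : ℝ≥0∞) := G.continuous.measurable.coe_nnreal_ennreal
  set W : ℕ → Ω → ℝ≥0∞ := fun m ω => G (fun i => crossGridProcess r X m (v i) ω) with hWdef
  have hWm : ∀ m, Measurable (W m) := fun m =>
    hGm.comp (measurable_pi_lambda _ fun i => hs.measurable_crossGridProcess m (v i))
  have hWb : ∀ m ω, W m ω ≤ C := fun m ω => ENNReal.coe_le_coe.2 (hC _)
  have hW : ∀ ω, Filter.Tendsto (fun m => W m ω) Filter.atTop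
      (nhds (G (fun i => crossProcess r X (v i) ω) : ℝ≥0∞)) := fun ω =>
    ENNReal.tendsto_coe.2 ((G.continuous.tendsto _).comp
      (tendsto_pi_nhds.2 fun i => hs.tendsto_crossGridProcess (v i) ω))
  have h1 := hs.tendsto_lintegral_grid hz hc0 t hWm hWb hW
  have h2 := hs.tendsto_lintegral_grid hz hc0 s hWm hWb hW
  refine tendsto_nhds_unique h1 (h2.congr fun m => ?_)
  exact (hs.lintegral_stopped_grid hz hc0 hc m t (a := crossIdx r X m s)
    (fun ω => (hs.skipFree ω).gridIdx_mono m (NNReal.coe_le_coe.2 hst))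
    (hs.measurableSet_crossIdx_le m s) (hWm m) (hWb m)
    (hs.measurable_indicator_crossGridProcess m hvs hGm)).symm

/-- Given finitely many earlier values, `Y_t - Y_s` has Laplace transform `exp (-(t - s) c)`. -/
lemma setLIntegral_lexp_increment {z : Fin d → ℝ} (hz : 0 ≤ z) {c : ℝ} (hc0 : 0 ≤ c)
    (hc : laplaceExponent P X (z + c • r) = c) {n : ℕ} {v : Fin n → ℝ≥0} {s t : ℝ≥0}
    (hvs : ∀ i, v i ≤ s) {i₀ : Fin n} (hi₀ : v i₀ = s) (hst : s ≤ t)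
    {B : Set (Fin n → Fin d → ℝ)} (hB : MeasurableSet B) :
    ∫⁻ ω in (fun ω i => crossProcess r X (v i) ω) ⁻¹' B,
        lexp z (crossProcess r X t ω - crossProcess r X s ω) ∂P =
      P ((fun ω i => crossProcess r X (v i) ω) ⁻¹' B) *
        ENNReal.ofReal (Real.exp (-((t - s) * c))) := by
  have hYm := hs.measurable_crossProcess
  set Yv : Ω → Fin n → Fin d → ℝ := fun ω i => crossProcess r X (v i) ω with hYv
  have hYvm : Measurable Yv := measurable_pi_lambda _ fun i => hYm (v i)
  set w : ℝ≥0 → Ω → ℝ≥0∞ := fun t ω => lexp z (crossProcess r X t ω) *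
    ENNReal.ofReal (Real.exp (c * t)) with hw
  have hwm : ∀ t, Measurable (w t) := fun t => by
    have := hYm t
    simp only [hw]
    fun_prop
  have hfin : ∀ t, IsFiniteMeasure (P.withDensity (w t)) := fun t => by
    refine isFiniteMeasure_withDensity (ne_top_of_le_ne_top
      (b := ENNReal.ofReal (Real.exp (c * t))) ENNReal.ofReal_ne_top ?_)
    calc ∫⁻ ω, w t ω ∂P ≤ ∫⁻ ω, 1 * ENNReal.ofReal (Real.exp (c * t)) ∂P := by
          refine lintegral_mono fun ω => ?_
          simp only [hw]
          gcongr
          exact lexp_le_one hz (hs.crossProcess_nonneg _ _)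
      _ = _ := by simp
  have hmeas : (P.withDensity (w t)).map Yv = (P.withDensity (w s)).map Yv := by
    refine ext_of_forall_lintegral_eq_of_IsFiniteMeasure fun G => ?_
    have hGm : Measurable fun x => (G x : ℝ≥0∞) := G.continuous.measurable.coe_nnreal_ennreal
    have e : ∀ u, ∫⁻ x, G x ∂((P.withDensity (w u)).map Yv) = ∫⁻ ω, G (Yv ω) * w u ω ∂P := by
      intro u
      rw [lintegral_map_withDensity (hwm u) hYvm hGm]
      exact lintegral_congr fun ω => mul_comm _ _
    rw [e, e]
    exact hs.lintegral_mul_lexp_crossProcess hz hc0 hc hvs hst G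
  -- testing against `exp (z·Y_s)` on `B` turns `exp (-z·Y_t)` into `exp (-z·(Y_t - Y_s))`
  set F : (Fin n → Fin d → ℝ) → ℝ≥0∞ := B.indicator fun x => (lexp z (x i₀))⁻¹ with hF
  have hFm : Measurable F := by
    refine Measurable.indicator ?_ hB
    exact ((measurable_lexp z).comp (measurable_pi_apply i₀)).inv
  have e : ∀ u, ∫⁻ x, F x ∂((P.withDensity (w u)).map Yv) =
      (∫⁻ ω in Yv ⁻¹' B, lexp z (crossProcess r X u ω - crossProcess r X s ω) ∂P) *
        ENNReal.ofReal (Real.exp (c * u)) := by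
    intro u
    have h1 := hYm u
    have h2 := hYm s
    rw [lintegral_map_withDensity (hwm u) hYvm hFm, ← lintegral_mul_const _ (by fun_prop),
      ← lintegral_indicator (hYvm hB)]
    refine lintegral_congr fun ω => ?_
    by_cases hω : Yv ω ∈ B
    · have hω' : ω ∈ Yv ⁻¹' B := hω
      simp only [hF, indicator_of_mem hω, indicator_of_mem hω',
        lexp_sub, hw]
      have : Yv ω i₀ = crossProcess r X s ω := by simp only [hYv, hi₀]
      rw [this]
      ring
    · have hω' : ω ∉ Yv ⁻¹' B := hω
      simp [hF, indicator_of_notMem hω, indicator_of_notMem hω']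
  have h := e t
  rw [hmeas, e s] at h
  simp only [sub_self, lexp_zero_right, setLIntegral_const, one_mul] at h
  have h3 : ENNReal.ofReal (Real.exp (c * t)) * ENNReal.ofReal (Real.exp (-(c * t))) = 1 := by
    rw [← ENNReal.ofReal_mul (Real.exp_nonneg _), ← Real.exp_add]
    simp
  have h4 := congrArg (· * ENNReal.ofReal (Real.exp (-(c * t)))) h
  simp only [mul_assoc, h3, mul_one] at h4
  rw [← h4, ← ENNReal.ofReal_mul (Real.exp_nonneg _), ← Real.exp_add]
  congr 3
  ring

/-- The increment `Y_t - Y_s` has the law of `Y_{t-s}`, conditionally on finitely many values of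
`Y` up to time `s`. -/
lemma map_restrict_increment {n : ℕ} {v : Fin n → ℝ≥0} {s u : ℝ≥0}
    (hvs : ∀ i, v i ≤ s) {i₀ : Fin n} (hi₀ : v i₀ = s)
    {B : Set (Fin n → Fin d → ℝ)} (hB : MeasurableSet B) :
    (P.restrict ((fun ω i => crossProcess r X (v i) ω) ⁻¹' B)).map
        (fun ω => crossProcess r X (s + u) ω - crossProcess r X s ω) =
      P ((fun ω i => crossProcess r X (v i) ω) ⁻¹' B) • P.map (crossProcess r X u) := by
  have hYm := hs.measurable_crossProcess
  have hfin : IsFiniteMeasure (P ((fun ω i => crossProcess r X (v i) ω) ⁻¹' B) •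
      P.map (crossProcess r X u)) := Measure.smul_finite _ (measure_ne_top _ _)
  refine map_restrict_eq_of_lexp ((hYm _).sub (hYm _)) (ae_of_all _ fun ω => ?_) ?_ _ fun n => ?_
  · exact sub_nonneg.2 (hs.crossProcess_mono ω (le_add_of_nonneg_right zero_le))
  · refine Measure.ae_smul_measure ?_ _
    rw [ae_map_iff (hYm u).aemeasurable measurableSet_Ici]
    exact ae_of_all _ fun ω => hs.crossProcess_nonneg _ _
  · have hn : (0 : Fin d → ℝ) ≤ fun i => (n i : ℝ) := fun i => Nat.cast_nonneg _
    obtain ⟨c, hc0, hc⟩ := hs.exists_laplaceExponent_eq hs.regular hn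
    simp only [Pi.sub_apply]
    rw [hs.setLIntegral_lexp_increment hn hc0 hc hvs hi₀ (le_add_of_nonneg_right zero_le) hB,
      lintegral_smul_measure, lintegral_map (measurable_lexp _) (hYm u),
      hs.lintegral_lexp_crossProcess hn hc0 hc u]
    simp

lemma map_increment (s u : ℝ≥0) :
    P.map (fun ω => crossProcess r X (s + u) ω - crossProcess r X s ω) =
      P.map (crossProcess r X u) := by
  have := hs.map_restrict_increment (n := 1) (v := fun _ => s) (s := s) (u := u) (fun _ => le_rfl)
    (i₀ := 0) rfl MeasurableSet.univ
  simpa using this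

lemma crossProcess_zero_ae : ∀ᵐ ω ∂P, crossProcess r X 0 ω = 0 := by
  obtain ⟨c, hc0, hc⟩ := hs.exists_laplaceExponent_eq hs.regular
    (show (0 : Fin d → ℝ) ≤ 1 from zero_le_one)
  have h1 := hs.lintegral_lexp_crossProcess zero_le_one hc0 hc 0
  have hm := hs.measurable_crossProcess 0
  have h2 : (fun ω => lexp 1 (crossProcess r X 0 ω)) =ᵐ[P] fun _ => 1 :=
    ae_eq_of_ae_le_of_lintegral_le
      (ae_of_all _ fun ω => lexp_le_one zero_le_one (hs.crossProcess_nonneg _ _))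
      (by simp [h1]) aemeasurable_const (by simp [h1])
  filter_upwards [h2] with ω hω
  have h3 : (1 : Fin d → ℝ) ⬝ᵥ crossProcess r X 0 ω = 0 := by
    simp only [lexp] at hω
    have := congrArg ENNReal.toReal hω
    rw [ENNReal.toReal_ofReal (Real.exp_nonneg _)] at this
    simpa using this
  simp only [dotProduct, Pi.one_apply, one_mul] at h3
  ext i
  exact (Finset.sum_eq_zero_iff_of_nonneg fun i _ => hs.crossProcess_nonneg 0 ω i).1 h3 i
    (Finset.mem_univ i)

/-- The passage process is a subordinator. -/
theorem isSubordinator_crossProcess : IsSubordinator P (crossProcess r X) where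
  measurable := hs.measurable_crossProcess
  start := hs.crossProcess_zero_ae
  indep_increments := by
    refine HasIndepIncrements.of_indep_pastSigma fun t ht k => ?_
    rw [indepFun_iff_measure_inter_preimage_eq_mul]
    intro B D hB hD
    have hYm := hs.measurable_crossProcess
    have hDm : Measurable fun ω => crossProcess r X (t (k + 1)) ω - crossProcess r X (t k) ω :=
      (hYm _).sub (hYm _)
    obtain ⟨u, hu⟩ := exists_add_of_le (ht (Nat.le_succ k))
    have h := hs.map_restrict_increment (v := fun j : Fin (k + 1) => t j) (s := t k) (u := u)
      (fun i => ht (by omega)) (i₀ := Fin.last k) (by simp) hB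
    rw [← hs.map_increment (t k) u, ← hu] at h
    have h' := congrArg (fun μ => μ D) h
    simp only [Measure.smul_apply, smul_eq_mul] at h'
    rw [Measure.map_apply hDm hD, Measure.map_apply hDm hD, Measure.restrict_apply (hDm hD)] at h'
    rw [inter_comm]
    exact h'
  stationary_increments := fun s t =>
    ⟨((hs.measurable_crossProcess _).sub (hs.measurable_crossProcess _)).aemeasurable,
      (hs.measurable_crossProcess t).aemeasurable, hs.map_increment s t⟩
  monotone := ae_of_all _ hs.crossProcess_mono
  right_continuous := ae_of_all _ hs.crossProcess_rightCts

omit [IsProbabilityMeasure P] in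
lemma firstPassageTime_le_crossTime (t : ℝ≥0) (ω : Ω) :
    firstPassageTime (reservoir r X) t ω ≤ crossTime r X t ω :=
  iInf₂_le (crossTime r X t ω) (hs.reservoir_crossTime t ω)

omit [IsProbabilityMeasure P] in
lemma crossTime_le_firstPassageTime {s t : ℝ≥0} (hst : s < t) (ω : Ω) :
    (crossTime r X s ω : ℝ≥0∞) ≤ firstPassageTime (reservoir r X) t ω := by
  refine le_iInf₂ fun u hu => ENNReal.coe_le_coe.2 ?_
  refine (hs.skipFree ω).passTime_le_of_lt_apply ?_
  rw [hu]
  exact NNReal.coe_lt_coe.2 hst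

/-- The time of hitting `t` and the time of exceeding `t` agree almost surely: the former is at
least `σ_s` for every `s < t`, and `σ_s = s + r·Y_s` tends to `σ_t` almost surely as `s` increases to `t`,
because the Laplace transform of `r·Y_s` is continuous in `s`. -/
lemma firstPassageTime_ae_eq (t : ℝ≥0) :
    ∀ᵐ ω ∂P, firstPassageTime (reservoir r X) t ω = crossTime r X t ω := by
  rcases eq_or_ne t 0 with rfl | ht
  · filter_upwards [hs.crossProcess_zero_ae] with ω hω
    refine le_antisymm (hs.firstPassageTime_le_crossTime 0 ω) ?_
    have : crossTime r X 0 ω = 0 := by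
      have := hs.coe_crossTime 0 ω
      rw [hω] at this
      simpa using this
    simp [this]
  set s : ℕ → ℝ≥0 := fun n => t - 1 / (n + 1) with hsdef
  have hst : ∀ n, s n < t := fun n => tsub_lt_self (pos_iff_ne_zero.2 ht) (by positivity)
  have hsmono : Monotone s := fun n m hnm => by
    have : (n : ℝ≥0) ≤ m := by exact_mod_cast hnm
    simp only [hsdef]
    gcongr
  have hslim : Filter.Tendsto s Filter.atTop (nhds t) := by
    have : Filter.Tendsto (fun n : ℕ => t - 1 / ((n : ℝ≥0) + 1)) Filter.atTop (nhds (t - 0)) :=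
      tendsto_const_nhds.sub tendsto_one_div_add_atTop_nhds_zero_nat
    rwa [tsub_zero] at this
  obtain ⟨c, hc0, hc⟩ := hs.exists_laplaceExponent_eq hs.regular hs.nonneg
  have hL := hs.lintegral_lexp_crossProcess hs.nonneg hc0 hc
  have hYm := hs.measurable_crossProcess
  have hle : ∀ ω, lexp r (crossProcess r X t ω) ≤ ⨅ n, lexp r (crossProcess r X (s n) ω) :=
    fun ω => le_iInf fun n => lexp_le_lexp hs.nonneg (hs.crossProcess_mono ω (hst n).le)
  have hint : ∫⁻ ω, ⨅ n, lexp r (crossProcess r X (s n) ω) ∂P ≤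
      ∫⁻ ω, lexp r (crossProcess r X t ω) ∂P := by
    have hlim : Filter.Tendsto (fun n => ∫⁻ ω, lexp r (crossProcess r X (s n) ω) ∂P) Filter.atTop
        (nhds (∫⁻ ω, lexp r (crossProcess r X t ω) ∂P)) := by
      simp_rw [hL]
      refine ENNReal.tendsto_ofReal ((Real.continuous_exp.tendsto _).comp ?_)
      exact (((NNReal.continuous_coe.tendsto _).comp hslim).mul_const c).neg
    exact ge_of_tendsto' hlim fun n => lintegral_mono fun ω => iInf_le _ n
  have hae := ae_eq_of_ae_le_of_lintegral_le (ae_of_all P hle)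
    (by rw [hL]; exact ENNReal.ofReal_ne_top) (Measurable.aemeasurable (by
      exact Measurable.iInf fun n => (measurable_lexp r).comp (hYm _))) hint
  filter_upwards [hae] with ω hω
  refine le_antisymm (hs.firstPassageTime_le_crossTime t ω) ?_
  obtain ⟨τ, hτ⟩ : ∃ τ : ℝ≥0, (τ : ℝ≥0∞) = firstPassageTime (reservoir r X) t ω :=
    ⟨_, ENNReal.coe_toNNReal (ne_top_of_le_ne_top ENNReal.coe_ne_top
      (hs.firstPassageTime_le_crossTime t ω))⟩
  have h1 : ∀ n, r ⬝ᵥ crossProcess r X (s n) ω ≤ τ - t := by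
    intro n
    have hlim : Filter.Tendsto (fun m => (τ : ℝ) - s m) Filter.atTop (nhds (τ - t)) :=
      tendsto_const_nhds.sub ((NNReal.continuous_coe.tendsto _).comp hslim)
    refine ge_of_tendsto hlim ?_
    filter_upwards [Filter.eventually_ge_atTop n] with m hm
    have h2 := hs.crossTime_le_firstPassageTime (hst m) ω
    rw [← hτ, ENNReal.coe_le_coe, ← NNReal.coe_le_coe, hs.coe_crossTime] at h2
    have h3 := dotProduct_le_dotProduct_right hs.nonneg (hs.crossProcess_mono ω (hsmono hm))
    simp only at h3
    linarith
  have h4 : ENNReal.ofReal (Real.exp (-(τ - t))) ≤ lexp r (crossProcess r X t ω) := by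
    rw [hω]
    exact le_iInf fun n => ENNReal.ofReal_le_ofReal (Real.exp_le_exp.2 (neg_le_neg (h1 n)))
  unfold lexp at h4
  rw [ENNReal.ofReal_le_ofReal_iff (Real.exp_nonneg _), Real.exp_le_exp] at h4
  rw [← hτ, ENNReal.coe_le_coe, ← NNReal.coe_le_coe, hs.coe_crossTime]
  linarith

lemma passageProcess_ae_eq (t : ℝ≥0) : passageProcess r X t =ᵐ[P] crossProcess r X t := by
  filter_upwards [hs.firstPassageTime_ae_eq t] with ω hω
  simp [passageProcess, crossProcess, hω]

end IsPassageReady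

end Passage

/-! ### The Markov property at the passage time -/

section Passage

/-- An integral is the sum of the integrals over the fibres of a measurable map to `ℕ`. -/
lemma lintegral_eq_tsum_fiber {α : Type*} [MeasurableSpace α] {μ : Measure α} {n : α → ℕ}
    (hn : Measurable n) (f : α → ℝ≥0∞) :
    ∫⁻ a, f a ∂μ = ∑' k, ∫⁻ a in n ⁻¹' {k}, f a ∂μ := by
  rw [← lintegral_iUnion (fun k => hn (measurableSet_singleton k))]
  · have : ⋃ k, n ⁻¹' {k} = univ := by
      ext a
      simp
    rw [this, setLIntegral_univ]
  · intro i j hij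
    exact Disjoint.preimage n (by simpa using hij)

variable {Ω : Type*} [MeasurableSpace Ω] {P : Measure Ω} {d : ℕ}
  {X : ℝ≥0 → Ω → (Fin d → ℝ)} {r : Fin d → ℝ}

namespace IsPassageReady

variable [IsProbabilityMeasure P] (hs : IsPassageReady P X r)

include hs

/-- The Markov property at the grid passage time, by summation over its values: the event that the
passage occurs at `k / 2ᵐ` belongs to the past of this time. -/
lemma setLIntegral_lexp_crossGrid {z : Fin d → ℝ} (hz : 0 ≤ z) (m : ℕ) (t u : ℝ≥0) :
    ∫⁻ ω in {ω | crossGrid r X m t ω < u}, lexp z (X u ω) ∂P =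
      ∫⁻ ω in {ω | crossGrid r X m t ω < u}, lexp z (crossGridProcess r X m t ω) *
        ENNReal.ofReal (Real.exp (-((u - crossGrid r X m t ω) * laplaceExponent P X z))) ∂P := by
  have hidx : Measurable (crossIdx r X m t) :=
    Measurable.of_uncurry_left (f := crossIdx r X m) (hs.measurable_crossIdx m)
  rw [lintegral_eq_tsum_fiber hidx, lintegral_eq_tsum_fiber hidx]
  congr 1
  ext k
  have hk : MeasurableSet (crossIdx r X m t ⁻¹' {k}) := hidx (measurableSet_singleton k)
  rw [Measure.restrict_restrict hk]
  by_cases hku : (k : ℝ≥0) / 2 ^ m < u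
  · have hset : crossIdx r X m t ⁻¹' {k} ∩ {ω | crossGrid r X m t ω < u} =
        crossIdx r X m t ⁻¹' {k} := by
      refine inter_eq_left.2 fun ω (hω : crossIdx r X m t ω = k) => ?_
      change crossGrid r X m t ω < u
      rwa [crossGrid_eq, hω]
    have hkF : MeasurableSet[pastSigma X (fun j => (j : ℝ≥0) / 2 ^ m) k]
        (crossIdx r X m t ⁻¹' {k}) := by
      have : crossIdx r X m t ⁻¹' {k} = {ω | crossIdx r X m t ω ≤ k} \
          ⋃ j ∈ Finset.range k, {ω | crossIdx r X m t ω ≤ j} := by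
        ext ω
        simp only [mem_preimage, mem_singleton_iff, mem_sdiff, mem_iUnion, Finset.mem_range,
          exists_prop, not_exists, not_and, mem_ofPred_eq]
        refine ⟨fun h => ⟨h.le, fun j hj => by omega⟩, fun ⟨h1, h2⟩ => ?_⟩
        by_contra hne
        exact h2 _ (lt_of_le_of_ne h1 hne) le_rfl
      rw [this]
      refine (hs.measurableSet_crossIdx_le m t k).diff
        (Finset.measurableSet_biUnion _ fun j hj => ?_)
      exact pastSigma_mono X _ (Finset.mem_range.1 hj).le _ (hs.measurableSet_crossIdx_le m t j)
    have h := hs.regular.lintegral_mul_lexp (monotone_grid m) (by simp) k (u - k / 2 ^ m) hz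
      (G := (crossIdx r X m t ⁻¹' {k}).indicator fun _ => 1) (measurable_const.indicator hkF)
    rw [add_tsub_cancel_of_le hku.le] at h
    have e : ∀ v, ∫⁻ ω, (crossIdx r X m t ⁻¹' {k}).indicator (fun _ => 1) ω * lexp z (X v ω) ∂P =
        ∫⁻ ω in crossIdx r X m t ⁻¹' {k}, lexp z (X v ω) ∂P := by
      intro v
      rw [← lintegral_indicator hk]
      refine lintegral_congr fun ω => ?_
      by_cases hω : ω ∈ crossIdx r X m t ⁻¹' {k}
      · simp only [indicator_of_mem hω, one_mul]
      · simp only [indicator_of_notMem hω, zero_mul]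
    rw [e, e] at h
    have hm := hs.regular.measurable (k / 2 ^ m)
    rw [hset, h, ← lintegral_mul_const _ (by fun_prop)]
    refine setLIntegral_congr_fun hk fun ω (hω : crossIdx r X m t ω = k) => ?_
    simp only [crossGridProcess, crossGrid_eq, hω]
    rw [NNReal.coe_sub hku.le]
  · have hset : crossIdx r X m t ⁻¹' {k} ∩ {ω | crossGrid r X m t ω < u} = ∅ := by
      ext ω
      simp only [mem_inter_iff, mem_preimage, mem_singleton_iff, mem_ofPred_eq, mem_empty_iff_false,
        iff_false, not_and]
      intro hω
      rwa [crossGrid_eq, hω]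
    rw [hset]
    simp

/-- The Markov property at the passage time, for Laplace functionals: on `{σ_t < u}` the vector
`X_u` is `Y_t` plus an independent increment over the remaining time `u - σ_t`. -/
lemma setLIntegral_lexp_crossTime {z : Fin d → ℝ} (hz : 0 ≤ z) (t u : ℝ≥0) :
    ∫⁻ ω in {ω | crossTime r X t ω < u}, lexp z (X u ω) ∂P =
      ∫⁻ ω in {ω | crossTime r X t ω < u}, lexp z (crossProcess r X t ω) *
        ENNReal.ofReal (Real.exp (-((u - crossTime r X t ω) * laplaceExponent P X z))) ∂P := by
  have hσm : Measurable (crossTime r X t) :=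
    Measurable.of_uncurry_left (f := crossTime r X) hs.measurable_crossTime
  have hσg : ∀ m, Measurable (crossGrid r X m t) := fun m =>
    Measurable.of_uncurry_left (f := crossGrid r X m) (hs.measurable_crossGrid m)
  have hXm := hs.regular.measurable
  have hYm := hs.measurable_crossProcess t
  have hYg := fun m => hs.measurable_crossGridProcess m t
  have hA : MeasurableSet {ω | crossTime r X t ω < u} := measurableSet_lt hσm measurable_const
  have hAg : ∀ m, MeasurableSet {ω | crossGrid r X m t ω < u} := fun m =>
    measurableSet_lt (hσg m) measurable_const
  have hφ := hs.regular.laplaceExponent_nonneg hz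
  -- the events `{σ^m_t < u}` increase to `{σ_t < u}`, as `σ^m_t` decreases to `σ_t`
  have hlim : ∀ (f : ℕ → Ω → ℝ≥0∞) (f' : Ω → ℝ≥0∞), (∀ m, Measurable (f m)) →
      (∀ m ω, crossGrid r X m t ω < u → f m ω ≤ 1) →
      (∀ ω, Filter.Tendsto (fun m => f m ω) Filter.atTop (nhds (f' ω))) →
      Filter.Tendsto (fun m => ∫⁻ ω in {ω | crossGrid r X m t ω < u}, f m ω ∂P) Filter.atTop
        (nhds (∫⁻ ω in {ω | crossTime r X t ω < u}, f' ω ∂P)) := by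
    intro f f' hf hb hl
    rw [← lintegral_indicator hA]
    simp_rw [← lintegral_indicator (hAg _)]
    refine tendsto_lintegral_of_dominated_convergence (fun _ => 1)
      (fun m => (hf m).indicator (hAg m)) (fun m => ae_of_all _ fun ω => ?_) (by simp)
      (ae_of_all _ fun ω => ?_)
    · by_cases hω : crossGrid r X m t ω < u
      · rw [indicator_of_mem (show ω ∈ {ω | crossGrid r X m t ω < u} from hω)]
        exact hb m ω hω
      · rw [indicator_of_notMem (show ω ∉ {ω | crossGrid r X m t ω < u} from hω)]
        exact zero_le_one
    · by_cases hω : crossTime r X t ω < u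
      · rw [indicator_of_mem (show ω ∈ {ω | crossTime r X t ω < u} from hω)]
        refine (hl ω).congr' ?_
        filter_upwards [(hs.tendsto_crossGrid t ω).eventually (gt_mem_nhds hω)] with m hm
        rw [indicator_of_mem (show ω ∈ {ω | crossGrid r X m t ω < u} from hm)]
      · rw [indicator_of_notMem (show ω ∉ {ω | crossTime r X t ω < u} from hω)]
        refine tendsto_const_nhds.congr fun m => ?_
        rw [indicator_of_notMem]
        exact fun h => hω ((IsSkipFreePath.passTime_le_gridTime m _).trans_lt h)
  have l1 := hlim (fun _ ω => lexp z (X u ω)) (fun ω => lexp z (X u ω))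
    (fun _ => by have := hXm u; fun_prop)
    (fun _ ω _ => lexp_le_one hz (hs.regular.nonneg _ _)) (fun ω => tendsto_const_nhds)
  have l2 := hlim (fun m ω => lexp z (crossGridProcess r X m t ω) *
      ENNReal.ofReal (Real.exp (-((u - crossGrid r X m t ω) * laplaceExponent P X z))))
    (fun ω => lexp z (crossProcess r X t ω) *
      ENNReal.ofReal (Real.exp (-((u - crossTime r X t ω) * laplaceExponent P X z))))
    (fun m => by have := hσg m; have := hYg m; fun_prop)
    (fun m ω hω => by
      refine mul_le_one' (lexp_le_one hz (hs.regular.nonneg _ _)) ?_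
      rw [ENNReal.ofReal_le_one, Real.exp_le_one_iff, neg_nonpos]
      refine mul_nonneg (sub_nonneg.2 ?_) hφ
      exact_mod_cast hω.le)
    (fun ω => by
      refine ENNReal.Tendsto.mul (((continuous_lexp z).tendsto _).comp
        (hs.tendsto_crossGridProcess t ω)) (Or.inr ENNReal.ofReal_ne_top) ?_
        (Or.inr (lexp_ne_top _ _))
      refine ENNReal.tendsto_ofReal ((Real.continuous_exp.tendsto _).comp ?_)
      exact ((tendsto_const_nhds.sub ((NNReal.continuous_coe.tendsto _).comp
        (hs.tendsto_crossGrid t ω))).mul_const _).neg)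
  refine tendsto_nhds_unique l1 (l2.congr fun m => ?_)
  exact (hs.setLIntegral_lexp_crossGrid hz m t u).symm

end IsPassageReady

end Passage

/-! ### The cyclic lemma and its probabilistic form -/

section Cyclic

/-- The window `c, …, c + N` contains a point at which a sequence with positive drift over a period
`N + 1` is at its running maximum. -/
lemma partialSups_window {W : ℕ → ℝ} {N : ℕ} {T : ℝ} (hper : ∀ k, W (k + (N + 1)) = W k + T)
    (hT : 0 ≤ T) (c : ℕ) : partialSups (fun j => W (c + j)) N = partialSups W (c + N) := by
  refine le_antisymm (partialSups_le _ _ _ fun j hj => le_partialSups_of_le W (by omega))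
    (partialSups_le _ _ _ fun j hj => ?_)
  have key : ∀ i j : ℕ, j ≤ c + N → c ≤ j + i → W j ≤ partialSups (fun j => W (c + j)) N := by
    intro i
    induction i with
    | zero =>
      intro j hj hcj
      have h := le_partialSups_of_le (fun j => W (c + j)) (show j - c ≤ N by omega)
      simpa [show c + (j - c) = j by omega] using h
    | succ i ih =>
      intro j hj hcj
      by_cases hc : c ≤ j
      · exact ih j hj (by omega)
      · have h1 := ih (j + (N + 1)) (by omega) (by omega)
        rw [hper] at h1
        linarith
  exact key c j hj (by omega)

/-- The cyclic lemma: over one period of a sequence with increment `T` per period, the heights by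
which the sequence exceeds its previous `N + 1` values add up to `T⁺`. -/
lemma sum_ladder_cyclic {W : ℕ → ℝ} {N : ℕ} {T : ℝ} (hper : ∀ k, W (k + (N + 1)) = W k + T) :
    ∑ c ∈ Finset.range (N + 1), max 0 (W (c + (N + 1)) - partialSups (fun j => W (c + j)) N) =
      max 0 T := by
  rcases le_total T 0 with hT | hT
  · rw [max_eq_left hT]
    refine Finset.sum_eq_zero fun c _ => max_eq_left ?_
    have h := le_partialSups_of_le (fun j => W (c + j)) (Nat.zero_le N)
    simp only [add_zero] at h
    rw [hper]
    linarith
  · rw [max_eq_right hT]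
    have h1 : ∀ c, max 0 (W (c + (N + 1)) - partialSups (fun j => W (c + j)) N) =
        partialSups W (N + (c + 1)) - partialSups W (N + c) := by
      intro c
      rw [partialSups_window hper hT, ← add_assoc N, partialSups_add_one, add_comm c N,
        show c + (N + 1) = N + c + 1 by ring, ← max_sub_sub_right, sub_self]
    simp_rw [h1]
    rw [Finset.sum_range_sub (fun c => partialSups W (N + c)), add_zero, add_comm N (N + 1),
      ← partialSups_window hper hT (N + 1)]
    have h2 : partialSups (fun j => W (N + 1 + j)) N = partialSups W N + T := by
      have e : (fun j => W (N + 1 + j)) = fun j => W j + T := by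
        ext j
        rw [add_comm, hper]
      rw [e]
      refine le_antisymm (partialSups_le _ _ _ fun j hj => ?_) ?_
      · have := le_partialSups_of_le W hj
        linarith
      · rw [← le_sub_iff_add_le]
        refine partialSups_le _ _ _ fun j hj => ?_
        have := le_partialSups_of_le (fun j => W j + T) hj
        linarith
    rw [h2]
    ring

variable {d : ℕ}

/-- The walk with increments `h - r · x_i`, where the finite sequence `x` is continued
periodically. -/
noncomputable def periodicWalk (r : Fin d → ℝ) (h : ℝ) {N : ℕ} (x : Fin (N + 1) → Fin d → ℝ)
    (k : ℕ) : ℝ :=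
  ∑ i ∈ Finset.range k, (h - r ⬝ᵥ x (Fin.ofNat (N + 1) i))

lemma periodicWalk_add_period (r : Fin d → ℝ) (h : ℝ) {N : ℕ} (x : Fin (N + 1) → Fin d → ℝ)
    (k : ℕ) : periodicWalk r h x (k + (N + 1)) = periodicWalk r h x k +
      ((N + 1) * h - r ⬝ᵥ ∑ i, x i) := by
  have h0 : ∀ k, periodicWalk r h x (k + (N + 1)) - periodicWalk r h x k =
      periodicWalk r h x (N + 1) := by
    intro k
    induction k with
    | zero => simp [periodicWalk]
    | succ k ih =>
      have e1 : periodicWalk r h x (k + 1 + (N + 1)) = periodicWalk r h x (k + (N + 1)) +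
          (h - r ⬝ᵥ x (Fin.ofNat (N + 1) (k + (N + 1)))) := by
        rw [show k + 1 + (N + 1) = k + (N + 1) + 1 by ring, periodicWalk, Finset.sum_range_succ]
        rfl
      have e2 : periodicWalk r h x (k + 1) = periodicWalk r h x k +
          (h - r ⬝ᵥ x (Fin.ofNat (N + 1) k)) := by
        rw [periodicWalk, Finset.sum_range_succ]
        rfl
      have e3 : Fin.ofNat (N + 1) (k + (N + 1)) = Fin.ofNat (N + 1) k := by
        ext
        simp
      rw [e1, e2, e3, ← ih]
      ring
  have h1 : periodicWalk r h x (N + 1) = (N + 1) * h - r ⬝ᵥ ∑ i, x i := by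
    rw [periodicWalk, ← Fin.sum_univ_eq_sum_range
      (fun i => h - r ⬝ᵥ x (Fin.ofNat (N + 1) i)) (N + 1)]
    have : ∀ i : Fin (N + 1), Fin.ofNat (N + 1) (i : ℕ) = i := fun i => by ext; simp
    simp only [this, Finset.sum_sub_distrib, dotProduct_sum]
    simp
  rw [← h1, ← h0 k]
  ring

lemma periodicWalk_rotate (r : Fin d → ℝ) (h : ℝ) {N : ℕ} (x : Fin (N + 1) → Fin d → ℝ)
    (c k : ℕ) : periodicWalk r h (fun i => x (i + Fin.ofNat (N + 1) c)) k =
      periodicWalk r h x (c + k) - periodicWalk r h x c := by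
  simp only [periodicWalk, Finset.sum_range_add, add_sub_cancel_left]
  refine Finset.sum_congr rfl fun i _ => ?_
  congr 3
  ext
  simp [Fin.val_add, add_comm]

@[fun_prop]
lemma measurable_periodicWalk (r : Fin d → ℝ) (h : ℝ) {N : ℕ} (k : ℕ) :
    Measurable fun x : Fin (N + 1) → Fin d → ℝ => periodicWalk r h x k := by
  unfold periodicWalk
  fun_prop

lemma measurable_partialSups_periodicWalk (r : Fin d → ℝ) (h : ℝ) {N : ℕ} (k : ℕ) :
    Measurable fun x : Fin (N + 1) → Fin d → ℝ => partialSups (periodicWalk r h x) k := by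
  induction k with
  | zero => simpa using measurable_periodicWalk r h 0
  | succ k ih =>
    simp only [partialSups_add_one]
    exact ih.sup (measurable_periodicWalk r h (k + 1))

variable {Ω : Type*} [MeasurableSpace Ω] {P : Measure Ω}
  {X : ℝ≥0 → Ω → (Fin d → ℝ)} {r : Fin d → ℝ} [IsProbabilityMeasure P]

/-- The increments of a subordinator over a grid are exchangeable, so the cyclic lemma may be
averaged over all rotations: given `X_{nh}`, the expected height by which `Z_{nh} = nh - r·X_{nh}`
exceeds the previous values of `Z` on the grid is `Z_{nh}⁺ / n`. -/
lemma IsRegularSubordinator.lintegral_ladder (hX : IsRegularSubordinator P X) (r : Fin d → ℝ)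
    (h : ℝ≥0) (N : ℕ) {G : (Fin d → ℝ) → ℝ≥0∞} (hG : Measurable G) :
    (N + 1 : ℝ≥0∞) * ∫⁻ ω, ENNReal.ofReal (reservoir r X ((N + 1 : ℕ) * h) ω -
        partialSups (fun j : ℕ => reservoir r X (j * h) ω) N) * G (X ((N + 1 : ℕ) * h) ω) ∂P =
      ∫⁻ ω, ENNReal.ofReal (reservoir r X ((N + 1 : ℕ) * h) ω) * G (X ((N + 1 : ℕ) * h) ω) ∂P := by
  set ξ : Ω → Fin (N + 1) → Fin d → ℝ :=
    fun ω i => X (((i : ℕ) + 1 : ℕ) * h) ω - X ((i : ℕ) * h) ω with hξ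
  have hξi : ∀ i, Measurable fun ω => ξ ω i := fun i =>
    (hX.measurable _).sub (hX.measurable _)
  have hξm : Measurable ξ := measurable_pi_lambda _ hξi
  have hgrid : Monotone fun j : ℕ => (j : ℝ≥0) * h := fun i j hij => by
    have : (i : ℝ≥0) ≤ j := by exact_mod_cast hij
    simp only
    gcongr
  have hind : iIndepFun (fun i ω => ξ ω i) P :=
    (hX.indep_increments.nat hgrid).precomp (g := fun i : Fin (N + 1) => (i : ℕ)) Fin.val_injective
  have hlaw : ∀ i, P.map (fun ω => ξ ω i) = P.map (X h) := by
    intro i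
    have := (hX.stationary_increments ((i : ℕ) * h) h).map_eq
    rw [← this]
    congr 1
    ext ω : 1
    simp only [hξ]
    push_cast
    ring_nf
  have hpi : ∀ e : Equiv.Perm (Fin (N + 1)), P.map (fun ω i => ξ ω (e i)) =
      Measure.pi fun _ => P.map (X h) := by
    intro e
    have h1 := (iIndepFun_iff_map_fun_eq_pi_map (fun i => (hξi (e i)).aemeasurable)).1
      (hind.precomp e.injective)
    rw [h1]
    congr 1
    ext1 i
    exact hlaw (e i)
  set Φ : (Fin (N + 1) → Fin d → ℝ) → ℝ≥0∞ := fun x =>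
    ENNReal.ofReal (periodicWalk r h x (N + 1) - partialSups (periodicWalk r h x) N) *
      G (∑ i, x i) with hΦ
  have hΦm : Measurable Φ := by
    have := measurable_partialSups_periodicWalk (N := N) r h N
    simp only [hΦ]
    fun_prop
  have hrot : ∀ c : ℕ, ∫⁻ ω, Φ (fun i => ξ ω (i + Fin.ofNat (N + 1) c)) ∂P =
      ∫⁻ ω, Φ (ξ ω) ∂P := by
    intro c
    have h1 := hpi (Equiv.addRight (Fin.ofNat (N + 1) c))
    have h2 := hpi (Equiv.refl _)
    simp only [Equiv.coe_addRight, Equiv.refl_apply] at h1 h2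
    rw [← lintegral_map (μ := P) (g := fun ω i => ξ ω (i + Fin.ofNat (N + 1) c)) hΦm
      (measurable_pi_lambda _ fun i => hξi _), h1, ← h2,
      lintegral_map hΦm (measurable_pi_lambda _ hξi)]
  have hsum : ∀ ω, ∑ i, ξ ω i = X ((N + 1 : ℕ) * h) ω := by
    intro ω
    simp only [hξ]
    rw [Fin.sum_univ_eq_sum_range (fun i : ℕ => X ((i + 1 : ℕ) * h) ω - X (i * h) ω) (N + 1),
      Finset.sum_range_sub (fun i : ℕ => X (i * h) ω)]
    simp [hX.start_zero]
  have hwalk : ∀ ω, ∀ k ≤ N + 1, periodicWalk r h (ξ ω) k = reservoir r X (k * h) ω := by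
    intro ω k hk
    induction k with
    | zero => simp [periodicWalk, reservoir_zero hX]
    | succ k ih =>
      have ih' := ih (by omega)
      rw [periodicWalk] at ih' ⊢
      rw [Finset.sum_range_succ, ih']
      have hmod : k % (N + 1) = k := Nat.mod_eq_of_lt (by omega)
      simp only [hξ, reservoir, Fin.val_ofNat, hmod, dotProduct_sub]
      push_cast
      ring
  have hΦξ : ∀ ω, Φ (ξ ω) = ENNReal.ofReal (reservoir r X ((N + 1 : ℕ) * h) ω -
      partialSups (fun j : ℕ => reservoir r X (j * h) ω) N) * G (X ((N + 1 : ℕ) * h) ω) := by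
    intro ω
    simp only [hΦ, hsum, hwalk ω (N + 1) le_rfl]
    congr 3
    refine le_antisymm (partialSups_le _ _ _ fun j hj => ?_) (partialSups_le _ _ _ fun j hj => ?_)
    · rw [hwalk ω j (by omega)]
      exact le_partialSups_of_le (fun j : ℕ => reservoir r X (j * h) ω) hj
    · rw [← hwalk ω j (by omega)]
      exact le_partialSups_of_le _ hj
  simp_rw [← hΦξ]
  have hcount : (N + 1 : ℝ≥0∞) * ∫⁻ ω, Φ (ξ ω) ∂P =
      ∑ c ∈ Finset.range (N + 1), ∫⁻ ω, Φ (fun i => ξ ω (i + Fin.ofNat (N + 1) c)) ∂P := by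
    rw [Finset.sum_congr rfl fun c _ => hrot c, Finset.sum_const, Finset.card_range, nsmul_eq_mul]
    push_cast
    rfl
  have hΦc : ∀ c ∈ Finset.range (N + 1),
      Measurable fun ω => Φ fun i => ξ ω (i + Fin.ofNat (N + 1) c) := fun c _ =>
    hΦm.comp (measurable_pi_lambda _ fun i => hξi _)
  rw [hcount, ← lintegral_finsetSum _ hΦc]
  refine lintegral_congr fun ω => ?_
  have hG' : ∀ c : ℕ, ∑ i, ξ ω (i + Fin.ofNat (N + 1) c) = ∑ i, ξ ω i := fun c =>
    Equiv.sum_comp (Equiv.addRight (Fin.ofNat (N + 1) c)) (ξ ω)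
  have hps : ∀ c : ℕ, partialSups (periodicWalk r h fun i => ξ ω (i + Fin.ofNat (N + 1) c)) N =
      partialSups (fun j => periodicWalk r h (ξ ω) (c + j)) N - periodicWalk r h (ξ ω) c := by
    intro c
    refine le_antisymm (partialSups_le _ _ _ fun j hj => ?_) ?_
    · rw [periodicWalk_rotate]
      gcongr
      exact le_partialSups_of_le (fun j => periodicWalk r h (ξ ω) (c + j)) hj
    · rw [sub_le_iff_le_add]
      refine partialSups_le _ _ _ fun j hj => ?_
      have := le_partialSups_of_le
        (periodicWalk r h fun i => ξ ω (i + Fin.ofNat (N + 1) c)) hj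
      rw [periodicWalk_rotate] at this
      linarith
  simp only [hΦ, hG', hps, periodicWalk_rotate, sub_sub_sub_cancel_right]
  rw [← Finset.sum_mul, hsum]
  congr 1
  have hmax : ∀ a : ℝ, ENNReal.ofReal a = ENNReal.ofReal (max 0 a) := fun a => by
    rw [max_comm, ENNReal.ofReal_max]
    simp
  rw [Finset.sum_congr rfl fun c _ => hmax _,
    ← ENNReal.ofReal_sum_of_nonneg fun c _ => le_max_left _ _,
    sum_ladder_cyclic (periodicWalk_add_period r h (ξ ω)), ← hmax, hsum]
  congr 1
  simp [reservoir]

end Cyclic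

/-! ### Kendall's identity -/

section HalfLine

/-- Lebesgue measure on `[0,∞)`. -/
noncomputable def halfLine : Measure ℝ≥0 := (volume.restrict (Ioi (0 : ℝ))).map Real.toNNReal

instance : SFinite halfLine := by unfold halfLine; infer_instance

lemma lintegral_halfLine {f : ℝ≥0 → ℝ≥0∞} (hf : Measurable f) :
    ∫⁻ t, f t ∂halfLine = ∫⁻ t in Ioi (0 : ℝ), f t.toNNReal := by
  unfold halfLine
  rw [lintegral_map hf measurable_real_toNNReal]

lemma halfLine_apply {S : Set ℝ≥0} (hS : MeasurableSet S) :
    halfLine S = volume (Real.toNNReal ⁻¹' S ∩ Ioi (0 : ℝ)) := by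
  unfold halfLine
  rw [Measure.map_apply measurable_real_toNNReal hS,
    Measure.restrict_apply (measurable_real_toNNReal hS)]

lemma halfLine_Ico {a b : ℝ} (ha : 0 ≤ a) :
    halfLine {t : ℝ≥0 | a ≤ t ∧ (t : ℝ) < b} = ENNReal.ofReal (b - a) := by
  have hS : MeasurableSet {t : ℝ≥0 | a ≤ t ∧ (t : ℝ) < b} :=
    (measurableSet_le measurable_const measurable_coe_nnreal_real).inter
      (measurableSet_lt measurable_coe_nnreal_real measurable_const)
  rw [halfLine_apply hS, ← Real.volume_Ioo, measure_congr]
  have h0 : ∀ᵐ x : ℝ, x ≠ a := by simp [ae_iff]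
  filter_upwards [h0] with x hx
  refine propext ⟨fun ⟨⟨h1, h2⟩, h3⟩ => ?_, fun ⟨h1, h2⟩ => ?_⟩
  · rw [Real.coe_toNNReal _ (le_of_lt h3)] at h1 h2
    exact ⟨lt_of_le_of_ne h1 (Ne.symm hx), h2⟩
  · have hx0 : 0 < x := ha.trans_lt h1
    refine ⟨⟨?_, ?_⟩, hx0⟩ <;> rw [Real.coe_toNNReal _ hx0.le]
    exacts [h1.le, h2]

lemma halfLine_Ioc {a b : ℝ} (ha : 0 ≤ a) :
    halfLine {t : ℝ≥0 | a < t ∧ (t : ℝ) ≤ b} = ENNReal.ofReal (b - a) := by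
  have hS : MeasurableSet {t : ℝ≥0 | a < t ∧ (t : ℝ) ≤ b} :=
    (measurableSet_lt measurable_const measurable_coe_nnreal_real).inter
      (measurableSet_le measurable_coe_nnreal_real measurable_const)
  rw [halfLine_apply hS, ← Real.volume_Ioc]
  congr 1
  ext x
  constructor
  · rintro ⟨⟨h1, h2⟩, h3⟩
    rw [Real.coe_toNNReal _ (le_of_lt h3)] at h1 h2
    exact ⟨h1, h2⟩
  · rintro ⟨h1, h2⟩
    have hx0 : 0 < x := ha.trans_lt h1
    refine ⟨⟨?_, ?_⟩, hx0⟩ <;> rw [Real.coe_toNNReal _ hx0.le]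
    exacts [h1, h2]

lemma ae_halfLine_pos : ∀ᵐ t ∂halfLine, 0 < t := by
  have hS : MeasurableSet {t : ℝ≥0 | ¬ 0 < t} :=
    (measurableSet_lt measurable_const measurable_id).compl
  rw [ae_iff, halfLine_apply hS]
  convert measure_empty (μ := (volume : Measure ℝ))
  ext x
  simp

lemma lintegral_exp_neg_halfLine : ∫⁻ t : ℝ≥0, ENNReal.ofReal (Real.exp (-t)) ∂halfLine ≠ ∞ := by
  rw [lintegral_halfLine (by fun_prop)]
  have h : IntegrableOn (fun t : ℝ => Real.exp (-t)) (Ioi 0) := by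
    simpa using integrableOn_exp_mul_Ioi (a := -1) (by norm_num) 0
  have h2 := h.2
  rw [hasFiniteIntegral_iff_ofReal (ae_of_all _ fun t => (Real.exp_pos _).le)] at h2
  refine ne_of_lt (lt_of_le_of_lt (le_of_eq ?_) h2)
  refine setLIntegral_congr_fun measurableSet_Ioi fun t ht => ?_
  simp only [Real.coe_toNNReal _ (le_of_lt ht)]

/-- Riemann sums over the grid `2⁻ᵐ ℕ` as integrals of functions rounded up to the grid. -/
lemma lintegral_halfLine_ceil (m : ℕ) (f : ℝ≥0 → ℝ≥0∞) :
    ∫⁻ u, f ((⌈u * 2 ^ m⌉₊ : ℝ≥0) / 2 ^ m) ∂halfLine =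
      ∑' N : ℕ, f ((N + 1 : ℕ) / 2 ^ m) * ENNReal.ofReal ((2 ^ m : ℝ)⁻¹) := by
  have hceil : Measurable fun u : ℝ≥0 => ⌈u * 2 ^ m⌉₊ :=
    Nat.measurable_ceil.comp (measurable_id.mul_const _)
  have hk : ∀ k, ∫⁻ u in (fun u : ℝ≥0 => ⌈u * 2 ^ m⌉₊) ⁻¹' {k},
      f ((⌈u * 2 ^ m⌉₊ : ℝ≥0) / 2 ^ m) ∂halfLine =
      f (k / 2 ^ m) * halfLine ((fun u : ℝ≥0 => ⌈u * 2 ^ m⌉₊) ⁻¹' {k}) := by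
    intro k
    rw [← setLIntegral_const]
    refine setLIntegral_congr_fun (hceil (measurableSet_singleton k)) fun u hu => ?_
    have : ⌈u * 2 ^ m⌉₊ = k := hu
    simp only [this]
  have h0 : halfLine ((fun u : ℝ≥0 => ⌈u * 2 ^ m⌉₊) ⁻¹' {0}) = 0 := by
    refine measure_mono_null (fun u hu => ?_) (ae_iff.1 ae_halfLine_pos)
    have : ⌈u * 2 ^ m⌉₊ = 0 := hu
    rw [Nat.ceil_eq_zero] at this
    simpa using this
  have hsucc : ∀ N : ℕ, halfLine ((fun u : ℝ≥0 => ⌈u * 2 ^ m⌉₊) ⁻¹' {N + 1}) =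
      ENNReal.ofReal ((2 ^ m : ℝ)⁻¹) := by
    intro N
    have hset : (fun u : ℝ≥0 => ⌈u * 2 ^ m⌉₊) ⁻¹' {N + 1} =
        {u : ℝ≥0 | (N : ℝ) / 2 ^ m < u ∧ (u : ℝ) ≤ ((N + 1 : ℕ) : ℝ) / 2 ^ m} := by
      ext u
      simp only [mem_preimage, mem_singleton_iff, Nat.ceil_eq_iff (Nat.succ_ne_zero N),
        mem_ofPred_eq]
      rw [div_lt_iff₀ (by positivity), le_div_iff₀ (by positivity)]
      norm_cast
    rw [hset, halfLine_Ioc (by positivity)]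
    congr 1
    push_cast
    field_simp
    ring
  rw [lintegral_eq_tsum_fiber hceil]
  simp_rw [hk]
  rw [tsum_eq_zero_add' ENNReal.summable, h0, mul_zero, zero_add]
  simp_rw [hsucc]

end HalfLine

section Kendall

lemma IsSkipFreePath.gridIdx_eq_succ_iff {z : ℝ≥0 → ℝ} (hz : IsSkipFreePath z) {m : ℕ} {t : ℝ}
    {N : ℕ} : gridIdx z m t = N + 1 ↔
      partialSups (fun j : ℕ => z (j / 2 ^ m)) N ≤ t ∧ t < z ((N + 1 : ℕ) / 2 ^ m) := by
  constructor
  · intro h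
    refine ⟨partialSups_le _ _ _ fun j hj => ?_, ?_⟩
    · by_contra hcon
      have : gridIdx z m t ≤ j := Nat.sInf_le (not_le.1 hcon)
      omega
    · have := hz.lt_gridTime m t
      rwa [gridTime, h] at this
  · rintro ⟨h1, h2⟩
    refine le_antisymm (Nat.sInf_le h2) ?_
    by_contra hcon
    have hle : gridIdx z m t ≤ N := by omega
    obtain ⟨j, hj, hlt⟩ := hz.gridIdx_le_iff.1 hle
    have := le_partialSups_of_le (fun j : ℕ => z (j / 2 ^ m)) hj
    linarith

variable {Ω : Type*} [MeasurableSpace Ω] {P : Measure Ω} {d : ℕ}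
  {X : ℝ≥0 → Ω → (Fin d → ℝ)} {r : Fin d → ℝ}

namespace IsPassageReady

variable [IsProbabilityMeasure P] (hs : IsPassageReady P X r)

include hs

omit [IsProbabilityMeasure P] in
/-- The levels `t` passed at the grid point `N + 1` form an interval whose length is the height by
which the path exceeds its previous values on the grid. -/
lemma lintegral_crossGrid (m : ℕ) (ω : Ω) (f : ℝ≥0 → ℝ≥0∞) :
    ∫⁻ t, f (crossGrid r X m t ω) ∂halfLine =
      ∑' N : ℕ, f ((N + 1 : ℕ) / 2 ^ m) *
        ENNReal.ofReal (reservoir r X ((N + 1 : ℕ) / 2 ^ m) ω -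
          partialSups (fun j : ℕ => reservoir r X (j / 2 ^ m) ω) N) := by
  have hidx : Measurable fun t => crossIdx r X m t ω :=
    Measurable.of_uncurry_right (f := crossIdx r X m) (hs.measurable_crossIdx m)
  have hk : ∀ k, ∫⁻ t in (fun t => crossIdx r X m t ω) ⁻¹' {k}, f (crossGrid r X m t ω) ∂halfLine =
      f (k / 2 ^ m) * halfLine ((fun t => crossIdx r X m t ω) ⁻¹' {k}) := by
    intro k
    rw [← setLIntegral_const]
    refine setLIntegral_congr_fun (hidx (measurableSet_singleton k)) fun t ht => ?_
    have : crossIdx r X m t ω = k := ht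
    simp only [crossGrid_eq, this]
  have h0 : (fun t => crossIdx r X m t ω) ⁻¹' {0} = ∅ := by
    ext t
    simp only [mem_preimage, mem_singleton_iff, mem_empty_iff_false, iff_false]
    intro h
    have := (hs.skipFree ω).lt_gridTime m t
    have h' : gridIdx (fun u => reservoir r X u ω) m t = 0 := h
    simp only [gridTime, h', Nat.cast_zero, zero_div, reservoir_zero hs.regular] at this
    exact absurd this (not_lt.2 t.coe_nonneg)
  have hsucc : ∀ N, halfLine ((fun t => crossIdx r X m t ω) ⁻¹' {N + 1}) =
      ENNReal.ofReal (reservoir r X ((N + 1 : ℕ) / 2 ^ m) ω -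
          partialSups (fun j : ℕ => reservoir r X (j / 2 ^ m) ω) N) := by
    intro N
    rw [← halfLine_Ico]
    · congr 1
      ext t
      exact (hs.skipFree ω).gridIdx_eq_succ_iff
    · have := le_partialSups_of_le (fun j : ℕ => reservoir r X (j / 2 ^ m) ω) (Nat.zero_le N)
      simpa [reservoir_zero hs.regular] using this
  rw [lintegral_eq_tsum_fiber hidx]
  simp_rw [hk]
  rw [tsum_eq_zero_add' ENNReal.summable, h0, measure_empty, mul_zero, zero_add]
  simp_rw [hsucc]

omit hs [IsProbabilityMeasure P] in
lemma measurable_partialSups_reservoir (hX : ∀ t, Measurable (X t)) (m N : ℕ) :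
    Measurable fun ω => partialSups (fun j : ℕ => reservoir r X (j / 2 ^ m) ω) N := by
  induction N with
  | zero => simpa using measurable_reservoir hX _
  | succ N ih =>
    simp only [partialSups_add_one]
    exact ih.sup (measurable_reservoir hX _)

/-- Kendall's identity on the grid `2⁻ᵐ ℕ`. -/
lemma kendall_grid (m : ℕ) {F : ℝ≥0 → (Fin d → ℝ) → ℝ≥0∞}
    (hF : Measurable (Function.uncurry F)) :
    ∫⁻ ω, ∫⁻ t, F (crossGrid r X m t ω) (crossGridProcess r X m t ω) ∂halfLine ∂P =
      ∫⁻ u, (fun v : ℝ≥0 => ∫⁻ ω, ENNReal.ofReal (reservoir r X v ω / v) * F v (X v ω) ∂P)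
        ((⌈u * 2 ^ m⌉₊ : ℝ≥0) / 2 ^ m) ∂halfLine := by
  have hXm := hs.regular.measurable
  have hFm : ∀ v, Measurable (F v) := fun v => hF.of_uncurry_left
  rw [lintegral_halfLine_ceil m
    fun v : ℝ≥0 => ∫⁻ ω, ENNReal.ofReal (reservoir r X v ω / v) * F v (X v ω) ∂P]
  have h1 : ∀ ω, ∫⁻ t, F (crossGrid r X m t ω) (crossGridProcess r X m t ω) ∂halfLine =
      ∑' N : ℕ, F ((N + 1 : ℕ) / 2 ^ m) (X ((N + 1 : ℕ) / 2 ^ m) ω) *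
        ENNReal.ofReal (reservoir r X ((N + 1 : ℕ) / 2 ^ m) ω -
          partialSups (fun j : ℕ => reservoir r X (j / 2 ^ m) ω) N) := fun ω =>
    hs.lintegral_crossGrid m ω fun v => F v (X v ω)
  simp_rw [h1]
  rw [lintegral_tsum fun N => ?_]
  · congr 1
    ext N
    have h2 := hs.regular.lintegral_ladder r ((2 ^ m)⁻¹) N (hFm ((N + 1 : ℕ) / 2 ^ m))
    simp only [← div_eq_mul_inv] at h2
    have hN0 : (N + 1 : ℝ≥0∞) ≠ 0 := by positivity
    have hNt : (N + 1 : ℝ≥0∞) ≠ ∞ := by finiteness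
    rw [← ENNReal.mul_right_inj hN0 hNt, lintegral_congr fun ω => mul_comm _ _, h2]
    have h3 := hXm ((N + 1 : ℕ) / 2 ^ m)
    have h4 := measurable_reservoir (r := r) hXm ((N + 1 : ℕ) / 2 ^ m)
    have h5 := hFm ((N + 1 : ℕ) / 2 ^ m)
    rw [← lintegral_mul_const _ (by fun_prop), ← lintegral_const_mul _ (by fun_prop)]
    refine lintegral_congr fun ω => ?_
    rw [mul_right_comm, ← ENNReal.ofReal_mul' (by positivity), ← mul_assoc]
    congr 1
    have h6 : (N + 1 : ℝ≥0∞) = ENNReal.ofReal (N + 1) := by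
      rw [ENNReal.ofReal_add (by positivity) zero_le_one]
      simp
    rw [h6, ← ENNReal.ofReal_mul (by positivity)]
    congr 1
    push_cast
    field_simp
  · have := hXm ((N + 1 : ℕ) / 2 ^ m)
    have h3 := measurable_reservoir (r := r) hXm ((N + 1 : ℕ) / 2 ^ m)
    have h4 := measurable_partialSups_reservoir (r := r) hXm m N
    have h5 := hFm ((N + 1 : ℕ) / 2 ^ m)
    exact Measurable.aemeasurable (by fun_prop)

/-- Kendall's identity: the pair `(σ_t, Y_t)` under `dt` has the law of `(u, X_u)` under
`(Z_u⁺ / u) du`, where `Z_u = u - r · X_u`. -/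
theorem kendall {F : ℝ≥0 → (Fin d → ℝ) → ℝ≥0∞} (hF : Measurable (Function.uncurry F)) :
    ∫⁻ p, F (crossTime r X p.1 p.2) (crossProcess r X p.1 p.2) ∂(halfLine.prod P) =
      ∫⁻ p, ENNReal.ofReal (reservoir r X p.1 p.2 / p.1) * F p.1 (X p.1 p.2)
        ∂(halfLine.prod P) := by
  have hXj := hs.regular.measurable_joint
  have hRj : Measurable fun p : ℝ≥0 × Ω => reservoir r X p.1 p.2 := by
    unfold reservoir
    fun_prop
  have hσj := hs.measurable_crossTime
  have hYj := hs.measurable_crossProcess_uncurry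
  have hexpfin : ∫⁻ p : ℝ≥0 × Ω, ENNReal.ofReal (Real.exp (-p.1)) ∂(halfLine.prod P) ≠ ∞ := by
    rw [lintegral_prod _ (Measurable.aemeasurable (by fun_prop))]
    simpa using lintegral_exp_neg_halfLine
  -- bounded continuous functions weighted by `exp (-u)`
  have hcont : ∀ f : BoundedContinuousFunction (ℝ≥0 × (Fin d → ℝ)) ℝ≥0,
      ∫⁻ p, ENNReal.ofReal (Real.exp (-(crossTime r X p.1 p.2))) *
        f (crossTime r X p.1 p.2, crossProcess r X p.1 p.2) ∂(halfLine.prod P) =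
      ∫⁻ p, ENNReal.ofReal (reservoir r X p.1 p.2 / p.1) *
        (ENNReal.ofReal (Real.exp (-p.1)) * f (p.1, X p.1 p.2)) ∂(halfLine.prod P) := by
    intro f
    obtain ⟨C, hC⟩ : ∃ C : ℝ≥0, ∀ x, f x ≤ C :=
      ⟨_, fun x => BoundedContinuousFunction.NNReal.upper_bound f x⟩
    have hfm : Measurable fun x => (f x : ℝ≥0∞) := f.continuous.measurable.coe_nnreal_ennreal
    have hG : Measurable (Function.uncurry fun (v : ℝ≥0) (x : Fin d → ℝ) =>
        ENNReal.ofReal (Real.exp (-v)) * f (v, x)) := by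
      simp only [Function.uncurry_def]
      fun_prop
    have hc : ∀ m : ℕ, Measurable fun p : ℝ≥0 × Ω => (⌈p.1 * 2 ^ m⌉₊ : ℝ≥0) / 2 ^ m := fun m =>
      (measurable_from_nat (f := fun k : ℕ => (k : ℝ≥0) / 2 ^ m)).comp
        (Nat.measurable_ceil.comp (measurable_fst.mul_const _))
    have hXc : ∀ m : ℕ, Measurable fun p : ℝ≥0 × Ω => X ((⌈p.1 * 2 ^ m⌉₊ : ℝ≥0) / 2 ^ m) p.2 :=
      fun m => hXj.comp ((hc m).prodMk measurable_snd)
    have hRc : ∀ m : ℕ, Measurable fun p : ℝ≥0 × Ω =>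
        reservoir r X ((⌈p.1 * 2 ^ m⌉₊ : ℝ≥0) / 2 ^ m) p.2 :=
      fun m => hRj.comp ((hc m).prodMk measurable_snd)
    have hLm : ∀ m, Measurable fun p : ℝ≥0 × Ω =>
        ENNReal.ofReal (Real.exp (-(crossGrid r X m p.1 p.2))) *
          f (crossGrid r X m p.1 p.2, crossGridProcess r X m p.1 p.2) := fun m => by
      have h1 := hs.measurable_crossGrid m
      have h2 := hs.measurable_crossGridProcess_uncurry m
      fun_prop
    have hRm : ∀ m : ℕ, Measurable fun p : ℝ≥0 × Ω =>
        ENNReal.ofReal (reservoir r X ((⌈p.1 * 2 ^ m⌉₊ : ℝ≥0) / 2 ^ m) p.2 /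
          ((⌈p.1 * 2 ^ m⌉₊ : ℝ≥0) / 2 ^ m : ℝ≥0)) *
        (ENNReal.ofReal (Real.exp (-((⌈p.1 * 2 ^ m⌉₊ : ℝ≥0) / 2 ^ m : ℝ≥0))) *
          f ((⌈p.1 * 2 ^ m⌉₊ : ℝ≥0) / 2 ^ m, X ((⌈p.1 * 2 ^ m⌉₊ : ℝ≥0) / 2 ^ m) p.2)) :=
      fun m => by
        have h1 := hc m
        have h2 := hXc m
        have h3 := hRc m
        fun_prop
    have hgrid := fun m => hs.kendall_grid m hG
    have hgrid' : ∀ m : ℕ, ∫⁻ p, ENNReal.ofReal (Real.exp (-(crossGrid r X m p.1 p.2))) *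
          f (crossGrid r X m p.1 p.2, crossGridProcess r X m p.1 p.2) ∂(halfLine.prod P) =
        ∫⁻ p, ENNReal.ofReal (reservoir r X ((⌈p.1 * 2 ^ m⌉₊ : ℝ≥0) / 2 ^ m) p.2 /
          ((⌈p.1 * 2 ^ m⌉₊ : ℝ≥0) / 2 ^ m : ℝ≥0)) *
        (ENNReal.ofReal (Real.exp (-((⌈p.1 * 2 ^ m⌉₊ : ℝ≥0) / 2 ^ m : ℝ≥0))) *
          f ((⌈p.1 * 2 ^ m⌉₊ : ℝ≥0) / 2 ^ m, X ((⌈p.1 * 2 ^ m⌉₊ : ℝ≥0) / 2 ^ m) p.2))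
          ∂(halfLine.prod P) := fun m => by
      rw [lintegral_prod_symm' _ (hLm m), lintegral_prod _ (hRm m).aemeasurable]
      exact hgrid m
    have hbfin : ∫⁻ p : ℝ≥0 × Ω, C * ENNReal.ofReal (Real.exp (-p.1)) ∂(halfLine.prod P) ≠ ∞ := by
      rw [lintegral_const_mul _ (by fun_prop)]
      exact ENNReal.mul_ne_top ENNReal.coe_ne_top hexpfin
    have hL : Filter.Tendsto (fun m : ℕ => ∫⁻ p,
          ENNReal.ofReal (Real.exp (-(crossGrid r X m p.1 p.2))) *
          f (crossGrid r X m p.1 p.2, crossGridProcess r X m p.1 p.2) ∂(halfLine.prod P))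
        Filter.atTop (nhds (∫⁻ p, ENNReal.ofReal (Real.exp (-(crossTime r X p.1 p.2))) *
          f (crossTime r X p.1 p.2, crossProcess r X p.1 p.2) ∂(halfLine.prod P))) := by
      refine tendsto_lintegral_of_dominated_convergence _ hLm
        (fun m => ae_of_all _ fun p => ?_) hbfin (ae_of_all _ fun p => ?_)
      · refine (mul_comm _ _).trans_le (mul_le_mul' (ENNReal.coe_le_coe.2 (hC _)) ?_)
        refine (ENNReal.ofReal_le_ofReal (Real.exp_le_exp.2 (neg_le_neg ?_)))
        refine ((hs.skipFree p.2).le_passTime p.1.coe_nonneg).trans ?_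
        exact_mod_cast IsSkipFreePath.passTime_le_gridTime m _
      · refine ENNReal.Tendsto.mul ?_ (Or.inr ENNReal.coe_ne_top) ?_ (Or.inr ENNReal.ofReal_ne_top)
        · exact ENNReal.tendsto_ofReal ((Real.continuous_exp.tendsto _).comp
            ((NNReal.continuous_coe.tendsto _).comp (hs.tendsto_crossGrid p.1 p.2)).neg)
        · exact ENNReal.tendsto_coe.2 ((f.continuous.tendsto _).comp
            ((hs.tendsto_crossGrid p.1 p.2).prodMk_nhds (hs.tendsto_crossGridProcess p.1 p.2)))
    refine tendsto_nhds_unique hL (Filter.Tendsto.congr (fun m => (hgrid' m).symm) ?_)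
    have hpos : ∀ᵐ p ∂(halfLine.prod P), 0 < p.1 :=
      Measure.quasiMeasurePreserving_fst.ae ae_halfLine_pos
    refine tendsto_lintegral_of_dominated_convergence _ hRm
      (fun m => ae_of_all _ fun p => ?_) hbfin ?_
    · have h1 : ∀ v : ℝ≥0, ENNReal.ofReal (reservoir r X v p.2 / v) ≤ 1 := fun v => by
        rw [ENNReal.ofReal_le_one]
        exact div_le_one_of_le₀ ((hs.skipFree p.2).le_self v) v.coe_nonneg
      refine (mul_le_of_le_one_left' (h1 _)).trans ?_
      rw [mul_comm]
      refine mul_le_mul' (ENNReal.coe_le_coe.2 (hC _))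
        (ENNReal.ofReal_le_ofReal (Real.exp_le_exp.2 (neg_le_neg (NNReal.coe_le_coe.2 ?_))))
      rw [le_div_iff₀ (by positivity)]
      exact Nat.le_ceil _
    · filter_upwards [hpos] with p hp
      have hlim := tendsto_ceil_grid p.1
      have hlim' := tendsto_nhds_of_tendsto_nhdsWithin hlim
      have hlimR := (NNReal.continuous_coe.tendsto _).comp hlim'
      refine ENNReal.Tendsto.mul ?_ (Or.inr (ENNReal.mul_ne_top ENNReal.ofReal_ne_top
        ENNReal.coe_ne_top)) (ENNReal.Tendsto.mul ?_ (Or.inr ENNReal.coe_ne_top) ?_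
        (Or.inr ENNReal.ofReal_ne_top)) (Or.inr ENNReal.ofReal_ne_top)
      · refine ENNReal.tendsto_ofReal (Filter.Tendsto.div ?_ hlimR (by exact_mod_cast hp.ne'))
        exact ((hs.skipFree p.2).rightCts p.1).tendsto.comp hlim
      · exact ENNReal.tendsto_ofReal ((Real.continuous_exp.tendsto _).comp hlimR.neg)
      · exact ENNReal.tendsto_coe.2 ((f.continuous.tendsto _).comp
            (hlim'.prodMk_nhds ((hs.regular.rightCts p.2 p.1).tendsto.comp hlim)))
  set w₁ : ℝ≥0 × Ω → ℝ≥0∞ := fun p => ENNReal.ofReal (Real.exp (-(crossTime r X p.1 p.2)))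
  set w₂ : ℝ≥0 × Ω → ℝ≥0∞ := fun p =>
    ENNReal.ofReal (reservoir r X p.1 p.2 / p.1) * ENNReal.ofReal (Real.exp (-p.1))
  have hw₁ : Measurable w₁ := by fun_prop
  have hw₂ : Measurable w₂ := by fun_prop
  have hV₁ : Measurable fun p : ℝ≥0 × Ω => (crossTime r X p.1 p.2, crossProcess r X p.1 p.2) :=
    hσj.prodMk hYj
  have hV₂ : Measurable fun p : ℝ≥0 × Ω => (p.1, X p.1 p.2) := measurable_fst.prodMk hXj
  have hfin : IsFiniteMeasure ((halfLine.prod P).withDensity w₁) := by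
    refine isFiniteMeasure_withDensity (ne_top_of_le_ne_top hexpfin (lintegral_mono fun p => ?_))
    exact ENNReal.ofReal_le_ofReal (Real.exp_le_exp.2
      (neg_le_neg ((hs.skipFree p.2).le_passTime p.1.coe_nonneg)))
  have hmeas : ((halfLine.prod P).withDensity w₁).map
        (fun p => (crossTime r X p.1 p.2, crossProcess r X p.1 p.2)) =
      ((halfLine.prod P).withDensity w₂).map fun p => (p.1, X p.1 p.2) := by
    refine ext_of_forall_lintegral_eq_of_IsFiniteMeasure fun f => ?_
    have hfm : Measurable fun x => (f x : ℝ≥0∞) := f.continuous.measurable.coe_nnreal_ennreal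
    rw [lintegral_map_withDensity hw₁ hV₁ hfm, lintegral_map_withDensity hw₂ hV₂ hfm, hcont f]
    exact lintegral_congr fun p => by rw [← mul_assoc]
  have hGm : Measurable fun x : ℝ≥0 × (Fin d → ℝ) =>
      ENNReal.ofReal (Real.exp x.1) * F x.1 x.2 := by
    refine Measurable.mul (by fun_prop) hF
  have h := congrArg (fun μ => ∫⁻ x, ENNReal.ofReal (Real.exp x.1) * F x.1 x.2 ∂μ) hmeas
  rw [lintegral_map_withDensity hw₁ hV₁ hGm, lintegral_map_withDensity hw₂ hV₂ hGm] at h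
  have hexp : ∀ v : ℝ≥0, ENNReal.ofReal (Real.exp (-v)) * ENNReal.ofReal (Real.exp v) = 1 := by
    intro v
    rw [← ENNReal.ofReal_mul (Real.exp_nonneg _), ← Real.exp_add]
    simp
  have e1 : ∀ p, w₁ p * (ENNReal.ofReal (Real.exp (crossTime r X p.1 p.2)) *
      F (crossTime r X p.1 p.2) (crossProcess r X p.1 p.2)) =
      F (crossTime r X p.1 p.2) (crossProcess r X p.1 p.2) := fun p => by
    rw [← mul_assoc, hexp, one_mul]
  have e2 : ∀ p : ℝ≥0 × Ω, w₂ p * (ENNReal.ofReal (Real.exp p.1) * F p.1 (X p.1 p.2)) =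
      ENNReal.ofReal (reservoir r X p.1 p.2 / p.1) * F p.1 (X p.1 p.2) := fun p => by
    rw [← mul_assoc, mul_assoc (ENNReal.ofReal _), hexp, mul_one]
  simpa only [e1, e2] using h

end IsPassageReady

end Kendall

/-! ### The density formula at almost every time -/

section AlmostEveryTime

instance : SigmaFinite halfLine := by
  refine ⟨⟨⟨fun n => {t : ℝ≥0 | (0 : ℝ) ≤ t ∧ (t : ℝ) < n}, fun _ => trivial, fun n => ?_, ?_⟩⟩⟩
  · rw [halfLine_Ico le_rfl]
    exact ENNReal.ofReal_lt_top
  · refine eq_univ_of_forall fun t => mem_iUnion.2 ?_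
    obtain ⟨n, hn⟩ := exists_nat_gt (t : ℝ)
    exact ⟨n, t.coe_nonneg, hn⟩

/-- Translation of a function supported on `(c,∞)`. -/
lemma lintegral_halfLine_add {f : ℝ≥0 → ℝ≥0∞} (hf : Measurable f) (c : ℝ≥0)
    (h0 : ∀ u ≤ c, f u = 0) : ∫⁻ u, f u ∂halfLine = ∫⁻ t, f (t + c) ∂halfLine := by
  rw [lintegral_halfLine hf, lintegral_halfLine (by fun_prop),
    ← lintegral_indicator measurableSet_Ioi, ← lintegral_indicator measurableSet_Ioi,
    ← lintegral_add_right_eq_self _ (c : ℝ)]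
  refine lintegral_congr fun t => ?_
  simp only [indicator, mem_Ioi]
  rcases le_or_gt t 0 with ht | ht
  · rw [if_neg ht.not_gt]
    split_ifs
    · exact h0 _ (Real.toNNReal_le_iff_le_coe.2 (by linarith))
    · rfl
  · rw [if_pos ht, if_pos (by positivity), Real.toNNReal_add ht.le c.coe_nonneg, Real.toNNReal_coe]

variable {Ω : Type*} [MeasurableSpace Ω] {P : Measure Ω} {d : ℕ}
  {X : ℝ≥0 → Ω → (Fin d → ℝ)} {r : Fin d → ℝ}

lemma measurable_passageDensity {p : ℝ≥0 → (Fin d → ℝ) → ℝ≥0∞}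
    (hp : Measurable (Function.uncurry p)) :
    Measurable (Function.uncurry (passageDensity r p)) := by
  unfold passageDensity Function.uncurry
  have h1 : Measurable fun x : ℝ≥0 × (Fin d → ℝ) =>
      (Real.toNNReal ((x.1 : ℝ) + r ⬝ᵥ x.2), x.2) := by fun_prop
  have h2 := hp.comp h1
  simp only [Function.comp_def, Function.uncurry_def] at h2
  exact Measurable.mul (by fun_prop) h2

lemma HasOrthantDensity.lintegral_comp {V : Ω → Fin d → ℝ} {f : (Fin d → ℝ) → ℝ≥0∞}
    (h : HasOrthantDensity P V f) {g : (Fin d → ℝ) → ℝ≥0∞} (hg : Measurable g) :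
    ∫⁻ ω, g (V ω) ∂P = ∫⁻ y in Ici 0, f y * g y := by
  rw [← lintegral_map' hg.aemeasurable h.hasLaw.aemeasurable, h.hasLaw.map_eq,
    lintegral_withDensity_eq_lintegral_mul₀ h.aemeasurable hg.aemeasurable]
  rfl

lemma ae_withDensity_orthant {f : (Fin d → ℝ) → ℝ≥0∞} :
    ∀ᵐ x ∂((volume.restrict (Ici 0)).withDensity f), 0 ≤ x :=
  (withDensity_absolutelyContinuous _ _).ae_le (ae_restrict_mem measurableSet_Ici)

namespace IsPassageReady

variable [IsProbabilityMeasure P] (hs : IsPassageReady P X r)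

include hs

/-- Kendall's identity in terms of densities. -/
lemma lintegral_mul_lexp_passageDensity {p : ℝ≥0 → (Fin d → ℝ) → ℝ≥0∞}
    (hp : Measurable (Function.uncurry p)) (hpX : ∀ t, 0 < t → HasOrthantDensity P (X t) (p t))
    {a : ℝ≥0 → ℝ≥0∞} (ha : Measurable a) (z : Fin d → ℝ) :
    ∫⁻ t, a t * ∫⁻ ω, lexp z (crossProcess r X t ω) ∂P ∂halfLine =
      ∫⁻ t, a t * (∫⁻ y in Ici 0, passageDensity r p t y * lexp z y) ∂halfLine := by
  have hXj := hs.regular.measurable_joint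
  have hq := measurable_passageDensity (r := r) hp
  set F : ℝ≥0 → (Fin d → ℝ) → ℝ≥0∞ := fun u x => a ((u : ℝ) - r ⬝ᵥ x).toNNReal * lexp z x with hFdef
  have hF : Measurable (Function.uncurry F) := by
    simp only [hFdef, Function.uncurry_def]
    fun_prop
  have hqj : Measurable fun x : ℝ≥0 × (Fin d → ℝ) => passageDensity r p x.1 x.2 := hq
  have hK := hs.kendall hF
  have hYj := hs.measurable_crossProcess_uncurry
  have hl : ∀ t ω, F (crossTime r X t ω) (crossProcess r X t ω) =
      a t * lexp z (crossProcess r X t ω) := fun t ω => by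
    simp only [hFdef, hs.coe_crossTime, add_sub_cancel_right, Real.toNNReal_coe]
  simp only [hl] at hK
  rw [lintegral_prod _ (Measurable.aemeasurable (by fun_prop)),
    lintegral_prod _ (Measurable.aemeasurable ?_)] at hK
  swap
  · have : Measurable fun q : ℝ≥0 × Ω => F q.1 (X q.1 q.2) := hF.comp (measurable_fst.prodMk hXj)
    unfold reservoir
    fun_prop
  have h1 : ∀ t, ∫⁻ ω, a t * lexp z (crossProcess r X t ω) ∂P =
      a t * ∫⁻ ω, lexp z (crossProcess r X t ω) ∂P := fun t => by
    have := hs.measurable_crossProcess t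
    exact lintegral_const_mul _ (by fun_prop)
  simp only [h1] at hK
  rw [hK]
  -- the integrand on the right-hand side of Kendall's identity, in terms of `p`
  set H : ℝ≥0 → (Fin d → ℝ) → ℝ≥0∞ := fun u y =>
    p u y * (ENNReal.ofReal (((u : ℝ) - r ⬝ᵥ y) / u) * F u y) with hHdef
  have hH : Measurable (Function.uncurry H) := by
    simp only [hHdef, hFdef, Function.uncurry_def]
    have : Measurable fun x : ℝ≥0 × (Fin d → ℝ) => p x.1 x.2 := hp
    fun_prop
  have h2 : ∫⁻ u, ∫⁻ ω, ENNReal.ofReal (reservoir r X u ω / u) * F u (X u ω) ∂P ∂halfLine =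
      ∫⁻ u, (∫⁻ y in Ici 0, H u y) ∂halfLine := by
    refine lintegral_congr_ae ?_
    filter_upwards [ae_halfLine_pos] with u hu
    refine (hpX u hu).lintegral_comp
      (g := fun y => ENNReal.ofReal (((u : ℝ) - r ⬝ᵥ y) / u) * F u y) ?_
    have := hF.of_uncurry_left (x := u)
    fun_prop
  rw [h2, lintegral_lintegral_swap hH.aemeasurable]
  have h3 : ∀ t, a t * ∫⁻ y in Ici 0, passageDensity r p t y * lexp z y =
      ∫⁻ y in Ici 0, a t * (passageDensity r p t y * lexp z y) := fun t => by
    have := hq.of_uncurry_left (x := t)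
    exact (lintegral_const_mul _ (by fun_prop)).symm
  simp only [h3]
  conv_rhs => rw [lintegral_lintegral_swap (Measurable.aemeasurable (by fun_prop))]
  refine setLIntegral_congr_fun measurableSet_Ici fun y hy => ?_
  have hc : 0 ≤ r ⬝ᵥ y := dotProduct_nonneg_of_nonneg hs.nonneg hy
  have hcc : ((r ⬝ᵥ y).toNNReal : ℝ) = r ⬝ᵥ y := Real.coe_toNNReal _ hc
  rw [lintegral_halfLine_add (hH.of_uncurry_right (y := y)) (r ⬝ᵥ y).toNNReal fun u hu => ?_]
  · refine lintegral_congr fun t => ?_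
    simp only [hHdef, hFdef, passageDensity, NNReal.coe_add, hcc, add_sub_cancel_right,
      Real.toNNReal_coe]
    rw [Real.toNNReal_add t.coe_nonneg hc, Real.toNNReal_coe]
    ring
  · have : ((u : ℝ) - r ⬝ᵥ y) / u ≤ 0 := by
      refine div_nonpos_of_nonpos_of_nonneg ?_ u.coe_nonneg
      rw [← hcc, sub_nonpos]
      exact_mod_cast hu
    simp only [hHdef, ENNReal.ofReal_of_nonpos this, zero_mul, mul_zero]

/-- At almost every time, the law of the passage process has the density `passageDensity`. -/
theorem ae_map_crossProcess {p : ℝ≥0 → (Fin d → ℝ) → ℝ≥0∞}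
    (hp : Measurable (Function.uncurry p)) (hpX : ∀ t, 0 < t → HasOrthantDensity P (X t) (p t)) :
    ∀ᵐ t ∂halfLine, P.map (crossProcess r X t) =
      (volume.restrict (Ici 0)).withDensity (passageDensity r p t) := by
  have hq := measurable_passageDensity (r := r) hp
  have hYj := hs.measurable_crossProcess_uncurry
  have hae : ∀ᵐ t ∂halfLine, ∀ n : Fin d → ℕ,
      ∫⁻ ω, lexp (fun i => (n i : ℝ)) (crossProcess r X t ω) ∂P =
        ∫⁻ y in Ici 0, passageDensity r p t y * lexp (fun i => (n i : ℝ)) y := by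
    refine ae_all_iff.2 fun n => ?_
    have hqj : Measurable fun x : ℝ≥0 × (Fin d → ℝ) => passageDensity r p x.1 x.2 := hq
    refine ae_eq_of_forall_setLIntegral_eq_of_sigmaFinite
      (Measurable.lintegral_prod_right' (f := fun x : ℝ≥0 × Ω =>
        lexp (fun i => (n i : ℝ)) (crossProcess r X x.1 x.2)) (by fun_prop))
      (Measurable.lintegral_prod_right' (f := fun x : ℝ≥0 × (Fin d → ℝ) =>
        passageDensity r p x.1 x.2 * lexp (fun i => (n i : ℝ)) x.2) (by fun_prop))
      fun s hS _ => ?_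
    have h := hs.lintegral_mul_lexp_passageDensity hp hpX
      (measurable_const.indicator hS : Measurable (s.indicator fun _ => (1 : ℝ≥0∞)))
      (fun i => (n i : ℝ))
    rw [← lintegral_indicator hS, ← lintegral_indicator hS]
    simpa only [indicator, ite_mul, one_mul, zero_mul] using h
  filter_upwards [hae] with t ht
  have hqt := hq.of_uncurry_left (x := t)
  have hint : ∀ z, ∫⁻ x, lexp z x ∂((volume.restrict (Ici 0)).withDensity (passageDensity r p t)) =
      ∫⁻ y in Ici 0, passageDensity r p t y * lexp z y := fun z =>
    lintegral_withDensity_eq_lintegral_mul _ hqt (measurable_lexp z)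
  have hfin : IsFiniteMeasure ((volume.restrict (Ici 0)).withDensity (passageDensity r p t)) := by
    refine isFiniteMeasure_withDensity ?_
    have := ht 0
    simp only [Pi.zero_apply, Nat.cast_zero] at this
    change ∫⁻ ω, lexp 0 _ ∂P = ∫⁻ y in Ici 0, _ * lexp 0 y at this
    simp only [lexp_zero_left, mul_one] at this
    rw [← this]
    simp
  have := map_restrict_eq_of_lexp (hs.measurable_crossProcess t)
    (ae_of_all P (hs.crossProcess_nonneg t)) ae_withDensity_orthant univ fun n => by
      rw [Measure.restrict_univ, ht n, hint]
  rwa [Measure.restrict_univ] at this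

end IsPassageReady

end AlmostEveryTime

/-! ### Canonical densities -/

section Canonical

variable {d : ℕ}

/-- A convolution depends, at every point, only on the almost-everywhere classes of its factors. -/
lemma lconvolution_congr_ae {f f' g g' : (Fin d → ℝ) → ℝ≥0∞} (hf : f =ᵐ[volume] f')
    (hg : g =ᵐ[volume] g') : f ⋆ₗ g = f' ⋆ₗ g' := by
  ext y
  simp only [lconvolution_def]
  refine lintegral_congr_ae ?_
  have h : MeasurePreserving (fun x : Fin d → ℝ => -x + y) volume volume := by
    simpa only [neg_add_eq_sub] using Measure.measurePreserving_sub_left volume y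
  filter_upwards [hf, h.quasiMeasurePreserving.ae_eq_comp hg] with x h1 h2
  simp only [Function.comp_apply] at h2
  rw [h1, h2]

lemma lconvolution_eq_setLIntegral {f g : (Fin d → ℝ) → ℝ≥0∞} (hf : ∀ y, ¬ 0 ≤ y → f y = 0)
    (hg : ∀ y, ¬ 0 ≤ y → g y = 0) (y : Fin d → ℝ) :
    (f ⋆ₗ g) y = ∫⁻ x in Icc 0 y, f x * g (y - x) := by
  rw [lconvolution_def, ← lintegral_indicator measurableSet_Icc]
  refine lintegral_congr fun x => ?_
  rw [neg_add_eq_sub]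
  by_cases hx : x ∈ Icc 0 y
  · rw [indicator_of_mem hx]
  · rw [indicator_of_notMem hx]
    by_cases h0 : 0 ≤ x
    · rw [hg _ fun h => hx ⟨h0, sub_nonneg.1 h⟩, mul_zero]
    · rw [hf _ h0, zero_mul]

lemma lconvolution_eq_zero {f g : (Fin d → ℝ) → ℝ≥0∞} (hf : ∀ y, ¬ 0 ≤ y → f y = 0)
    (hg : ∀ y, ¬ 0 ≤ y → g y = 0) (y : Fin d → ℝ) (hy : ¬ 0 ≤ y) : (f ⋆ₗ g) y = 0 := by
  have : Icc 0 y = ∅ := Icc_eq_empty hy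
  rw [lconvolution_eq_setLIntegral hf hg, this, setLIntegral_empty]

variable {Ω : Type*} [MeasurableSpace Ω] {P : Measure Ω} {X : ℝ≥0 → Ω → (Fin d → ℝ)}

/-- A jointly measurable canonical family of densities of the marginals of `X`, extended by `0`
outside the orthant, so that the semigroup identity is a convolution on the whole space. -/
structure IsSemigroupDensity (P : Measure Ω) (X : ℝ≥0 → Ω → (Fin d → ℝ))
    (q : ℝ≥0 → (Fin d → ℝ) → ℝ≥0∞) : Prop where
  measurable : Measurable (Function.uncurry q)
  eq_zero : ∀ t y, ¬ 0 ≤ y → q t y = 0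
  map_eq : ∀ t, 0 < t → P.map (X t) = volume.withDensity (q t)
  add : ∀ s t, 0 < s → 0 < t → q (s + t) = q s ⋆ₗ q t

lemma IsSubordinator.map_add [IsFiniteMeasure P] (hX : IsSubordinator P X) (s t : ℝ≥0) :
    P.map (X (s + t)) = P.map (X s) ∗ P.map (X t) := by
  have hind := hX.indep_increments.indepFun_eval_sub (zero_le (a := s))
    (le_add_of_nonneg_right (zero_le (a := t)) : s ≤ s + t) hX.start
  have h := hind.map_add_eq_map_conv_map (hX.measurable s)
    ((hX.measurable (s + t)).sub (hX.measurable s))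
  rw [add_sub_cancel] at h
  rw [h]
  congr 1
  exact (hX.stationary_increments s t).map_eq

lemma map_withDensity_of_hasOrthantDensity {V : Ω → Fin d → ℝ} {f : (Fin d → ℝ) → ℝ≥0∞}
    (h : HasOrthantDensity P V f) : P.map V = volume.withDensity ((Ici 0).indicator f) := by
  rw [h.hasLaw.map_eq, withDensity_indicator measurableSet_Ici]

lemma withDensity_restrict_orthant {f : (Fin d → ℝ) → ℝ≥0∞} (hf : ∀ y, ¬ 0 ≤ y → f y = 0) :
    (volume.restrict (Ici 0)).withDensity f = volume.withDensity f := by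
  rw [← withDensity_indicator measurableSet_Ici]
  congr 1
  ext y
  by_cases hy : 0 ≤ y
  · rw [indicator_of_mem (show y ∈ Ici 0 from hy)]
  · rw [indicator_of_notMem (show y ∉ Ici 0 from hy), hf y hy]

lemma hasOrthantDensity_of_map_eq {V : Ω → Fin d → ℝ} (hV : AEMeasurable V P)
    {f : (Fin d → ℝ) → ℝ≥0∞} (hf : AEMeasurable f) (hf0 : ∀ y, ¬ 0 ≤ y → f y = 0)
    (h : P.map V = volume.withDensity f) : HasOrthantDensity P V f :=
  ⟨hf.restrict, ⟨hV, by rw [h, withDensity_restrict_orthant hf0]⟩⟩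

namespace IsSemigroupDensity

variable {q : ℝ≥0 → (Fin d → ℝ) → ℝ≥0∞} (hq : IsSemigroupDensity P X q)

include hq

lemma measurable_apply (t : ℝ≥0) : Measurable (q t) := hq.measurable.of_uncurry_left

lemma hasOrthantDensity (hX : ∀ t, Measurable (X t)) {t : ℝ≥0} (ht : 0 < t) :
    HasOrthantDensity P (X t) (q t) :=
  hasOrthantDensity_of_map_eq (hX t).aemeasurable (hq.measurable_apply t).aemeasurable
    (hq.eq_zero t) (hq.map_eq t ht)

lemma isTransitionDensity (hX : ∀ t, Measurable (X t)) : IsTransitionDensity P X q where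
  density _ ht := hq.hasOrthantDensity hX ht
  chapman_kolmogorov s t hs ht y _ := by
    rw [hq.add s t hs ht, lconvolution_eq_setLIntegral (hq.eq_zero s) (hq.eq_zero t)]

/-- Canonical densities are unique at every point of the orthant, because the semigroup identity
expresses `p t` by the integral of a product of densities at time `t / 2`. -/
lemma eq_of_isTransitionDensity {p : ℝ≥0 → (Fin d → ℝ) → ℝ≥0∞}
    (hp : IsTransitionDensity P X p) {t : ℝ≥0} (ht : 0 < t) {y : Fin d → ℝ} (hy : 0 ≤ y) :
    p t y = q t y := by
  have ht2 : 0 < t / 2 := by positivity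
  have hae : (Ici 0).indicator (p (t / 2)) =ᵐ[volume] q (t / 2) := by
    have hd := hp.density _ ht2
    rw [← withDensity_eq_iff_of_sigmaFinite
      ((aemeasurable_indicator_iff measurableSet_Ici).2 hd.aemeasurable)
      (hq.measurable_apply _).aemeasurable, ← map_withDensity_of_hasOrthantDensity hd,
      hq.map_eq _ ht2]
  have h1 := hp.chapman_kolmogorov _ _ ht2 ht2 y hy
  have h2 := hq.add _ _ ht2 ht2
  rw [add_halves] at h1 h2
  rw [h1, h2, ← lconvolution_congr_ae hae hae, lconvolution_eq_setLIntegral]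
  · refine setLIntegral_congr_fun measurableSet_Icc fun x hx => ?_
    rw [indicator_of_mem (show x ∈ Ici 0 from hx.1),
      indicator_of_mem (show y - x ∈ Ici 0 from sub_nonneg.2 hx.2)]
  all_goals exact fun y hy => indicator_of_notMem hy _

end IsSemigroupDensity

variable [IsProbabilityMeasure P]

/-- Jointly measurable densities: the Radon–Nikodym derivative of the kernel `t ↦ law of X_t` with
respect to a finite measure equivalent to Lebesgue measure. -/
lemma exists_measurable_density (hX : IsRegularSubordinator P X)
    (hac : ∀ t, 0 < t → P.map (X t) ≪ volume) :
    ∃ f : ℝ≥0 → (Fin d → ℝ) → ℝ≥0∞, Measurable (Function.uncurry f) ∧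
      (∀ t y, ¬ 0 ≤ y → f t y = 0) ∧ ∀ t, 0 < t → P.map (X t) = volume.withDensity (f t) := by
  have hXj := hX.measurable_joint
  have hκ : Measurable fun t => P.map (X t) := by
    refine Measure.measurable_of_measurable_coe _ fun s hs => ?_
    have : ∀ t, P.map (X t) s = P (Prod.mk t ⁻¹' ((fun p : ℝ≥0 × Ω => X p.1 p.2) ⁻¹' s)) :=
      fun t => Measure.map_apply (hX.measurable t) hs
    simp_rw [this]
    exact measurable_measure_prodMk_left (hXj hs)
  let κ : Kernel ℝ≥0 (Fin d → ℝ) := ⟨fun t => P.map (X t), hκ⟩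
  have hκm : IsMarkovKernel κ :=
    ⟨fun t => Measure.isProbabilityMeasure_map (hX.measurable t).aemeasurable⟩
  let η : Kernel ℝ≥0 (Fin d → ℝ) := Kernel.const _ (volume : Measure (Fin d → ℝ)).toFinite
  set g : (Fin d → ℝ) → ℝ≥0∞ := (volume : Measure (Fin d → ℝ)).toFinite.rnDeriv volume
  have hg : (volume : Measure (Fin d → ℝ)).withDensity g =
      (volume : Measure (Fin d → ℝ)).toFinite :=
    Measure.withDensity_rnDeriv_eq _ _ (toFinite_absolutelyContinuous _)
  have hgm : Measurable g := Measure.measurable_rnDeriv _ _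
  have hfm : Measurable fun p : ℝ≥0 × (Fin d → ℝ) => g p.2 * κ.rnDeriv η p.1 p.2 := by fun_prop
  refine ⟨fun t => (Ici 0).indicator fun y => g y * κ.rnDeriv η t y, ?_,
    fun t y hy => indicator_of_notMem hy _, fun t ht => ?_⟩
  · exact hfm.indicator (s := Prod.snd ⁻¹' Ici (0 : Fin d → ℝ)) (measurable_snd measurableSet_Ici)
  · have h1 : η.withDensity (κ.rnDeriv η) t = κ t := Kernel.withDensity_rnDeriv_eq
      ((hac t ht).trans (absolutelyContinuous_toFinite _))
    have h2 : P.map (X t) = volume.withDensity (fun y => g y * κ.rnDeriv η t y) := by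
      rw [Kernel.withDensity_apply _ (Kernel.measurable_rnDeriv κ η)] at h1
      change (volume : Measure (Fin d → ℝ)).toFinite.withDensity _ = P.map (X t) at h1
      rw [← h1, ← hg]
      exact (withDensity_mul _ hgm (Kernel.measurable_rnDeriv_right κ η t)).symm
    have h3 : ∀ᵐ x ∂(P.map (X t)), x ∈ Ici (0 : Fin d → ℝ) :=
      (ae_map_iff (hX.measurable t).aemeasurable measurableSet_Ici).2
        (ae_of_all _ fun ω => hX.nonneg t ω)
    rw [withDensity_indicator measurableSet_Ici, ← restrict_withDensity measurableSet_Ici, ← h2,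
      Measure.restrict_eq_self_of_ae_mem h3]

/-- The family `f (t / 2) ⋆ f (t / 2)` is canonical for every measurable family of densities `f`:
convolutions depend only on almost-everywhere classes, so both sides of the semigroup identity are
`f (s / 2) ⋆ f (s / 2) ⋆ f (t / 2) ⋆ f (t / 2)` at every point. -/
theorem exists_isSemigroupDensity (hX : IsRegularSubordinator P X)
    (hac : ∀ t, 0 < t → P.map (X t) ≪ volume) : ∃ q, IsSemigroupDensity P X q := by
  obtain ⟨f, hf, hf0, hfX⟩ := exists_measurable_density hX hac
  have hfm : ∀ t, Measurable (f t) := fun t => hf.of_uncurry_left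
  have hmap : ∀ {s t}, 0 < s → 0 < t →
      P.map (X (s + t)) = volume.withDensity (f s ⋆ₗ f t) := fun {s t} hs ht => by
    rw [hX.map_add, hfX s hs, hfX t ht, conv_withDensity_eq_lconvolution (hfm s) (hfm t)]
  have hae : ∀ {s t}, 0 < s → 0 < t → f s ⋆ₗ f t =ᵐ[volume] f (s + t) := fun {s t} hs ht => by
    rw [← withDensity_eq_iff_of_sigmaFinite
      (measurable_lconvolution volume (hfm s) (hfm t)).aemeasurable (hfm _).aemeasurable,
      ← hmap hs ht, hfX _ (by positivity)]
  refine ⟨fun t => f (t / 2) ⋆ₗ f (t / 2), ?_, fun t => lconvolution_eq_zero (hf0 _) (hf0 _),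
    fun t ht => ?_, fun s t hs ht => ?_⟩
  · have h1 : Measurable fun p : (ℝ≥0 × (Fin d → ℝ)) × (Fin d → ℝ) => f (p.1.1 / 2) p.2 :=
      hf.comp ((measurable_fst.fst.div_const 2).prodMk measurable_snd)
    have h2 : Measurable fun p : (ℝ≥0 × (Fin d → ℝ)) × (Fin d → ℝ) =>
        f (p.1.1 / 2) (-p.2 + p.1.2) :=
      hf.comp ((measurable_fst.fst.div_const 2).prodMk
        (measurable_snd.neg.add measurable_fst.snd))
    exact (h1.mul h2).lintegral_prod_right'
  · have := hmap (s := t / 2) (t := t / 2) (by positivity) (by positivity)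
    rwa [add_halves] at this
  · have hs2 : 0 < s / 2 := by positivity
    have ht2 : 0 < t / 2 := by positivity
    have hpos : 0 < (s + t) / 2 := by positivity
    have hst : s / 2 + t / 2 = (s + t) / 2 := (add_div _ _ _).symm
    have e3 : f (s / 2) ⋆ₗ f (t / 2) =ᵐ[volume] f ((s + t) / 2) := by simpa [hst] using hae hs2 ht2
    calc f ((s + t) / 2) ⋆ₗ f ((s + t) / 2)
        = (f (s / 2) ⋆ₗ f (t / 2)) ⋆ₗ (f (s / 2) ⋆ₗ f (t / 2)) := (lconvolution_congr_ae e3 e3).symm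
      _ = f (s / 2) ⋆ₗ (f (t / 2) ⋆ₗ (f (t / 2) ⋆ₗ f (s / 2))) := by
          rw [lconvolution_comm (f := f (t / 2)) (g := f (s / 2)),
            lconvolution_assoc (hfm _) (hfm _)
              (measurable_lconvolution _ (hfm _) (hfm _))]
      _ = (f (s / 2) ⋆ₗ f (s / 2)) ⋆ₗ (f (t / 2) ⋆ₗ f (t / 2)) := by
          rw [lconvolution_assoc (hfm (t / 2)) (hfm (t / 2)) (hfm (s / 2)),
            lconvolution_comm (f := f (t / 2) ⋆ₗ f (t / 2)) (g := f (s / 2)),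
            lconvolution_assoc (hfm (s / 2)) (hfm (s / 2))
              (measurable_lconvolution _ (hfm _) (hfm _))]

end Canonical

/-! ### The density formula at every time -/

section EveryTime

variable {Ω : Type*} [MeasurableSpace Ω] {P : Measure Ω} {d : ℕ}
  {X : ℝ≥0 → Ω → (Fin d → ℝ)} {r : Fin d → ℝ} {q : ℝ≥0 → (Fin d → ℝ) → ℝ≥0∞}

namespace IsSemigroupDensity

variable (hq : IsSemigroupDensity P X q)

include hq

lemma measurable_passageDensity (t : ℝ≥0) : Measurable (passageDensity r q t) :=
  (_root_.measurable_passageDensity hq.measurable).of_uncurry_left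

lemma passageDensity_eq_zero (t : ℝ≥0) (y : Fin d → ℝ) (hy : ¬ 0 ≤ y) :
    passageDensity r q t y = 0 := by
  rw [passageDensity, hq.eq_zero _ _ hy, mul_zero]

lemma measurable_passageDensity_mul (s u : ℝ≥0) :
    Measurable fun p : (Fin d → ℝ) × (Fin d → ℝ) =>
      passageDensity r q s p.2 * q (u - s - r ⬝ᵥ p.2).toNNReal (p.1 - p.2) := by
  have h1 : Measurable fun p : (Fin d → ℝ) × (Fin d → ℝ) =>
      ((u - s - r ⬝ᵥ p.2).toNNReal, p.1 - p.2) := by fun_prop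
  exact ((hq.measurable_passageDensity s).comp measurable_snd).mul (hq.measurable.comp h1)

end IsSemigroupDensity

namespace IsPassageReady

variable [IsProbabilityMeasure P] (hs : IsPassageReady P X r) (hq : IsSemigroupDensity P X q)

include hs hq

/-- The density of `X u` on the event that level `s` is passed before time `u`, by the strong Markov
property at the passage time. -/
lemma map_restrict_crossTime_lt {s : ℝ≥0}
    (hgood : P.map (crossProcess r X s) = volume.withDensity (passageDensity r q s)) (u : ℝ≥0) :
    (P.restrict {ω | crossTime r X s ω < u}).map (X u) = volume.withDensity fun y =>
      ∫⁻ x in {x | s + r ⬝ᵥ x < u},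
        passageDensity r q s x * q (u - s - r ⬝ᵥ x).toNNReal (y - x) := by
  have hB : MeasurableSet {x : Fin d → ℝ | s + r ⬝ᵥ x < u} :=
    measurableSet_lt (by fun_prop) measurable_const
  have hQ := hq.measurable_passageDensity (r := r) s
  have hqj := hq.measurable_passageDensity_mul (r := r) s u
  set h : (Fin d → ℝ) → ℝ≥0∞ := fun y =>
    ∫⁻ x in {x | s + r ⬝ᵥ x < u}, passageDensity r q s x * q (u - s - r ⬝ᵥ x).toNNReal (y - x)
    with hh
  have hhm : Measurable h := hqj.lintegral_prod_right'
  have hh0 : ∀ y, ¬ 0 ≤ y → h y = 0 := fun y hy => by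
    rw [hh]
    refine (lintegral_congr fun x => ?_).trans lintegral_zero
    by_cases hx : 0 ≤ x
    · rw [hq.eq_zero _ (y - x) fun h => hy (hx.trans (sub_nonneg.1 h)), mul_zero]
    · rw [hq.passageDensity_eq_zero s x hx, zero_mul]
  have hlap : ∀ z : Fin d → ℝ, 0 ≤ z →
      ∫⁻ ω in {ω | crossTime r X s ω < u}, lexp z (X u ω) ∂P = ∫⁻ y, h y * lexp z y := by
    intro z hz
    have hset : {ω | crossTime r X s ω < u} =
        crossProcess r X s ⁻¹' {x : Fin d → ℝ | s + r ⬝ᵥ x < u} := by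
      ext ω
      simp only [mem_ofPred_eq, mem_preimage, ← hs.coe_crossTime, NNReal.coe_lt_coe]
    have hG : Measurable fun x : Fin d → ℝ => lexp z x *
        ENNReal.ofReal (Real.exp (-((u - (s + r ⬝ᵥ x)) * laplaceExponent P X z))) := by fun_prop
    rw [hs.setLIntegral_lexp_crossTime hz, hset]
    simp only [hs.coe_crossTime]
    rw [← setLIntegral_map hB hG (hs.measurable_crossProcess s), hgood,
      setLIntegral_withDensity_eq_setLIntegral_mul _ hQ hG hB]
    have hin : ∀ y, h y * lexp z y = ∫⁻ x in {x | s + r ⬝ᵥ x < u},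
        passageDensity r q s x * q (u - s - r ⬝ᵥ x).toNNReal (y - x) * lexp z y := fun y =>
      (lintegral_mul_const _ (hqj.comp measurable_prodMk_left)).symm
    simp only [hin]
    rw [lintegral_lintegral_swap (Measurable.aemeasurable (by fun_prop))]
    refine setLIntegral_congr_fun hB fun x hx => ?_
    have hv : 0 < (u - s - r ⬝ᵥ x).toNNReal := by
      rw [Real.toNNReal_pos]
      have : (s : ℝ) + r ⬝ᵥ x < u := hx
      linarith
    have hvc : (((u - s - r ⬝ᵥ x).toNNReal : ℝ≥0) : ℝ) = u - (s + r ⬝ᵥ x) := by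
      rw [Real.coe_toNNReal _ (Real.toNNReal_pos.1 hv).le, sub_sub]
    have hL := hs.regular.toIsSubordinator.lintegral_lexp (u - s - r ⬝ᵥ x).toNNReal hz
    rw [hvc, ← lintegral_map (measurable_lexp z) (hs.regular.measurable _), hq.map_eq _ hv,
      lintegral_withDensity_eq_lintegral_mul _ (hq.measurable_apply _) (measurable_lexp z),
      ← lintegral_sub_right_eq_self _ x] at hL
    rw [Pi.mul_apply, ← hL, ← mul_assoc, ← lintegral_const_mul _ ?_]
    · refine lintegral_congr fun y => ?_
      have : lexp z y = lexp z x * lexp z (y - x) := by rw [← lexp_add, add_sub_cancel]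
      rw [this, Pi.mul_apply]
      ring
    · have := hq.measurable_apply (u - s - r ⬝ᵥ x).toNNReal
      simp only [Pi.mul_apply]
      fun_prop
  have hint : ∀ z, ∫⁻ x, lexp z x ∂(volume.withDensity h) = ∫⁻ y, h y * lexp z y := fun z =>
    lintegral_withDensity_eq_lintegral_mul _ hhm (measurable_lexp z)
  have hfin : IsFiniteMeasure (volume.withDensity h) := by
    refine isFiniteMeasure_withDensity ?_
    have := hlap 0 le_rfl
    simp only [lexp_zero_left, mul_one] at this
    rw [← this]
    simp
  refine map_restrict_eq_of_lexp (hs.regular.measurable u)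
    (ae_of_all P (hs.regular.nonneg u)) ?_ _ fun n => ?_
  · rw [ae_withDensity_iff hhm]
    exact ae_of_all _ fun y hy => by_contra fun h0 => hy (hh0 y h0)
  · rw [hlap _ fun i => Nat.cast_nonneg _, hint]

/-- Almost-everywhere form of the decomposition at the passage of `s`: where `r · y < u - s`, the
event `X u = y` forces the level `s` to be passed before `u`. -/
lemma ae_eq_lintegral_passageDensity {s : ℝ≥0}
    (hgood : P.map (crossProcess r X s) = volume.withDensity (passageDensity r q s)) (u : ℝ≥0)
    (hu : 0 < u) :
    ∀ᵐ y : Fin d → ℝ, r ⬝ᵥ y < u - s →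
      q u y = ∫⁻ x, passageDensity r q s x * q (u - s - r ⬝ᵥ x).toNNReal (y - x) := by
  have hXu := hs.regular.measurable u
  have hB : MeasurableSet {y : Fin d → ℝ | r ⬝ᵥ y < u - s} :=
    measurableSet_lt (by fun_prop) measurable_const
  have hB' : MeasurableSet {x : Fin d → ℝ | s + r ⬝ᵥ x < u} :=
    measurableSet_lt (by fun_prop) measurable_const
  have hsub : X u ⁻¹' {y : Fin d → ℝ | r ⬝ᵥ y < u - s} ⊆ {ω | crossTime r X s ω < u} := by
    intro ω hω
    refine (hs.skipFree ω).passTime_lt_of_lt_apply s.coe_nonneg ?_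
    have : r ⬝ᵥ X u ω < u - s := hω
    rw [reservoir]
    linarith
  have h := congrArg (Measure.restrict · {y : Fin d → ℝ | r ⬝ᵥ y < u - s})
    (hs.map_restrict_crossTime_lt hq hgood u)
  rw [Measure.restrict_map hXu hB, Measure.restrict_restrict (hXu hB), inter_eq_left.2 hsub,
    ← Measure.restrict_map hXu hB, hq.map_eq u hu, restrict_withDensity hB, restrict_withDensity hB,
    withDensity_eq_iff_of_sigmaFinite (hq.measurable_apply u).aemeasurable
      (hq.measurable_passageDensity_mul s u).lintegral_prod_right'.aemeasurable] at h
  filter_upwards [(ae_restrict_iff' hB).1 h] with y hy hyB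
  rw [hy hyB, ← lintegral_indicator hB']
  refine lintegral_congr fun x => ?_
  by_cases hx : x ∈ {x : Fin d → ℝ | s + r ⬝ᵥ x < u}
  · rw [indicator_of_mem hx]
  · rw [indicator_of_notMem hx, hq.eq_zero _ (y - x), mul_zero]
    intro hxy
    have := dotProduct_le_dotProduct_right hs.nonneg (sub_nonneg.1 hxy)
    refine hx (?_ : s + r ⬝ᵥ x < u)
    linarith

/-- Decomposition of the density of `X u` at the passage of level `s`, valid at every point below
level `u - s`: the almost-everywhere identity is made pointwise by a last convolution step. -/
lemma eq_lintegral_passageDensity {s : ℝ≥0}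
    (hgood : P.map (crossProcess r X s) = volume.withDensity (passageDensity r q s)) {u : ℝ≥0}
    {y : Fin d → ℝ} (hy : r ⬝ᵥ y < u - s) (hy0 : 0 ≤ y) :
    q u y = ∫⁻ x, passageDensity r q s x * q (u - s - r ⬝ᵥ x).toNNReal (y - x) := by
  have hry : 0 ≤ r ⬝ᵥ y := dotProduct_nonneg_of_nonneg hs.nonneg hy0
  obtain ⟨δ, hδ0, hδ⟩ : ∃ δ : ℝ≥0, 0 < δ ∧ (δ : ℝ) = (u - s - r ⬝ᵥ y) / 2 :=
    ⟨((u - s - r ⬝ᵥ y) / 2).toNNReal, Real.toNNReal_pos.2 (by linarith),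
      Real.coe_toNNReal _ (by linarith)⟩
  obtain ⟨w, rfl⟩ : ∃ w, u = w + δ := by
    refine ⟨u - δ, (tsub_add_cancel_of_le ?_).symm⟩
    rw [← NNReal.coe_le_coe, hδ]
    linarith [s.coe_nonneg]
  push_cast at hδ hy
  have hw : 0 < w := by
    rw [← NNReal.coe_pos]
    linarith [s.coe_nonneg, NNReal.coe_pos.2 hδ0]
  have hm := hq.measurable_passageDensity_mul (r := r) s w
  have hmδ := hq.measurable_apply δ
  calc q (w + δ) y = ∫⁻ a, q w a * q δ (-a + y) := by rw [hq.add _ _ hw hδ0, lconvolution_def]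
    _ = ∫⁻ a, (∫⁻ x, passageDensity r q s x * q (w - s - r ⬝ᵥ x).toNNReal (a - x)) *
          q δ (-a + y) := by
        refine lintegral_congr_ae ?_
        filter_upwards [hs.ae_eq_lintegral_passageDensity hq hgood w hw] with a ha
        by_cases hay : a ≤ y
        · rw [ha]
          have := dotProduct_le_dotProduct_right hs.nonneg hay
          linarith [NNReal.coe_pos.2 hδ0]
        · rw [hq.eq_zero δ (-a + y), mul_zero, mul_zero]
          rwa [neg_add_eq_sub, sub_nonneg]
    _ = ∫⁻ a, ∫⁻ x, passageDensity r q s x * q (w - s - r ⬝ᵥ x).toNNReal (a - x) *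
          q δ (-a + y) :=
        lintegral_congr fun a => (lintegral_mul_const _ (hm.comp measurable_prodMk_left)).symm
    _ = ∫⁻ x, ∫⁻ a, passageDensity r q s x * q (w - s - r ⬝ᵥ x).toNNReal (a - x) *
          q δ (-a + y) := lintegral_lintegral_swap (Measurable.aemeasurable
            (hm.mul (hmδ.comp (measurable_fst.neg.add_const y))))
    _ = ∫⁻ x, passageDensity r q s x *
          (q (w - s - r ⬝ᵥ x).toNNReal ⋆ₗ q δ) (y - x) := by
        refine lintegral_congr fun x => ?_
        have hmx := hq.measurable_apply (w - s - r ⬝ᵥ x).toNNReal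
        rw [lconvolution_def, ← lintegral_const_mul _ (by fun_prop),
          ← lintegral_add_right_eq_self _ x]
        refine lintegral_congr fun a => ?_
        rw [add_sub_cancel_right, mul_assoc]
        congr 3
        abel
    _ = _ := by
        refine lintegral_congr fun x => ?_
        by_cases hxy : x ≤ y
        · have h1 := dotProduct_le_dotProduct_right hs.nonneg hxy
          have h2 : 0 < (w : ℝ) - s - r ⬝ᵥ x := by linarith [NNReal.coe_pos.2 hδ0]
          rw [← hq.add _ _ (Real.toNNReal_pos.2 h2) hδ0]
          congr 2
          rw [← NNReal.coe_inj, NNReal.coe_add, Real.coe_toNNReal _ h2.le, Real.coe_toNNReal]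
          all_goals push_cast; linarith [δ.coe_nonneg]
        · rw [hq.eq_zero _ (y - x) (by rwa [sub_nonneg]), lconvolution_eq_zero (hq.eq_zero _)
            (hq.eq_zero _) _ (by rwa [sub_nonneg])]

omit [IsProbabilityMeasure P] in
/-- With `u = v + w` for `v = s + r · x` and `w = t + r · (y - x)`, the identity
`1 / (v w) = (1 / u) (1 / v + 1 / w)` splits a product of passage densities into two terms. -/
lemma passageDensity_mul_passageDensity {s t u : ℝ≥0} (hs0 : 0 < s) (ht0 : 0 < t)
    (x y : Fin d → ℝ) (hu : (u : ℝ) = s + t + r ⬝ᵥ y) :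
    passageDensity r q s x * passageDensity r q t (y - x) =
      ENNReal.ofReal (t / u) * (passageDensity r q s x * q (u - s - r ⬝ᵥ x).toNNReal (y - x)) +
      ENNReal.ofReal (s / u) * (passageDensity r q t (y - x) *
        q (u - t - r ⬝ᵥ (y - x)).toNNReal (y - (y - x))) := by
  by_cases hx : 0 ≤ x ∧ x ≤ y
  swap
  · rw [sub_sub_cancel]
    rcases not_and_or.1 hx with hx | hx
    · rw [hq.passageDensity_eq_zero s x hx, hq.eq_zero _ x hx]
      simp
    · rw [← sub_nonneg] at hx
      rw [hq.passageDensity_eq_zero t _ hx, hq.eq_zero _ (y - x) hx]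
      simp
  have hrx : 0 ≤ r ⬝ᵥ x := dotProduct_nonneg_of_nonneg hs.nonneg hx.1
  have hrxy : 0 ≤ r ⬝ᵥ (y - x) := dotProduct_nonneg_of_nonneg hs.nonneg (sub_nonneg.2 hx.2)
  have hd : r ⬝ᵥ (y - x) = r ⬝ᵥ y - r ⬝ᵥ x := dotProduct_sub _ _ _
  have hv1 : (u : ℝ) - s - r ⬝ᵥ x = t + r ⬝ᵥ (y - x) := by rw [hd, hu]; ring
  have hv2 : (u : ℝ) - t - r ⬝ᵥ (y - x) = s + r ⬝ᵥ x := by rw [hd, hu]; ring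
  have hsum : (u : ℝ) = (s + r ⬝ᵥ x) + (t + r ⬝ᵥ (y - x)) := by rw [hd, hu]; ring
  have hpos1 : 0 < s + r ⬝ᵥ x := by positivity
  have hpos2 : 0 < t + r ⬝ᵥ (y - x) := by positivity
  rw [hv1, hv2, sub_sub_cancel, passageDensity, passageDensity]
  set A := q (s + r ⬝ᵥ x).toNNReal x
  set B := q (t + r ⬝ᵥ (y - x)).toNNReal (y - x)
  have hc : ENNReal.ofReal (s / (s + r ⬝ᵥ x)) * ENNReal.ofReal (t / (t + r ⬝ᵥ (y - x))) =
      ENNReal.ofReal (t / u) * ENNReal.ofReal (s / (s + r ⬝ᵥ x)) +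
        ENNReal.ofReal (s / u) * ENNReal.ofReal (t / (t + r ⬝ᵥ (y - x))) := by
    rw [← ENNReal.ofReal_mul (by positivity), ← ENNReal.ofReal_mul (by positivity),
      ← ENNReal.ofReal_mul (by positivity), ← ENNReal.ofReal_add (by positivity) (by positivity)]
    congr 1
    rw [hsum]
    field_simp
    ring
  calc ENNReal.ofReal (s / (s + r ⬝ᵥ x)) * A * (ENNReal.ofReal (t / (t + r ⬝ᵥ (y - x))) * B)
      = (ENNReal.ofReal (s / (s + r ⬝ᵥ x)) * ENNReal.ofReal (t / (t + r ⬝ᵥ (y - x)))) *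
        (A * B) := by ring
    _ = _ := by rw [hc]; ring

/-- The passage densities form a semigroup: the convolution at `y` splits into two terms, and both
are multiples of `q (s + t + r · y) y`, by the decomposition at the passage of `s` and `t`
respectively. -/
lemma passageDensity_lconvolution {s t : ℝ≥0} (hs0 : 0 < s) (ht0 : 0 < t)
    (hs1 : P.map (crossProcess r X s) = volume.withDensity (passageDensity r q s))
    (ht1 : P.map (crossProcess r X t) = volume.withDensity (passageDensity r q t)) :
    passageDensity r q s ⋆ₗ passageDensity r q t = passageDensity r q (s + t) := by
  ext y
  by_cases hy0 : 0 ≤ y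
  swap
  · rw [hq.passageDensity_eq_zero _ _ hy0, lconvolution_eq_zero (hq.passageDensity_eq_zero _)
      (hq.passageDensity_eq_zero _) _ hy0]
  have hry : 0 ≤ r ⬝ᵥ y := dotProduct_nonneg_of_nonneg hs.nonneg hy0
  have hsR := NNReal.coe_pos.2 hs0
  have htR := NNReal.coe_pos.2 ht0
  obtain ⟨u, hu⟩ : ∃ u : ℝ≥0, (u : ℝ) = s + t + r ⬝ᵥ y :=
    ⟨(s + t + r ⬝ᵥ y).toNNReal, Real.coe_toNNReal _ (by positivity)⟩
  have hu0 : (0 : ℝ) < u := by rw [hu]; positivity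
  have hus : Real.toNNReal (((s + t : ℝ≥0) : ℝ) + r ⬝ᵥ y) = u := by
    rw [NNReal.coe_add, ← hu, Real.toNNReal_coe]
  have e1 := hs.eq_lintegral_passageDensity hq hs1 (u := u) (y := y) (by linarith) hy0
  have e2 := hs.eq_lintegral_passageDensity hq ht1 (u := u) (y := y) (by linarith) hy0
  rw [← lintegral_sub_left_eq_self _ y] at e2
  have hm1 := (hq.measurable_passageDensity_mul (r := r) s u).comp (measurable_prodMk_left (x := y))
  have hm2 := ((hq.measurable_passageDensity_mul (r := r) t u).comp
    (measurable_prodMk_left (x := y))).comp (measurable_const_sub y)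
  simp only [Function.comp_def] at hm1 hm2
  rw [lconvolution_def]
  have key := fun x => hs.passageDensity_mul_passageDensity hq hs0 ht0 x y hu
  simp_rw [neg_add_eq_sub, key]
  rw [lintegral_add_left (hm1.const_mul _), lintegral_const_mul _ hm1, lintegral_const_mul _ hm2,
    ← e1, ← e2, ← add_mul, ← ENNReal.ofReal_add (by positivity) (by positivity), passageDensity,
    hus, NNReal.coe_add, ← hu]
  congr 2
  ring

/-- At every time, the law of the passage process has the density `passageDensity`: the time is
split into two times at which this is known. -/
theorem map_crossProcess {t : ℝ≥0} (ht : 0 < t) :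
    P.map (crossProcess r X t) = volume.withDensity (passageDensity r q t) := by
  have hae : ∀ᵐ x : ℝ, 0 < x → P.map (crossProcess r X x.toNNReal) =
      volume.withDensity (passageDensity r q x.toNNReal) := by
    have h := hs.ae_map_crossProcess hq.measurable fun t ht =>
      hq.hasOrthantDensity hs.regular.measurable ht
    have h' := (ae_restrict_iff' measurableSet_Ioi).1
      (ae_of_ae_map measurable_real_toNNReal.aemeasurable h)
    filter_upwards [h'] with x hx hx0
    rw [hx hx0, withDensity_restrict_orthant (hq.passageDensity_eq_zero _)]
  have hae' := (Measure.measurePreserving_sub_left volume (t : ℝ)).quasiMeasurePreserving.ae hae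
  have hne : (ae (volume.restrict (Ioo 0 (t : ℝ)))).NeBot := by
    rw [ae_neBot, Ne, Measure.restrict_eq_zero, Real.volume_Ioo]
    simpa using ht.ne'
  obtain ⟨x, ⟨hx0, hxt⟩, h1, h2⟩ :=
    ((ae_restrict_mem (measurableSet_Ioo (a := 0) (b := (t : ℝ)))).and
    ((ae_restrict_of_ae hae).and (ae_restrict_of_ae hae'))).exists
  have hsum : x.toNNReal + (t - x).toNNReal = t := by
    rw [← Real.toNNReal_add hx0.le (sub_pos.2 hxt).le, add_sub_cancel, Real.toNNReal_coe]
  have g1 := h1 hx0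
  have g2 := h2 (sub_pos.2 hxt)
  have h := hs.isSubordinator_crossProcess.map_add x.toNNReal (t - x).toNNReal
  rw [g1, g2, conv_withDensity_eq_lconvolution (hq.measurable_passageDensity _)
    (hq.measurable_passageDensity _), hs.passageDensity_lconvolution hq (Real.toNNReal_pos.2 hx0)
    (Real.toNNReal_pos.2 (sub_pos.2 hxt)) g1 g2, hsum] at h
  exact h

end IsPassageReady

end EveryTime

/-! ### Conclusion -/

section Conclusion

variable {Ω : Type*} [MeasurableSpace Ω] {P : Measure Ω} {d : ℕ}
  {X : ℝ≥0 → Ω → (Fin d → ℝ)} {r : Fin d → ℝ}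

lemma volume_dotProduct_eq_one (r : Fin d → ℝ) : volume {x : Fin d → ℝ | r ⬝ᵥ x = 1} = 0 := by
  rcases eq_empty_or_nonempty {x : Fin d → ℝ | r ⬝ᵥ x = 1} with h | ⟨x₀, hx₀⟩
  · rw [h, measure_empty]
  have hx₀ : r ⬝ᵥ x₀ = 1 := hx₀
  set K : Submodule ℝ (Fin d → ℝ) := LinearMap.ker (dotProductBilin ℝ ℝ r) with hK
  have hne : K ≠ ⊤ := fun h => by
    have : x₀ ∈ K := h ▸ Submodule.mem_top
    rw [hK, LinearMap.mem_ker] at this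
    exact one_ne_zero (hx₀.symm.trans this)
  have hset : {x : Fin d → ℝ | r ⬝ᵥ x = 1} = (fun x => x + -x₀) ⁻¹' (K : Set (Fin d → ℝ)) := by
    ext x
    change r ⬝ᵥ x = 1 ↔ r ⬝ᵥ (x + -x₀) = 0
    rw [dotProduct_add, dotProduct_neg, hx₀, ← sub_eq_add_neg, sub_eq_zero]
  rw [hset, measure_preimage_add_right]
  exact Measure.addHaar_submodule _ _ hne

lemma lintegral_dotProduct {V : Ω → Fin d → ℝ} (hV : Measurable V) (hr : 0 ≤ r)
    (hV0 : ∀ᵐ ω ∂P, 0 ≤ V ω) : ∫⁻ ω, ENNReal.ofReal (r ⬝ᵥ V ω) ∂P =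
      ∑ i, ENNReal.ofReal (r i) * ∫⁻ ω, ENNReal.ofReal (V ω i) ∂P := by
  have h : ∀ i, ENNReal.ofReal (r i) * ∫⁻ ω, ENNReal.ofReal (V ω i) ∂P =
      ∫⁻ ω, ENNReal.ofReal (r i) * ENNReal.ofReal (V ω i) ∂P := fun i =>
    (lintegral_const_mul _ (by fun_prop)).symm
  simp_rw [h]
  rw [← lintegral_finsetSum _ (by fun_prop)]
  refine lintegral_congr_ae ?_
  filter_upwards [hV0] with ω hω
  rw [dotProduct, ENNReal.ofReal_sum_of_nonneg fun i _ => mul_nonneg (hr i) (hω i)]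
  exact Finset.sum_congr rfl fun i _ => ENNReal.ofReal_mul (hr i)

lemma HasOrthantDensity.congr_ae {V V' : Ω → Fin d → ℝ} {f : (Fin d → ℝ) → ℝ≥0∞}
    (h : HasOrthantDensity P V f) (hV : V' =ᵐ[P] V) : HasOrthantDensity P V' f :=
  ⟨h.aemeasurable, ⟨h.hasLaw.aemeasurable.congr hV.symm, by
    rw [Measure.map_congr hV, h.hasLaw.map_eq]⟩⟩

lemma HasOrthantDensity.congr {V : Ω → Fin d → ℝ} {f g : (Fin d → ℝ) → ℝ≥0∞}
    (h : HasOrthantDensity P V f) (hfg : ∀ y, 0 ≤ y → g y = f y) : HasOrthantDensity P V g := by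
  have hae : g =ᵐ[volume.restrict (Ici 0)] f := by
    filter_upwards [ae_restrict_mem measurableSet_Ici] with y hy using hfg y hy
  exact ⟨h.aemeasurable.congr hae.symm, ⟨h.hasLaw.aemeasurable, by
    rw [h.hasLaw.map_eq, withDensity_congr_ae hae]⟩⟩

lemma IsTransitionDensity.congr_ae {X' : ℝ≥0 → Ω → (Fin d → ℝ)}
    {p : ℝ≥0 → (Fin d → ℝ) → ℝ≥0∞} (hp : IsTransitionDensity P X p)
    (h : ∀ t, X' t =ᵐ[P] X t) : IsTransitionDensity P X' p :=
  ⟨fun t ht => (hp.density t ht).congr_ae (h t), hp.chapman_kolmogorov⟩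

lemma laplaceExponent_congr_ae {X' : ℝ≥0 → Ω → (Fin d → ℝ)} (h : X' 1 =ᵐ[P] X 1) :
    laplaceExponent P X' = laplaceExponent P X := by
  ext z
  have : ∫⁻ ω, lexp z (X' 1 ω) ∂P = ∫⁻ ω, lexp z (X 1 ω) ∂P :=
    lintegral_congr_ae (h.fun_comp (lexp z))
  rw [laplaceExponent, laplaceExponent, this]

variable [IsProbabilityMeasure P]

/-- A subordinator with subcritical mean is indistinguishable from one all of whose paths are
regular and such that `u - r · X_u` exceeds every level. -/
lemma IsSubordinator.exists_isPassageReady (hX : IsSubordinator P X)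
    (hXac : ∀ t, 0 < t → P.map (X t) ≪ volume) (hr : 0 ≤ r)
    (hmean : ∑ i, ENNReal.ofReal (r i) * ∫⁻ ω, ENNReal.ofReal (X 1 ω i) ∂P ≤ 1) :
    ∃ X' : ℝ≥0 → Ω → (Fin d → ℝ), IsPassageReady P X' r ∧ ∀ᵐ ω ∂P, ∀ t, X' t ω = X t ω := by
  have hsub : ∀ {X' : ℝ≥0 → Ω → (Fin d → ℝ)}, (∀ᵐ ω ∂P, ∀ t, X' t ω = X t ω) →
      IsSubcritical P X' r := fun {X'} h => by
    refine ⟨hr, ?_, ?_⟩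
    · rw [lintegral_congr_ae (g := fun ω => ENNReal.ofReal (r ⬝ᵥ X 1 ω))
        (by filter_upwards [h] with ω hω; rw [hω]),
        lintegral_dotProduct (hX.measurable 1) hr (hX.ae_nonneg.mono fun ω hω => hω 1)]
      exact hmean
    · have h1 : ∀ᵐ x ∂(P.map (X 1)), r ⬝ᵥ x ≠ 1 :=
        (hXac 1 one_pos).ae_le
        (measure_eq_zero_iff_ae_notMem.1 (volume_dotProduct_eq_one r))
      filter_upwards [ae_of_ae_map (hX.measurable 1).aemeasurable h1, h] with ω h2 h3
      rwa [h3]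
  obtain ⟨X₁, hX₁, h₁, -⟩ := hX.exists_regular (Q := fun _ => True) (ae_of_all _ fun _ => trivial)
  obtain ⟨X', hX', h', hQ⟩ := hX.exists_regular
    (Q := fun ω => ∀ t : ℝ, ∃ k : ℕ, t < reservoir r X k ω) (by
      filter_upwards [(hsub h₁).ae_exceeds hX₁, h₁] with ω h2 h3
      simpa only [reservoir, h3] using h2)
  refine ⟨X', ⟨hsub h', hX', fun ω t => ?_⟩, h'⟩
  rcases hQ ω with h0 | ⟨h1, h2⟩
  · obtain ⟨k, hk⟩ := exists_nat_gt t
    exact ⟨k, by simpa [reservoir, h0] using hk⟩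
  · simpa only [reservoir, h2] using h1 t

/-- The functional equation of the Laplace exponents. -/
theorem IsPassageReady.laplaceExponent_crossProcess (hs : IsPassageReady P X r) {z : Fin d → ℝ}
    (hz : 0 ≤ z) :
    laplaceExponent P (crossProcess r X) z =
      laplaceExponent P X (z + laplaceExponent P (crossProcess r X) z • r) := by
  obtain ⟨c, hc0, hc⟩ := hs.exists_laplaceExponent_eq hs.regular hz
  have h : laplaceExponent P (crossProcess r X) z = c := by
    rw [laplaceExponent, hs.lintegral_lexp_crossProcess hz hc0 hc,
      ENNReal.toReal_ofReal (Real.exp_nonneg _), Real.log_exp]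
    simp
  rw [h, hc]

end Conclusion

theorem corollary3472 {Ω : Type*} [MeasurableSpace Ω] (P : Measure Ω) [IsProbabilityMeasure P]
    {d : ℕ} (X : ℝ≥0 → Ω → (Fin d → ℝ)) (hX : IsSubordinator P X)
    (hXac : ∀ t, 0 < t → P.map (X t) ≪ volume)
    (r : Fin d → ℝ) (hr : 0 ≤ r)
    (hmean : ∑ i, ENNReal.ofReal (r i) * ∫⁻ ω, ENNReal.ofReal (X 1 ω i) ∂P ≤ 1) :
    -- the first passage times are finite
    (∀ᵐ ω ∂P, ∀ t, firstPassageTime (reservoir r X) t ω ≠ ∞) ∧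
    -- `Y` is a subordinator, up to modification
    (∃ Y' : ℝ≥0 → Ω → (Fin d → ℝ), IsSubordinator P Y' ∧
      ∀ t, passageProcess r X t =ᵐ[P] Y' t) ∧
    -- the law of `Y` is absolutely continuous
    (∀ t, 0 < t → P.map (passageProcess r X t) ≪ volume) ∧
    -- the density formula at every `t > 0`, for the canonical densities of `X`, which exist
    (∃ p, IsTransitionDensity P X p) ∧
    (∀ p, IsTransitionDensity P X p →
      ∀ t, 0 < t → HasOrthantDensity P (passageProcess r X t) (passageDensity r p t)) ∧
    -- the density formula at almost every `t > 0`, for arbitrary measurable densities of `X`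
    (∀ p : ℝ≥0 → (Fin d → ℝ) → ℝ≥0∞, Measurable (Function.uncurry p) →
      (∀ t, 0 < t → HasOrthantDensity P (X t) (p t)) →
      ∀ᵐ t ∂(volume.restrict (Ioi (0 : ℝ))),
        HasOrthantDensity P (passageProcess r X t.toNNReal) (passageDensity r p t.toNNReal)) ∧
    -- the Laplace exponents of `X` and `Y`
    (∃ φX φY : (Fin d → ℝ) → ℝ, IsLaplaceExponent P X φX ∧
      IsLaplaceExponent P (passageProcess r X) φY ∧
      ∀ z, 0 ≤ z → φY z = φX (z + φY z • r)) := by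
  obtain ⟨X', hs, hXX'⟩ := hX.exists_isPassageReady hXac hr hmean
  have hXt : ∀ t, X' t =ᵐ[P] X t := fun t => hXX'.mono fun ω hω => hω t
  have hτ : ∀ᵐ ω ∂P, ∀ t,
      firstPassageTime (reservoir r X) t ω = firstPassageTime (reservoir r X') t ω := by
    filter_upwards [hXX'] with ω hω t
    simp only [firstPassageTime, reservoir, hω]
  have hY : ∀ t, passageProcess r X t =ᵐ[P] crossProcess r X' t := fun t => by
    refine Filter.EventuallyEq.trans ?_ (hs.passageProcess_ae_eq t)
    filter_upwards [hXX', hτ] with ω h1 h2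
    rw [passageProcess, passageProcess, h2, h1]
  have hac' : ∀ t, 0 < t → P.map (X' t) ≪ volume := fun t ht => by
    rw [Measure.map_congr (hXt t)]
    exact hXac t ht
  obtain ⟨q, hq⟩ := exists_isSemigroupDensity hs.regular hac'
  have hXm := hs.regular.measurable
  refine ⟨?_, ⟨crossProcess r X', hs.isSubordinator_crossProcess, hY⟩, fun t ht => ?_,
    ⟨q, (hq.isTransitionDensity hXm).congr_ae fun t => (hXt t).symm⟩, fun p hp t ht => ?_,
    fun p hpm hp => ?_, laplaceExponent P X, laplaceExponent P (crossProcess r X'),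
    hX.isLaplaceExponent, fun t z hz => ?_, fun z hz => ?_⟩
  · filter_upwards [hτ] with ω hω t
    rw [hω t]
    exact ne_top_of_le_ne_top ENNReal.coe_ne_top (hs.firstPassageTime_le_crossTime t ω)
  · rw [Measure.map_congr (hY t), hs.map_crossProcess hq ht]
    exact withDensity_absolutelyContinuous _ _
  · have h := hasOrthantDensity_of_map_eq (hs.measurable_crossProcess t).aemeasurable
      (hq.measurable_passageDensity t).aemeasurable (hq.passageDensity_eq_zero t)
      (hs.map_crossProcess hq ht)
    refine (h.congr_ae (hY t)).congr fun y hy => ?_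
    have hpos : 0 < ((t : ℝ) + r ⬝ᵥ y).toNNReal := by
      rw [Real.toNNReal_pos]
      exact add_pos_of_pos_of_nonneg ht (dotProduct_nonneg_of_nonneg hr hy)
    rw [passageDensity, passageDensity, hq.eq_of_isTransitionDensity (hp.congr_ae hXt) hpos hy]
  · have h := hs.ae_map_crossProcess hpm fun t ht => (hp t ht).congr_ae (hXt t)
    filter_upwards [ae_of_ae_map measurable_real_toNNReal.aemeasurable h] with t ht
    refine HasOrthantDensity.congr_ae ?_ (hY _)
    exact ⟨(measurable_passageDensity hpm).of_uncurry_left.aemeasurable,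
      ⟨(hs.measurable_crossProcess _).aemeasurable, ht⟩⟩
  · rw [← hs.isSubordinator_crossProcess.isLaplaceExponent t z hz]
    exact integral_congr_ae ((hY t).fun_comp fun x => Real.exp (-(z ⬝ᵥ x)))
  · rw [← laplaceExponent_congr_ae (hXt 1)]
    exact hs.laplaceExponent_crossProcess hz
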